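/- Let $L\subset\mathbb C$ be a lattice (a discrete subgroup of rank $2$) with real $j$-invariant $j(L)=1728\,g_2(L)^3/(g_2(L)^3-27g_3(L)^2)$, where $g_2(L)=60\sum_{0\ne l\in L}l^{-4}$ and $g_3(L)=140\sum_{0\neq l\in L}l^{-6}$. Let $\mathcal O_L=\{m\in\mathbb C: mL\subseteq L\}$ be its ring of multipliers, and suppose that $\mathcal O_L=\mathbb Z\big[f\,\tfrac{d_K+\sqrt{d_K}}{2}\big]$ is the order of conductor $f\ge 1$ in an imaginary quadratic field $K$ of discriminant $d_K$, and that $\mathcal O_L$ is different from $\mathbb Z$, $\mathbb Z[i]$ and $\mathbb Z\big[\tfrac{1-\sqrt{-3}}{2}\big]$. Put $d_L=f^2d_K$. For $k\in\{1,2\}$ and $z\in\mathbb C$ let $$E_k(z)=\sum_{l\in L,\ l+z\neq0}(l+z)^{-k}|l+z|^{-s}\Big|_{s=0},$$ where the value at $s=0$ is taken by analytic continuation in $s$. For $a,c\in\mathcal O_L$ with $c\ne0$ define the elliptic Dedekind sum and the normalized elliptic Dedekind sum by $$D_L(a,c)=\frac1c\sum_{\mu\in L/cL}E_1\Big(\frac{a\mu}{c}\Big)E_1\Big(\frac{\mu}{c}\Big),\qquad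 \tilde D_L(a,c)=\big(i\sqrt{|d_L|}\,E_2(0)\big)^{-1}D_L(a,c).$$ Then all the values $\tilde D_L(a,c)$ with $a,c\in\mathcal O_L$, $c\neq0$, are real, and the set of these values is dense in $\mathbb R$. -/

import Mathlib

open Complex

noncomputable section

namespace EllipticDedekind

/-- The ring of multipliers `{m ∈ ℂ : m Λ ⊆ Λ}` of an additive subgroup `Λ` of `ℂ`. -/
def multiplierRing (Λ : Submodule ℤ ℂ) : Subring ℂ where
  carrier := {m | ∀ l ∈ Λ, m * l ∈ Λ}
  mul_mem' {a b} ha hb l hl := by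
    rw [mul_assoc]
    exact ha _ (hb l hl)
  one_mem' l hl := by simpa using hl
  add_mem' {a b} ha hb l hl := by
    rw [add_mul]
    exact Λ.add_mem (ha l hl) (hb l hl)
  zero_mem' l _ := by simp
  neg_mem' {a} ha l hl := by
    rw [neg_mul]
    exact Λ.neg_mem (ha l hl)

/-- The `j`-invariant `1728 g₂³ / (g₂³ - 27 g₃²)` of a lattice. -/
def jInvariant (L : PeriodPair) : ℂ :=
  1728 * L.g₂ ^ 3 / (L.g₂ ^ 3 - 27 * L.g₃ ^ 2)

/-- `v` is the value at `0` of the analytic continuation of the restriction of `f` to the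
half-plane `Re s > 2`: that restriction extends holomorphically to a half-plane
`Re s > -ε` with `ε > 0`, and the extension takes the value `v` at `0`. -/
def HasContinuedValueAtZero (f : ℂ → ℂ) (v : ℂ) : Prop :=
  ∃ ε : ℝ, 0 < ε ∧ ∃ F : ℂ → ℂ, DifferentiableOn ℂ F {s | -ε < s.re} ∧
    (∀ s : ℂ, 2 < s.re → F s = f s) ∧ F 0 = v

/-- The continued value at `0` is unique. -/
theorem HasContinuedValueAtZero.unique {f : ℂ → ℂ} {v w : ℂ}
    (hv : HasContinuedValueAtZero f v) (hw : HasContinuedValueAtZero f w) : v = w := by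
  obtain ⟨ε, hε, F, hF, hFf, rfl⟩ := hv
  obtain ⟨δ, hδ, G, hG, hGf, rfl⟩ := hw
  set U : Set ℂ := {s | -(min ε δ) < s.re} with hU
  have hUo : IsOpen U := isOpen_lt continuous_const Complex.continuous_re
  have hUc : IsPreconnected U := (convex_halfSpace_re_gt _).isPreconnected
  have hFU : AnalyticOnNhd ℂ F U :=
    (hF.mono fun s hs => show -ε < s.re from
      lt_of_le_of_lt (neg_le_neg (min_le_left ε δ)) hs).analyticOnNhd hUo
  have hGU : AnalyticOnNhd ℂ G U :=
    (hG.mono fun s hs => show -δ < s.re from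
      lt_of_le_of_lt (neg_le_neg (min_le_right ε δ)) hs).analyticOnNhd hUo
  have hm : 0 < min ε δ := lt_min hε hδ
  have h3 : (3 : ℂ) ∈ U := by simp only [hU, Set.mem_ofPred_eq, Complex.re_ofNat]; linarith
  have h0 : (0 : ℂ) ∈ U := by simp only [hU, Set.mem_ofPred_eq, Complex.zero_re]; linarith
  refine hFU.eqOn_of_preconnected_of_eventuallyEq hGU hUc h3 ?_ h0
  have h2 : {s : ℂ | 2 < s.re} ∈ nhds (3 : ℂ) :=
    (isOpen_lt continuous_const Complex.continuous_re).mem_nhds (by simp; norm_num)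
  filter_upwards [h2] with s hs
  rw [hFf s hs, hGf s hs]

open scoped Classical in
/-- The value at `0` of the analytic continuation of `f` from `Re s > 2`. -/
def continuedValueAtZero (f : ℂ → ℂ) : ℂ :=
  if h : ∃ v, HasContinuedValueAtZero f v then h.choose else 0

theorem HasContinuedValueAtZero.eq {f : ℂ → ℂ} {v : ℂ} (hv : HasContinuedValueAtZero f v) :
    continuedValueAtZero f = v := by
  have h : ∃ v, HasContinuedValueAtZero f v := ⟨v, hv⟩
  rw [continuedValueAtZero, dif_pos h]
  exact h.choose_spec.unique hv

open scoped Classical in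
/-- The series `∑ (l + z)⁻ᵏ |l + z|⁻ˢ` over the `l ∈ Λ` with `l + z ≠ 0`. For a lattice `Λ` and
`k ≥ 0` it converges absolutely on `Re s > 2`. -/
def eisensteinSeries (Λ : Submodule ℤ ℂ) (k : ℕ) (z s : ℂ) : ℂ :=
  ∑' l : Λ, if (l : ℂ) + z = 0 then 0 else
    (((l : ℂ) + z) ^ k)⁻¹ * ((‖(l : ℂ) + z‖ : ℝ) : ℂ) ^ (-s)

/-- `E_k(z) = ∑ (l + z)⁻ᵏ |l + z|⁻ˢ` at `s = 0`, by analytic continuation in `s`. -/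
def E (Λ : Submodule ℤ ℂ) (k : ℕ) (z : ℂ) : ℂ :=
  continuedValueAtZero (eisensteinSeries Λ k z)

/-- `E_k` is periodic with respect to `Λ`. -/
theorem E_add_mem (Λ : Submodule ℤ ℂ) (k : ℕ) (z : ℂ) {m : ℂ} (hm : m ∈ Λ) :
    E Λ k (z + m) = E Λ k z := by
  unfold E
  congr 1
  funext s
  unfold eisensteinSeries
  rw [← (Equiv.addRight (⟨m, hm⟩ : Λ)).tsum_eq
    (fun l : Λ => if (l : ℂ) + z = 0 then 0 else
      (((l : ℂ) + z) ^ k)⁻¹ * ((‖(l : ℂ) + z‖ : ℝ) : ℂ) ^ (-s))]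
  refine tsum_congr fun l => ?_
  have h : (l : ℂ) + (z + m) = (((Equiv.addRight (⟨m, hm⟩ : Λ)) l : Λ) : ℂ) + z := by
    simp; ring
  rw [h]

/-- Multiplication by an element of the multiplier ring, as an endomorphism of `Λ`. -/
def mulEnd (Λ : Submodule ℤ ℂ) (k : multiplierRing Λ) : Λ →ₗ[ℤ] Λ where
  toFun l := ⟨(k : ℂ) * l, k.2 l l.2⟩
  map_add' x y := by ext; simp [mul_add]
  map_smul' n x := by ext; simp; ring

/-- The summand `E₁(h μ / k) E₁(μ / k)` of the elliptic Dedekind sum, as a function on `Λ / k Λ`. -/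
def dedekindSummand (Λ : Submodule ℤ ℂ) (h k : multiplierRing Λ)
    (μ : Λ ⧸ LinearMap.range (mulEnd Λ k)) : ℂ :=
  Quotient.liftOn' μ
    (fun m : Λ => E Λ 1 ((h : ℂ) * m / k) * E Λ 1 ((m : ℂ) / k)) <| by
      intro x y hxy
      rw [Submodule.quotientRel_def] at hxy
      obtain ⟨l, hl⟩ := hxy
      have hl' : (k : ℂ) * l = (x : ℂ) - y := congrArg Subtype.val hl
      by_cases hk : (k : ℂ) = 0
      · simp [hk]
      · have hx : (x : ℂ) = y + k * l := by rw [hl']; ring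
        have h1 : (x : ℂ) / k = (y : ℂ) / k + l := by rw [hx]; field_simp
        have h2 : (h : ℂ) * x / k = (h : ℂ) * y / k + h * l := by rw [hx]; field_simp
        simp only [h1, h2, E_add_mem Λ 1 _ l.2, E_add_mem Λ 1 _ (h.2 l l.2)]

/-- The elliptic Dedekind sum `D_Λ(h, k) = (1 / k) ∑_{μ ∈ Λ / k Λ} E₁(h μ / k) E₁(μ / k)`.
The index set is finite when `Λ` is a lattice and `k ≠ 0`. -/
def D (Λ : Submodule ℤ ℂ) (h k : multiplierRing Λ) : ℂ :=
  1 / (k : ℂ) * ∑ᶠ μ : Λ ⧸ LinearMap.range (mulEnd Λ k), dedekindSummand Λ h k μ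

/-- The normalized elliptic Dedekind sum `(i √|d| E₂(0))⁻¹ D_Λ(a, c)`, where `d` is the
discriminant of the multiplier ring. -/
def normalizedD (Λ : Submodule ℤ ℂ) (d : ℤ) (a c : multiplierRing Λ) : ℂ :=
  (I * (Real.sqrt |(d : ℝ)| : ℂ) * E Λ 2 0)⁻¹ * D Λ a c

end EllipticDedekind

end

open Complex

noncomputable section

namespace EllipticDedekind

open Filter Topology Asymptotics

/-! Everything rests on explicit values of elliptic Dedekind sums. The addition theorem
`E_one_add_sq`, (E₁(u) + E₁(v) - E₁(u+v))² = ℘(u) + ℘(v) + ℘(u+v), summed over u in the h-torsion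
and v in the k-torsion of ℂ/L for coprime h and k, gives the reciprocity law `D_reciprocity`: D(h,k)
+ D(k,h) = E₂(0)(x - x̄) with x = h/k + k/h + 1/(hk). If p r = 1 + q², then q acts on the p-torsion
as a square root of -1, so oddness of E₁ forces D(q,p) = 0, and reciprocity leaves D(p,q) = E₂(0) ·
2i · Im((p+r)/q).

Density: for coprime a, c complete the column (a, c) to a matrix γ of determinant 1. The entries p,
q, r of γγᵀ satisfy p r = 1 + q². As the second column runs off to infinity along multiples of the
first, (p+r)/q tends to a/c + c/a, so 2|d_L|^(-1/2) Im(a/c + c/a) is a limit of values. The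
fractions a/c = (1+2x)/2ⁿ are dense in ℂ, and Im(z + 1/z) takes every real value on the positive
imaginary axis. This needs E₂(0) ≠ 0, which is `E_two_ne_zero`: the q-expansion shows that in the
fundamental domain E₂(0) vanishes only at i and at the two corners, that is, for the two excluded
orders.

Reality: Hecke's functional equation identifies E₁(w) with the value at 0 of the series of ψ(l,w)/l,
for a perfect pairing ψ on the torus. Hence E₁ has a finite Fourier expansion at torsion points,
which gives D(ā, c̄) = -D(a,c) (`D_conj_conj`). A real j-invariant makes L homothetic to its
conjugate, because g₂ and g₃ determine the lattice; comparing complex conjugates then shows that the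
normalized sums are real (`normalizedD_real`).

The analytic input is E₁(z) = ζ(z) - E₂(0) z - B z̄ with B ≠ 0. It yields the addition theorem
through Liouville's theorem, and the torsion sums of ℘ through the distribution relation. -/

/-! ### Poisson summation and the theta functional equation -/

/-- Poisson summation for a complex shifted Gaussian. -/
lemma tsum_gaussian {b : ℝ} (hb : 0 < b) (z : ℂ) :
    ∑' j : ℤ, cexp (-Real.pi / b * (j + z) ^ 2) =
      (b : ℂ) ^ (1 / 2 : ℂ) * ∑' m : ℤ, cexp (-Real.pi * b * m ^ 2 + 2 * Real.pi * I * m * z) := by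
  have h := Complex.tsum_exp_neg_quadratic (a := (b : ℂ)) (by simpa using hb) (-I * z)
  have hne : (b : ℂ) ^ (1 / 2 : ℂ) ≠ 0 := by
    rw [Ne, Complex.cpow_eq_zero_iff]; simp [hb.ne']
  have h2 : ∀ n : ℤ, (n : ℂ) + I * (-I * z) = n + z := fun n => by
    linear_combination (-z) * I_sq
  simp only [h2] at h
  rw [← (Equiv.neg ℤ).tsum_eq (fun m : ℤ => cexp (-Real.pi * b * m ^ 2 + 2 * Real.pi * I * m * z))]
  rw [show (fun c : ℤ => cexp (-Real.pi * b * ((Equiv.neg ℤ c : ℤ) : ℂ) ^ 2 +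
    2 * Real.pi * I * ((Equiv.neg ℤ c : ℤ) : ℂ) * z)) =
    fun n : ℤ => cexp (-↑Real.pi * ↑b * ↑n ^ 2 + 2 * ↑Real.pi * (-I * z) * ↑n) from ?_, h]
  · rw [← mul_assoc, mul_one_div_cancel hne, one_mul]
  · funext n; congr 1; simp; ring

/-- Merges the square-root factors of two one-dimensional Poisson summations, as in √(y/t) ·
√(1/(ty)) = 1/t. -/
lemma sq_cpow_half {a b c : ℝ} (ha : 0 < a) (hb : 0 < b) (hc : 0 < c) (h : a * b = c ^ 2) :
    (a : ℂ) ^ (1 / 2 : ℂ) * (b : ℂ) ^ (1 / 2 : ℂ) = c := by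
  rw [← mul_cpow_ofReal_nonneg ha.le hb.le, ← ofReal_mul, h]
  rw [show (1 / 2 : ℂ) = ((1 / 2 : ℝ) : ℂ) by push_cast; ring, ← ofReal_cpow (by positivity),
    ← Real.sqrt_eq_rpow, Real.sqrt_sq hc.le]

lemma summable_gaussian_linear {c : ℝ} (hc : 0 < c) (d : ℝ) :
    Summable fun n : ℤ => Real.exp (-c * n ^ 2 + d * |(n : ℝ)|) := by
  have h := summable_pow_mul_jacobiTheta₂_term_bound (d / (2 * Real.pi))
    (T := c / Real.pi) (by positivity) 0
  refine h.congr fun n => ?_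
  simp only [pow_zero, one_mul]
  congr 1
  have := Real.pi_pos.ne'
  push_cast
  field_simp
  ring

/-- Two-dimensional Poisson summation for the Gaussian on the lattice `ℤ τ + ℤ`, with the
holomorphic and the antiholomorphic coordinate of the shift treated as independent. -/
lemma tsum_lattice_gaussian {τ : ℂ} (hτ : 0 < τ.im) {t : ℝ} (ht : 0 < t) (p q : ℂ)
    (hs1 : Summable fun x : ℤ × ℤ => cexp (-(Real.pi * t / τ.im) *
      ((p + (x.1 * τ + x.2)) * (q + (x.1 * star τ + x.2)))))
    (hs2 : Summable fun x : ℤ × ℤ => cexp (-(Real.pi / (t * τ.im)) *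
      ((x.1 * τ + x.2) * (x.1 * star τ + x.2)) +
      Real.pi / τ.im * ((x.1 * τ + x.2) * q - (x.1 * star τ + x.2) * p))) :
    ∑' x : ℤ × ℤ, cexp (-(Real.pi * t / τ.im) *
      ((p + (x.1 * τ + x.2)) * (q + (x.1 * star τ + x.2)))) =
    1 / t * ∑' x : ℤ × ℤ, cexp (-(Real.pi / (t * τ.im)) *
      ((x.1 * τ + x.2) * (x.1 * star τ + x.2)) +
      Real.pi / τ.im * ((x.1 * τ + x.2) * q - (x.1 * star τ + x.2) * p)) := by
  rw [hs1.tsum_prod, hs2.tsum_prod]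
  set y := τ.im with hy
  set x := τ.re with hx
  have hy0 : (y : ℂ) ≠ 0 := ofReal_ne_zero.mpr hτ.ne'
  have ht0 : (t : ℂ) ≠ 0 := ofReal_ne_zero.mpr ht.ne'
  have hτe : τ = x + y * I := (re_add_im τ).symm
  have hτs : star τ = x - y * I := by
    rw [hτe]; simp [sub_eq_add_neg]
  -- With σ the mean and δ the half difference of p + mτ and q + mτ̄, the product in the exponent is
  -- (n + σ)² - δ². Poisson summation in n alone turns the left side into the mixed sum over (m, k)
  -- of `A`.
  set A : ℤ → ℤ → ℂ := fun m k => cexp (Real.pi * t / (4 * y) * (p - q + 2 * m * y * I) ^ 2 +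
    (-Real.pi * (y / t) * k ^ 2 + 2 * Real.pi * I * k * ((p + q) / 2 + m * x))) with hA
  have step1 : ∀ m : ℤ, ∑' n : ℤ, cexp (-(Real.pi * t / y) *
      ((p + (m * τ + n)) * (q + (m * star τ + n)))) =
      ((y / t : ℝ) : ℂ) ^ (1 / 2 : ℂ) * ∑' k : ℤ, A m k := by
    intro m
    have h := tsum_gaussian (b := y / t) (by positivity) ((p + q) / 2 + m * x)
    have e1 : ∀ n : ℤ, cexp (-(Real.pi * t / y) * ((p + (m * τ + n)) * (q + (m * star τ + n)))) =
        cexp (Real.pi * t / (4 * y) * (p - q + 2 * m * y * I) ^ 2) *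
        cexp (-Real.pi / ((y / t : ℝ) : ℂ) * (n + ((p + q) / 2 + m * x)) ^ 2) := by
      intro n
      rw [← Complex.exp_add]
      congr 1
      rw [hτs, hτe]
      push_cast
      field_simp
      ring_nf
      try simp only [I_sq]
      try ring_nf
    simp_rw [e1]
    rw [tsum_mul_left, h, ← mul_assoc, mul_comm (cexp _), mul_assoc, ← tsum_mul_left]
    congr 1
    refine tsum_congr fun k => ?_
    rw [hA, ← Complex.exp_add]
    push_cast
    rfl
  -- Poisson summation in m, read from the Gaussian sum over m back to the sum over j, takes the
  -- same mixed sum to the right side.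
  have step2 : ∀ k : ℤ, ∑' m : ℤ, A m k = ((1 / (t * y) : ℝ) : ℂ) ^ (1 / 2 : ℂ) *
      ∑' j : ℤ, cexp (-(Real.pi / (t * y)) * ((k * τ + j) * (k * star τ + j)) +
      Real.pi / y * ((k * τ + j) * q - (k * star τ + j) * p)) := by
    intro k
    have h := tsum_gaussian (b := t * y) (by positivity) (t * (p - q) / 2 + k * x)
    have e1 : ∀ m : ℤ, A m k = cexp (Real.pi * t / (4 * y) * (p - q) ^ 2 - Real.pi * (y / t) * k ^ 2
        + Real.pi * I * k * (p + q)) * cexp (-Real.pi * ((t * y : ℝ) : ℂ) * m ^ 2 +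
          2 * Real.pi * I * m * (t * (p - q) / 2 + k * x)) := by
      intro m
      rw [hA, ← Complex.exp_add]
      push_cast
      field_simp
      ring_nf
      try simp only [I_sq]
      try ring_nf
    have e2 : ∀ j : ℤ, cexp (-(Real.pi / (t * y)) * ((k * τ + j) * (k * star τ + j)) +
      Real.pi / y * ((k * τ + j) * q - (k * star τ + j) * p)) =
        cexp (Real.pi * t / (4 * y) * (p - q) ^ 2 - Real.pi * (y / t) * k ^ 2
        + Real.pi * I * k * (p + q)) *
        cexp (-Real.pi / ((t * y : ℝ) : ℂ) * (j + (t * (p - q) / 2 + k * x)) ^ 2) := by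
      intro j
      rw [← Complex.exp_add]
      congr 1
      rw [hτs, hτe]
      push_cast
      field_simp
      ring_nf
      try simp only [I_sq]
      try ring_nf
    simp_rw [e1, e2]
    rw [tsum_mul_left, tsum_mul_left, h]
    have h3 := sq_cpow_half (a := 1 / (t * y)) (b := t * y) (c := 1) (by positivity)
      (by positivity) one_pos (by field_simp)
    rw [mul_left_comm, ← mul_assoc _ ((↑(t * y) : ℂ) ^ (1 / 2 : ℂ)), h3]
    simp
  -- Absolute summability of the mixed sum licenses the exchange of m and k. The imaginary parts of
  -- p - q and p + q only contribute linear terms against the Gaussians.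
  have hsA : Summable (Function.uncurry A) := by
    have hp := Summable.mul_of_nonneg
      (summable_gaussian_linear (c := Real.pi * t * y) (by positivity)
        (Real.pi * t * |(p - q).im|))
      (summable_gaussian_linear (c := Real.pi * (y / t)) (by positivity) (Real.pi * |(p + q).im|))
      (fun _ => (Real.exp_pos _).le) (fun _ => (Real.exp_pos _).le)
    refine Summable.of_norm_bounded (hp.mul_left (‖cexp (Real.pi * t / (4 * y) * (p - q) ^ 2)‖)) ?_
    rintro ⟨m, k⟩
    simp only [Function.uncurry, hA]
    have e1 : Real.pi * t / (4 * y) * (p - q + 2 * m * y * I) ^ 2 +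
        (-Real.pi * (y / t) * k ^ 2 + 2 * Real.pi * I * k * ((p + q) / 2 + m * x)) =
        Real.pi * t / (4 * y) * (p - q) ^ 2 + (((-(Real.pi * t * y) * m ^ 2 : ℝ) : ℂ) +
          ((Real.pi * t * m : ℝ) : ℂ) * ((p - q) * I)) + (((-(Real.pi * (y / t)) * k ^ 2 : ℝ) : ℂ) +
          ((Real.pi * k : ℝ) : ℂ) * ((p + q) * I)) + ((2 * Real.pi * k * m * x : ℝ) : ℂ) * I := by
      push_cast
      field_simp
      ring_nf
      try simp only [I_sq]
      try ring_nf
    rw [e1, Complex.exp_add, Complex.exp_add, Complex.exp_add, norm_mul, norm_mul, norm_mul,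
      norm_exp_ofReal_mul_I, mul_one, mul_assoc]
    refine mul_le_mul_of_nonneg_left ?_ (norm_nonneg _)
    refine mul_le_mul ?_ ?_ (norm_nonneg _) (Real.exp_pos _).le
    · rw [Complex.norm_exp, Real.exp_le_exp, add_re, ofReal_re, re_ofReal_mul, mul_I_re]
      have : -(m * (p - q).im) ≤ |(p - q).im| * |(m : ℝ)| := by
        rw [← abs_mul, mul_comm]; exact neg_le_abs _
      nlinarith [mul_pos Real.pi_pos ht]
    · rw [Complex.norm_exp, Real.exp_le_exp, add_re, ofReal_re, re_ofReal_mul, mul_I_re]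
      have : -(k * (p + q).im) ≤ |(p + q).im| * |(k : ℝ)| := by
        rw [← abs_mul, mul_comm]; exact neg_le_abs _
      nlinarith [Real.pi_pos]
  simp_rw [step1]
  rw [tsum_mul_left, ← Summable.tsum_comm hsA]
  simp_rw [step2]
  rw [tsum_mul_left, ← mul_assoc]
  congr 1
  rw [sq_cpow_half (c := 1 / t) (by positivity) (by positivity) (by positivity) (by field_simp)]
  push_cast; rfl

lemma pow_mul_exp_le {c : ℝ} (hc : 0 < c) (d : ℝ) (k : ℕ) :
    ∃ K : ℝ, 0 < K ∧ ∀ X : ℝ, 0 ≤ X → X ^ k * Real.exp (-c * X ^ 2 + d * X) ≤ K := by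
  set a := c / 2 with ha
  have ha0 : 0 < a := by positivity
  refine ⟨(1 + k.factorial / a ^ k) * Real.exp (d ^ 2 / (2 * c)), by positivity, fun X hX => ?_⟩
  have h1 : -c * X ^ 2 + d * X ≤ -(a * X ^ 2) + d ^ 2 / (2 * c) := by
    have : 0 ≤ (c * X - d) ^ 2 / (2 * c) := by positivity
    have e : (c * X - d) ^ 2 / (2 * c) = c * X ^ 2 / 2 - d * X + d ^ 2 / (2 * c) := by
      field_simp; ring
    rw [e] at this
    rw [ha]; nlinarith
  have h2 : X ^ k ≤ (1 + k.factorial / a ^ k) * Real.exp (a * X ^ 2) := by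
    have h3 := Real.pow_div_factorial_le_exp (a * X ^ 2) (by positivity) k
    have h4 : (X ^ 2) ^ k ≤ k.factorial / a ^ k * Real.exp (a * X ^ 2) := by
      rw [mul_pow, div_le_iff₀ (by positivity)] at h3
      rw [div_mul_eq_mul_div, le_div_iff₀ (by positivity)]
      linarith
    have h5 : X ^ k ≤ 1 + (X ^ 2) ^ k := by
      rw [← pow_mul, mul_comm 2 k, pow_mul]
      nlinarith [sq_nonneg (X ^ k - 1), pow_nonneg hX k]
    have h6 : 1 ≤ Real.exp (a * X ^ 2) := Real.one_le_exp (by positivity)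
    linarith
  calc X ^ k * Real.exp (-c * X ^ 2 + d * X)
      ≤ ((1 + k.factorial / a ^ k) * Real.exp (a * X ^ 2)) *
        Real.exp (-(a * X ^ 2) + d ^ 2 / (2 * c)) := by gcongr
    _ = _ := by rw [mul_assoc, ← Real.exp_add]; congr 2; ring

lemma summable_lattice_rpow (L : PeriodPair) {r : ℝ} (hr : r < -2) :
    Summable fun l : L.lattice => ‖(l : ℂ)‖ ^ r :=
  ZLattice.summable_norm_rpow L.lattice r (by simpa using hr)

lemma summable_lattice_gaussian (L : PeriodPair) {c : ℝ} (hc : 0 < c) (d : ℝ) (k : ℕ) :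
    Summable fun l : L.lattice => ‖(l : ℂ)‖ ^ k * Real.exp (-c * ‖(l : ℂ)‖ ^ 2 + d * ‖(l : ℂ)‖) := by
  obtain ⟨K, hK0, hK⟩ := pow_mul_exp_le hc d (k + 3)
  refine Summable.of_norm_bounded_eventually
    ((summable_lattice_rpow L (r := -3) (by norm_num)).mul_left K) ?_
  have : ∀ᶠ l : L.lattice in cofinite, l ≠ 0 := by simp [Filter.eventually_cofinite]
  filter_upwards [this] with l hl
  have hl' : 0 < ‖(l : ℂ)‖ := by simpa using hl
  have h := hK ‖(l : ℂ)‖ hl'.le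
  rw [Real.norm_of_nonneg (by positivity), Real.rpow_neg hl'.le]
  rw [← div_eq_mul_inv, le_div_iff₀ (by positivity)]
  calc _ = ‖(l : ℂ)‖ ^ (k + 3) * Real.exp (-c * ‖(l : ℂ)‖ ^ 2 + d * ‖(l : ℂ)‖) := by
        rw [pow_add]; norm_cast; ring
    _ ≤ K := h

lemma summable_lattice_shift_gaussian (L : PeriodPair) {c : ℝ} (hc : 0 < c) (w : ℂ) (k : ℕ) :
    Summable fun l : L.lattice => ‖w + l‖ ^ k * Real.exp (-c * ‖w + l‖ ^ 2) := by
  obtain ⟨K, hK0, hK⟩ := pow_mul_exp_le (c := c / 2) (by positivity) 0 k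
  refine Summable.of_nonneg_of_le (fun l => by positivity) (fun l => ?_)
    ((summable_lattice_gaussian L (c := c / 2) (by positivity) (c * ‖w‖) 0).mul_left K)
  have h := hK ‖w + l‖ (norm_nonneg _)
  rw [zero_mul, add_zero] at h
  rw [pow_zero, one_mul]
  calc _ = (‖w + l‖ ^ k * Real.exp (-(c / 2) * ‖w + l‖ ^ 2)) *
        Real.exp (-(c / 2) * ‖w + l‖ ^ 2) := by
        rw [mul_assoc, ← Real.exp_add]; congr 2; ring
    _ ≤ _ := by
        refine mul_le_mul h ?_ (Real.exp_pos _).le hK0.le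
        rw [Real.exp_le_exp]
        have h1 : ‖(l : ℂ)‖ - ‖w‖ ≤ ‖w + l‖ := by
          have := norm_sub_norm_le (l : ℂ) (-w); rw [norm_neg, sub_neg_eq_add, add_comm (l : ℂ)] at this
          exact this
        have h2 : ‖(l : ℂ)‖ ^ 2 - 2 * ‖w‖ * ‖(l : ℂ)‖ ≤ ‖w + l‖ ^ 2 := by
          rcases le_total ‖(l : ℂ)‖ ‖w‖ with h3 | h3
          · nlinarith [norm_nonneg (l : ℂ), norm_nonneg w, sq_nonneg ‖w + l‖]
          · nlinarith [norm_nonneg (l : ℂ), norm_nonneg w, sq_nonneg ‖w‖]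
        nlinarith

/-- The period pair `(τ, 1)`. -/
def tauPair (τ : ℂ) (hτ : 0 < τ.im) : PeriodPair where
  ω₁ := τ
  ω₂ := 1
  indep := by
    rw [LinearIndependent.pair_iff]
    intro s t h
    have h1 := congrArg Complex.im h
    simp at h1
    have h2 := congrArg Complex.re h
    rcases h1 with h1 | h1
    · subst h1; simpa using h2
    · exact absurd h1 hτ.ne'

lemma tauPair_equiv {τ : ℂ} (hτ : 0 < τ.im) (x : ℤ × ℤ) :
    (((tauPair τ hτ).latticeEquivProd.symm x : (tauPair τ hτ).lattice) : ℂ) = x.1 * τ + x.2 := by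
  rw [PeriodPair.latticeEquiv_symm_apply]; simp [tauPair]

lemma mem_tauPair {τ : ℂ} (hτ : 0 < τ.im) {z : ℂ} :
    z ∈ (tauPair τ hτ).lattice ↔ ∃ m n : ℤ, m * τ + n = z := by
  rw [PeriodPair.mem_lattice]; simp [tauPair]

/-- The pairing `exp (β (u w̄ - ū w))`. -/
def pairing (β : ℝ) (u w : ℂ) : ℂ := cexp (β * (u * star w - star u * w))

lemma tsum_tauPair {τ : ℂ} (hτ : 0 < τ.im) (f : ℂ → ℂ) :
    ∑' l : (tauPair τ hτ).lattice, f l = ∑' x : ℤ × ℤ, f (x.1 * τ + x.2) := by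
  rw [← (tauPair τ hτ).latticeEquivProd.symm.toEquiv.tsum_eq]
  exact tsum_congr fun x => by rw [← tauPair_equiv hτ]; rfl

lemma summable_tauPair {τ : ℂ} (hτ : 0 < τ.im) (f : ℂ → ℂ) :
    (Summable fun l : (tauPair τ hτ).lattice => f l) ↔
    Summable fun x : ℤ × ℤ => f (x.1 * τ + x.2) := by
  rw [← (tauPair τ hτ).latticeEquivProd.symm.toEquiv.summable_iff]
  exact summable_congr fun x => by rw [← tauPair_equiv hτ]; rfl

/-- The shifts p and q perturb |l|² only linearly in |l|, so the Gaussian bounds below are uniform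
for bounded p, q. This is what termwise differentiation in p requires. -/
lemma re_mul_star_ge (l p q : ℂ) :
    ‖l‖ ^ 2 - ‖l‖ * (‖p‖ + ‖q‖) - ‖p‖ * ‖q‖ ≤ ((p + l) * (q + star l)).re := by
  have e : (p + l) * (q + star l) = ((‖l‖ ^ 2 : ℝ) : ℂ) + (l * q + star l * p + p * q) := by
    have : l * star l = ((‖l‖ ^ 2 : ℝ) : ℂ) := by
      rw [Complex.star_def, mul_conj, normSq_eq_norm_sq]
    rw [← this]; ring
  rw [e, add_re, ofReal_re]
  have h1 : ‖l * q + star l * p + p * q‖ ≤ ‖l‖ * ‖q‖ + ‖l‖ * ‖p‖ + ‖p‖ * ‖q‖ := by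
    refine (norm_add₃_le).trans ?_
    simp
  have h2 := neg_le_of_abs_le ((abs_re_le_norm _).trans h1)
  linarith

lemma norm_exp_left_le {a : ℝ} (ha : 0 < a) {B : ℝ} (l : ℂ) {p q : ℂ} (hp : ‖p‖ ≤ B) (hq : ‖q‖ ≤ B) :
    ‖cexp (-(a : ℂ) * ((p + l) * (q + star l)))‖ ≤
      Real.exp (a * B ^ 2) * Real.exp (-a * ‖l‖ ^ 2 + 2 * a * B * ‖l‖) := by
  rw [Complex.norm_exp, ← Real.exp_add, Real.exp_le_exp, ← ofReal_neg, re_ofReal_mul]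
  have h := re_mul_star_ge l p q
  have h1 : ‖l‖ * (‖p‖ + ‖q‖) ≤ ‖l‖ * (2 * B) := by gcongr; linarith
  have h2 : ‖p‖ * ‖q‖ ≤ B * B := mul_le_mul hp hq (norm_nonneg _) ((norm_nonneg _).trans hp)
  nlinarith

lemma norm_exp_right_le {a b : ℝ} (hb : 0 < b) {B : ℝ} (l : ℂ) {p q : ℂ} (hp : ‖p‖ ≤ B)
    (hq : ‖q‖ ≤ B) :
    ‖cexp (-(a : ℂ) * (l * star l) + b * (l * q - star l * p))‖ ≤
      Real.exp (-a * ‖l‖ ^ 2 + 2 * b * B * ‖l‖) := by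
  rw [Complex.norm_exp, Real.exp_le_exp]
  have : l * star l = ((‖l‖ ^ 2 : ℝ) : ℂ) := by
    rw [Complex.star_def, mul_conj, normSq_eq_norm_sq]
  rw [this, add_re, ← ofReal_neg, ← ofReal_mul, ofReal_re, re_ofReal_mul]
  have h1 : ‖l * q - star l * p‖ ≤ ‖l‖ * (2 * B) := by
    refine (norm_sub_le _ _).trans ?_
    simp only [norm_mul, norm_star]
    nlinarith [norm_nonneg l]
  have h2 := (re_le_norm _).trans h1
  nlinarith

/-- The functional equation of the theta series `∑ conj (w + l) exp (-π t |w + l|² / Im τ)`. -/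
lemma theta_functional_equation {τ : ℂ} (hτ : 0 < τ.im) {t : ℝ} (ht : 0 < t) (w : ℂ) :
    ∑' l : (tauPair τ hτ).lattice, star (w + l) * cexp (-(Real.pi * t / τ.im) * ‖w + l‖ ^ 2) =
    1 / t ^ 2 * ∑' l : (tauPair τ hτ).lattice, star (l : ℂ) * pairing (Real.pi / τ.im) l w *
      cexp (-(Real.pi / (t * τ.im)) * ‖(l : ℂ)‖ ^ 2) := by
  set L := tauPair τ hτ
  -- The antiholomorphic coordinate stays fixed at w̄ while the holomorphic one becomes a free
  -- variable p. Both sides of Poisson summation are then holomorphic in p, and the derivative at p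
  -- = w brings down the factors conj(w + l) and conj(l).
  set F : L.lattice → ℂ → ℂ := fun l p =>
    cexp (-(Real.pi * t / τ.im) * ((p + l) * (star w + star (l : ℂ)))) with hF
  set G : L.lattice → ℂ → ℂ := fun l p =>
    cexp (-(Real.pi / (t * τ.im)) * (l * star (l : ℂ)) +
      Real.pi / τ.im * (l * star w - star (l : ℂ) * p)) with hG
  have hpi := Real.pi_pos
  set B := ‖w‖ + 1
  set U : Set ℂ := Metric.ball w 1
  have hwU : w ∈ U := Metric.mem_ball_self one_pos
  have hUB : ∀ p ∈ U, ‖p‖ ≤ B := fun p hp => by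
    have : ‖p - w‖ < 1 := by simpa [U, dist_eq_norm] using hp
    have := norm_le_insert' p w
    linarith
  have hqB : ‖star w‖ ≤ B := by rw [norm_star]; simp [B]
  have hFs := (summable_lattice_gaussian L (c := Real.pi * t / τ.im) (by positivity)
    (2 * (Real.pi * t / τ.im) * B) 0).mul_left (Real.exp (Real.pi * t / τ.im * B ^ 2))
  have hGs := summable_lattice_gaussian L (c := Real.pi / (t * τ.im)) (by positivity)
    (2 * (Real.pi / τ.im) * B) 0
  simp only [pow_zero, one_mul] at hFs hGs
  have hFle : ∀ l, ∀ p ∈ U, ‖F l p‖ ≤ _ := fun l p hp => by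
    have := norm_exp_left_le (a := Real.pi * t / τ.im) (by positivity) (l : ℂ) (hUB p hp) hqB
    simpa only [hF, ofReal_div, ofReal_mul] using this
  have hGle : ∀ l, ∀ p ∈ U, ‖G l p‖ ≤ _ := fun l p hp => by
    have := norm_exp_right_le (a := Real.pi / (t * τ.im)) (b := Real.pi / τ.im) (by positivity)
      (l : ℂ) (hUB p hp) hqB
    simpa only [hG, ofReal_div, ofReal_mul] using this
  have hFd : ∀ l p, HasDerivAt (F l)
      (F l p * (-(Real.pi * t / τ.im) * (star w + star (l : ℂ)))) p := fun l p => by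
    have := ((((hasDerivAt_id p).add_const (l : ℂ)).mul_const (star w + star (l : ℂ))).const_mul
      (-(Real.pi * t / τ.im : ℂ))).cexp
    simpa [hF] using this
  have hGd : ∀ l p, HasDerivAt (G l)
      (G l p * (-(Real.pi / τ.im) * star (l : ℂ))) p := fun l p => by
    have := (((((hasDerivAt_id p).const_mul (star (l : ℂ))).const_sub ((l : ℂ) * star w)).const_mul
      (Real.pi / τ.im : ℂ)).const_add (-(Real.pi / (t * τ.im)) * ((l : ℂ) * star (l : ℂ)))).cexp
    refine this.congr_deriv ?_
    simp [hG]
  have hD1 := Complex.hasSum_deriv_of_summable_norm hFs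
    (fun l => fun p _ => (hFd l p).differentiableAt.differentiableWithinAt) Metric.isOpen_ball
    hFle hwU
  have hD2 := Complex.hasSum_deriv_of_summable_norm hGs
    (fun l => fun p _ => (hGd l p).differentiableAt.differentiableWithinAt) Metric.isOpen_ball
    hGle hwU
  have hPoisson : ∀ p ∈ U, ∑' l, F l p = 1 / t * ∑' l, G l p := by
    intro p hp
    have h1 : Summable fun l => F l p := hFs.of_norm_bounded fun l => hFle l p hp
    have h2 : Summable fun l => G l p := hGs.of_norm_bounded fun l => hGle l p hp
    have e1 := summable_tauPair hτ (fun l : ℂ =>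
      cexp (-(Real.pi * t / τ.im) * ((p + l) * (star w + star l))))
    have e2 := summable_tauPair hτ (fun l : ℂ =>
      cexp (-(Real.pi / (t * τ.im)) * (l * star l) + Real.pi / τ.im * (l * star w - star l * p)))
    have e3 := tsum_tauPair hτ (fun l : ℂ =>
      cexp (-(Real.pi * t / τ.im) * ((p + l) * (star w + star l))))
    have e4 := tsum_tauPair hτ (fun l : ℂ =>
      cexp (-(Real.pi / (t * τ.im)) * (l * star l) + Real.pi / τ.im * (l * star w - star l * p)))
    have h1' := e1.1 h1
    have h2' := e2.1 h2
    have hst : ∀ x : ℤ × ℤ, star ((x.1 : ℂ) * τ + x.2) = x.1 * star τ + x.2 := fun x => by simp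
    simp only [hst] at h1' h2' e3 e4
    rw [show ∑' l, F l p = _ from e3, show ∑' l, G l p = _ from e4]
    exact tsum_lattice_gaussian hτ ht p (star w) h1' h2'
  have hEv : (fun p => ∑' l, F l p) =ᶠ[𝓝 w] fun p => 1 / t * ∑' l, G l p := by
    filter_upwards [Metric.isOpen_ball.mem_nhds hwU] with p hp using hPoisson p hp
  have hder := hEv.deriv_eq
  rw [deriv_const_mul_field, ← hD1.tsum_eq, ← hD2.tsum_eq] at hder
  simp only [(hFd _ _).deriv, (hGd _ _).deriv] at hder
  have hnorm : ∀ u : ℂ, u * star u = (‖u‖ : ℂ) ^ 2 := fun u => by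
    rw [Complex.star_def, mul_conj, normSq_eq_norm_sq]; push_cast; rfl
  have hl : ∀ l : L.lattice, star (w + l) * cexp (-(Real.pi * t / τ.im) * ‖w + l‖ ^ 2) =
      F l w * (-(Real.pi * t / τ.im) * (star w + star (l : ℂ))) * (-(τ.im / (Real.pi * t))) := by
    intro l
    rw [← hnorm, star_add, hF]
    have : (τ.im : ℂ) ≠ 0 := ofReal_ne_zero.mpr hτ.ne'
    have : (t : ℂ) ≠ 0 := ofReal_ne_zero.mpr ht.ne'
    have : (Real.pi : ℂ) ≠ 0 := ofReal_ne_zero.mpr hpi.ne'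
    field_simp
  have hr : ∀ l : L.lattice, star (l : ℂ) * pairing (Real.pi / τ.im) l w *
      cexp (-(Real.pi / (t * τ.im)) * ‖(l : ℂ)‖ ^ 2) =
      G l w * (-(Real.pi / τ.im) * star (l : ℂ)) * (-(τ.im / Real.pi)) := by
    intro l
    rw [mul_assoc, pairing, ← Complex.exp_add, ← hnorm, hG]
    have : (τ.im : ℂ) ≠ 0 := ofReal_ne_zero.mpr hτ.ne'
    have : (Real.pi : ℂ) ≠ 0 := ofReal_ne_zero.mpr hpi.ne'
    push_cast
    field_simp
    congr 2
    ring
  simp_rw [hl, hr]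
  rw [tsum_mul_right, tsum_mul_right, hder]
  have : (τ.im : ℂ) ≠ 0 := ofReal_ne_zero.mpr hτ.ne'
  have : (t : ℂ) ≠ 0 := ofReal_ne_zero.mpr ht.ne'
  have : (Real.pi : ℂ) ≠ 0 := ofReal_ne_zero.mpr hpi.ne'
  field_simp
  exact congrArg Neg.neg (tsum_congr fun l => by ring)

/-! ### Mellin transforms and Hecke's continuation of E₁ -/

/-- Exponential sums with frequencies bounded below decay faster than any power. -/
lemma exp_sum_isBigO {ι : Type*} {a : ι → ℂ} {p : ι → ℝ} {δ : ℝ} (hδ : 0 < δ)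
    (hp : ∀ i, a i = 0 ∨ δ ≤ p i)
    (hs : Summable fun i => ‖a i‖ * Real.exp (-Real.pi * p i)) (r : ℝ) :
    (fun t : ℝ => ∑' i, a i * (Real.exp (-Real.pi * p i * t) : ℂ)) =O[atTop] fun t => t ^ r := by
  have h1 : (fun t : ℝ => ∑' i, a i * (Real.exp (-Real.pi * p i * t) : ℂ)) =O[atTop]
      fun t => Real.exp (-(Real.pi * δ) * t) := by
    refine IsBigO.of_bound ((∑' i, ‖a i‖ * Real.exp (-Real.pi * p i)) *
      Real.exp (Real.pi * δ)) ?_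
    filter_upwards [eventually_ge_atTop 1] with t ht
    have hle : ∀ i, ‖a i * (Real.exp (-Real.pi * p i * t) : ℂ)‖ ≤
        ‖a i‖ * Real.exp (-Real.pi * p i) * (Real.exp (Real.pi * δ) *
          Real.exp (-(Real.pi * δ) * t)) := by
      intro i
      rcases hp i with h | h
      · simp [h]
      · rw [norm_mul, norm_real, Real.norm_of_nonneg (Real.exp_pos _).le, ← Real.exp_add,
          mul_assoc ‖a i‖, ← Real.exp_add]
        refine mul_le_mul_of_nonneg_left ?_ (norm_nonneg _)
        rw [Real.exp_le_exp]
        nlinarith [mul_nonneg (mul_nonneg Real.pi_pos.le (sub_nonneg.2 h)) (sub_nonneg.2 ht)]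
    have hs2 := hs.mul_right (Real.exp (Real.pi * δ) * Real.exp (-(Real.pi * δ) * t))
    refine (tsum_of_norm_bounded hs2.hasSum hle).trans ?_
    rw [tsum_mul_right, Real.norm_of_nonneg (Real.exp_pos _).le, mul_assoc]
  exact h1.trans (isLittleO_exp_neg_mul_rpow_atTop (by positivity) r).isBigO

lemma exp_sum_continuousOn {ι : Type*} {a : ι → ℂ} {p : ι → ℝ}
    (hp : ∀ i, 0 ≤ p i)
    (hs : ∀ t : ℝ, 0 < t → Summable fun i => ‖a i‖ * Real.exp (-Real.pi * p i * t)) :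
    ContinuousOn (fun t : ℝ => ∑' i, a i * (Real.exp (-Real.pi * p i * t) : ℂ)) (Set.Ioi 0) := by
  refine continuousOn_of_forall_continuousAt fun t₀ (ht₀ : 0 < t₀) => ?_
  have hc : ContinuousOn (fun t : ℝ => ∑' i, a i * (Real.exp (-Real.pi * p i * t) : ℂ))
      (Set.Ioi (t₀ / 2)) := by
    refine continuousOn_tsum (fun i => by fun_prop) (hs (t₀ / 2) (by positivity)) ?_
    intro i t ht
    rw [norm_mul, norm_real, Real.norm_of_nonneg (Real.exp_pos _).le]
    refine mul_le_mul_of_nonneg_left ?_ (norm_nonneg _)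
    rw [Real.exp_le_exp]
    have : t₀ / 2 < t := ht
    nlinarith [mul_nonneg Real.pi_pos.le (hp i)]
  exact hc.continuousAt (Ioi_mem_nhds (by linarith))

/-- Two Dirichlet series whose theta series are exchanged by `t ↦ 1 / t` with weight `2` extend
to entire functions that agree at the centre `1` of the functional equation. -/
theorem exists_entire_of_theta {ι : Type*} [Countable ι] {a b : ι → ℂ} {p q : ι → ℝ}
    {δ : ℝ} (hδ : 0 < δ) (hp0 : ∀ i, 0 ≤ p i) (hq0 : ∀ i, 0 ≤ q i)
    (hp : ∀ i, a i = 0 ∨ δ ≤ p i) (hq : ∀ i, b i = 0 ∨ δ ≤ q i)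
    (hsa : ∀ t : ℝ, 0 < t → Summable fun i => ‖a i‖ * Real.exp (-Real.pi * p i * t))
    (hsb : ∀ t : ℝ, 0 < t → Summable fun i => ‖b i‖ * Real.exp (-Real.pi * q i * t))
    (hfe : ∀ t : ℝ, 0 < t → ∑' i, a i * (Real.exp (-Real.pi * p i * (1 / t)) : ℂ) =
      t ^ 2 * ∑' i, b i * (Real.exp (-Real.pi * q i * t) : ℂ)) :
    ∃ A B : ℂ → ℂ, Differentiable ℂ A ∧ Differentiable ℂ B ∧ A 1 = B 1 ∧
      (∀ s : ℂ, 2 < s.re → (Summable fun i => ‖a i‖ / p i ^ s.re) →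
        A s = ∑' i, a i / (p i : ℂ) ^ s) ∧
      (∀ s : ℂ, 2 < s.re → (Summable fun i => ‖b i‖ / q i ^ s.re) →
        B s = ∑' i, b i / (q i : ℂ) ^ s) := by
  -- Terms of frequency 0 have coefficient 0, so both theta series decay rapidly and the constant
  -- terms f₀ and g₀ vanish. Hence Λ has no poles.
  let P : WeakFEPair ℂ :=
    { f := fun t => ∑' i, a i * (Real.exp (-Real.pi * p i * t) : ℂ)
      g := fun t => ∑' i, b i * (Real.exp (-Real.pi * q i * t) : ℂ)
      k := 2
      ε := 1
      f₀ := 0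
      g₀ := 0
      hf_int := (exp_sum_continuousOn hp0 hsa).locallyIntegrableOn measurableSet_Ioi
      hg_int := (exp_sum_continuousOn hq0 hsb).locallyIntegrableOn measurableSet_Ioi
      hk := two_pos
      hε := one_ne_zero
      h_feq := fun x hx => by
        rw [hfe x hx]
        norm_cast
        simp
      hf_top := fun r => by
        simpa using exp_sum_isBigO hδ hp (by simpa using hsa 1 one_pos) r
      hg_top := fun r => by
        simpa using exp_sum_isBigO hδ hq (by simpa using hsb 1 one_pos) r }
  have hPs : ∀ Q : WeakFEPair ℂ, Q.f₀ = 0 → Q.g₀ = 0 → Differentiable ℂ Q.Λ := fun Q h h' s =>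
    Q.differentiableAt_Λ (Or.inr h) (Or.inr h')
  have key : ∀ (Q : WeakFEPair ℂ) (c : ι → ℂ) (r : ι → ℝ), Q.k = 2 → Q.f₀ = 0 →
      (Q.f = fun t => ∑' i, c i * (Real.exp (-Real.pi * r i * t) : ℂ)) →
      (∀ i, 0 ≤ r i) → (∀ i, c i = 0 ∨ δ ≤ r i) →
      (∀ t : ℝ, 0 < t → Summable fun i => ‖c i‖ * Real.exp (-Real.pi * r i * t)) →
      ∀ s : ℂ, 2 < s.re → (Summable fun i => ‖c i‖ / r i ^ s.re) →
      (Real.pi : ℂ) ^ s * (Gamma s)⁻¹ * Q.Λ s = ∑' i, c i / (r i : ℂ) ^ s := by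
    intro Q c r hk hf0 hf hr0 hr hsc s hs hsum
    have h1 := (Q.hasMellin (s := s) (by rw [hk]; exact hs)).2
    simp only [hf0, sub_zero] at h1
    have h2 := hasSum_mellin_pi_mul (a := c) (q := r) (F := Q.f) (s := s)
      (fun i => (hr i).imp_right hδ.trans_le) (by linarith) (fun t ht => by
        rw [hf]
        refine Summable.hasSum (Summable.of_norm ((hsc t ht).congr fun i => ?_))
        rw [norm_mul, norm_real, Real.norm_of_nonneg (Real.exp_pos _).le]) hsum
    rw [← h1, show mellin (fun x => Q.f x) s = mellin Q.f s from rfl, ← h2.tsum_eq, ← tsum_mul_left]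
    refine tsum_congr fun i => ?_
    have hpi : (Real.pi : ℂ) ^ s ≠ 0 := by
      rw [Ne, cpow_eq_zero_iff]; simp [Real.pi_ne_zero]
    have hG : Gamma s ≠ 0 := Gamma_ne_zero_of_re_pos (by linarith)
    rw [cpow_neg]
    field_simp
  -- The Gamma factor is removed by multiplying with 1/Γ, which is entire, so no pole is created.
  have hent : ∀ Q : WeakFEPair ℂ, Differentiable ℂ Q.Λ →
      Differentiable ℂ fun s => (Real.pi : ℂ) ^ s * (Gamma s)⁻¹ * Q.Λ s := fun Q hQ => by
    refine Differentiable.mul (Differentiable.mul ?_ differentiable_one_div_Gamma) hQ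
    exact fun s => (differentiableAt_id.const_cpow (Or.inl (by simp [Real.pi_ne_zero])))
  refine ⟨fun s => (Real.pi : ℂ) ^ s * (Gamma s)⁻¹ * P.Λ s,
    fun s => (Real.pi : ℂ) ^ s * (Gamma s)⁻¹ * P.symm.Λ s, hent _ (hPs _ rfl rfl),
    hent _ (hPs _ rfl rfl), ?_, ?_, ?_⟩
  -- The point 1 is fixed by s ↦ 2 - s and ε = 1, so the two completed functions coincide there.
  · have := P.functional_equation 1
    have h2 : ((P.k : ℝ) : ℂ) - 1 = 1 := by norm_num [P]
    rw [h2] at this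
    simp only [this]
    simp [P]
  · exact key P a p rfl rfl rfl hp0 hp hsa
  · exact key P.symm b q rfl rfl rfl hq0 hq hsb

/-- The terms of a convergent Gaussian sum tend to 0 along the cofinite filter, so only finitely
many exceed exp(-R²). -/
lemma finite_lattice_norm_le (L : PeriodPair) (w : ℂ) (R : ℝ) :
    {l : L.lattice | ‖w + l‖ ≤ R}.Finite := by
  have h := (summable_lattice_shift_gaussian L one_pos w 0).tendsto_cofinite_zero
  have h2 := h.eventually (gt_mem_nhds (Real.exp_pos (-(|R| ^ 2))))
  rw [Filter.eventually_cofinite] at h2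
  refine h2.subset fun l hl => ?_
  simp only [Set.mem_ofPred_eq] at hl ⊢
  rw [not_lt, pow_zero, one_mul, Real.exp_le_exp]
  have : ‖w + l‖ ≤ |R| := hl.trans (le_abs_self R)
  nlinarith [norm_nonneg (w + l), abs_nonneg R]

lemma exists_norm_lower_bound (L : PeriodPair) (w : ℂ) :
    ∃ δ : ℝ, 0 < δ ∧ ∀ l : L.lattice, w + l = 0 ∨ δ ≤ ‖w + l‖ := by
  have hf := finite_lattice_norm_le L w 1
  set S := (hf.toFinset.image fun l : L.lattice => ‖w + l‖).filter fun x => 0 < x with hS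
  rcases S.eq_empty_or_nonempty with h | h
  · refine ⟨1, one_pos, fun l => ?_⟩
    by_contra hc
    push Not at hc
    have : ‖w + l‖ ∈ S := by
      rw [hS]
      simp only [Finset.mem_filter, Finset.mem_image, Set.Finite.mem_toFinset, Set.mem_ofPred_eq]
      exact ⟨⟨l, hc.2.le, rfl⟩, norm_pos_iff.2 hc.1⟩
    simp [h] at this
  · refine ⟨min 1 (S.min' h), lt_min one_pos ?_, fun l => ?_⟩
    · exact (Finset.mem_filter.1 (S.min'_mem h)).2
    · by_contra hc
      push Not at hc
      have hm : ‖w + l‖ ∈ S := by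
        rw [hS]
        simp only [Finset.mem_filter, Finset.mem_image, Set.Finite.mem_toFinset, Set.mem_ofPred_eq]
        exact ⟨⟨l, (hc.2.trans_le (min_le_left _ _)).le, rfl⟩, norm_pos_iff.2 hc.1⟩
      exact absurd (S.min'_le _ hm) (not_le.2 (hc.2.trans_le (min_le_right _ _)))

lemma summable_lattice_shift_rpow (L : PeriodPair) (w : ℂ) {r : ℝ} (hr : r < -2) :
    Summable fun l : L.lattice => ‖w + l‖ ^ r := by
  have := ZLattice.summable_norm_sub_rpow L.lattice r (by simpa using hr) (-w)
  refine this.congr fun l => ?_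
  rw [sub_neg_eq_add, add_comm]

open scoped Classical in
/-- The series `∑ ψ(l, w) l⁻¹ |l|⁻ˢ` over the non-zero `l ∈ Λ`, with `ψ` the pairing. -/
def charSeries (β : ℝ) (Λ : Submodule ℤ ℂ) (w s : ℂ) : ℂ :=
  ∑' l : Λ, if (l : ℂ) = 0 then 0 else
    pairing β l w * ((l : ℂ)⁻¹ * ((‖(l : ℂ)‖ : ℝ) : ℂ) ^ (-s))

lemma norm_pairing (β : ℝ) (u w : ℂ) : ‖pairing β u w‖ = 1 := by
  rw [pairing, Complex.norm_exp]
  have : (β * (u * star w - star u * w) : ℂ).re = 0 := by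
    simp [Complex.mul_re, mul_comm]
  rw [this, Real.exp_zero]

/-- Because ū/|u|² = 1/u, a theta coefficient ū of frequency |u|²/y, taken at the exponent 1 + s/2,
is an Eisenstein term up to a power of y. Thus s = 0 corresponds to the centre 1, where the two
continued series agree. -/
lemma conj_div_cpow {y : ℝ} (hy : 0 < y) {u : ℂ} (hu : u ≠ 0) (s : ℂ) :
    (y : ℂ) ^ (-(1 + s / 2)) * (star u / ((‖u‖ ^ 2 / y : ℝ) : ℂ) ^ (1 + s / 2)) =
      u⁻¹ * ((‖u‖ : ℝ) : ℂ) ^ (-s) := by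
  have hn : 0 < ‖u‖ := norm_pos_iff.2 hu
  have hn' : ((‖u‖ : ℝ) : ℂ) ≠ 0 := ofReal_ne_zero.2 hn.ne'
  have hy' : (y : ℂ) ≠ 0 := ofReal_ne_zero.2 hy.ne'
  have e1 : ((‖u‖ ^ 2 / y : ℝ) : ℂ) ^ (1 + s / 2) =
      (((‖u‖ : ℝ) : ℂ) ^ 2 * (‖u‖ : ℂ) ^ s) * (y : ℂ) ^ (-(1 + s / 2)) := by
    rw [div_eq_mul_inv, ofReal_mul, mul_cpow_ofReal_nonneg (by positivity) (by positivity),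
      ofReal_inv, inv_cpow _ _ (by rw [arg_ofReal_of_nonneg hy.le]; exact Real.pi_ne_zero.symm),
      cpow_neg]
    congr 1
    rw [ofReal_pow, cpow_add _ _ (pow_ne_zero 2 hn'), cpow_one]
    congr 1
    rw [← cpow_nat_mul' (x := (‖u‖ : ℂ))]
    · congr 1; push_cast; ring
    all_goals rw [arg_ofReal_of_nonneg hn.le]; simp [Real.pi_pos, Real.pi_pos.le]
  have hyc : (y : ℂ) ^ (-(1 + s / 2)) ≠ 0 := by rw [Ne, cpow_eq_zero_iff]; simp [hy']
  have hsc : (‖u‖ : ℂ) ^ s ≠ 0 := by rw [Ne, cpow_eq_zero_iff]; simp [hn']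
  rw [e1, cpow_neg (‖u‖ : ℂ)]
  have e2 : u * star u = (‖u‖ : ℂ) ^ 2 := by
    rw [Complex.star_def, mul_conj, normSq_eq_norm_sq]; push_cast; rfl
  generalize (y : ℂ) ^ (-(1 + s / 2)) = Y at hyc
  field_simp
  rw [← e2]; ring

lemma summable_conj_div {L : PeriodPair} {y : ℝ} (hy : 0 < y) (w : ℂ) {c : L.lattice → ℂ}
    (hc : ∀ l, ‖c l‖ ≤ ‖w + l‖) {σ : ℝ} (hσ : 2 < σ) :
    Summable fun l : L.lattice => ‖c l‖ / (‖w + l‖ ^ 2 / y) ^ σ := by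
  refine Summable.of_nonneg_of_le (fun l => by positivity) (fun l => ?_)
    ((summable_lattice_shift_rpow L w (r := 1 - 2 * σ) (by linarith)).mul_left (y ^ σ))
  rcases eq_or_ne (w + l) 0 with h | h
  · have : c l = 0 := by simpa [h] using hc l
    simp only [this, norm_zero, zero_div]
    positivity
  · have hn : 0 < ‖w + l‖ := norm_pos_iff.2 h
    rw [Real.div_rpow (by positivity) hy.le, Real.rpow_sub hn, Real.rpow_one, Real.rpow_mul hn.le,
      Real.rpow_two]
    rw [div_div_eq_mul_div, mul_div_assoc', mul_comm (‖c l‖)]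
    gcongr
    exact hc l

/-- Hecke's continuation of `E₁` and of its dual series, which agree at `s = 0`. -/
theorem hecke_continuation_tau {τ : ℂ} (hτ : 0 < τ.im) (w : ℂ) :
    ∃ v, HasContinuedValueAtZero (eisensteinSeries (tauPair τ hτ).lattice 1 w) v ∧
      HasContinuedValueAtZero (charSeries (Real.pi / τ.im) (tauPair τ hτ).lattice w) v := by
  set L := tauPair τ hτ with hL
  set y := τ.im with hy
  have hy0 : (y : ℂ) ≠ 0 := ofReal_ne_zero.2 hτ.ne'
  obtain ⟨δ₁, hδ₁, h₁⟩ := exists_norm_lower_bound L w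
  obtain ⟨δ₂, hδ₂, h₂⟩ := exists_norm_lower_bound L 0
  have hsum : ∀ (z : ℂ) (c : L.lattice → ℂ), (∀ l, ‖c l‖ ≤ ‖z + l‖) → ∀ t : ℝ, 0 < t →
      Summable fun l : L.lattice => ‖c l‖ * Real.exp (-Real.pi * (‖z + l‖ ^ 2 / y) * t) := by
    intro z c hc t ht
    refine Summable.of_nonneg_of_le (fun l => by positivity) (fun l => ?_)
      (summable_lattice_shift_gaussian L (c := Real.pi * t / y) (by positivity) z 1)
    rw [pow_one]
    refine mul_le_mul (hc l) (le_of_eq ?_) (Real.exp_pos _).le (norm_nonneg _)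
    congr 1; ring
  have hψ : ∀ l : L.lattice, ‖star (l : ℂ) * pairing (Real.pi / y) l w‖ ≤ ‖0 + (l : ℂ)‖ := by
    intro l; rw [norm_mul, norm_star, norm_pairing, mul_one, zero_add]
  have hww : ∀ l : L.lattice, ‖star (w + (l : ℂ))‖ ≤ ‖w + (l : ℂ)‖ := fun l => by rw [norm_star]
  obtain ⟨A, B, hA, hB, hAB, hAs, hBs⟩ := exists_entire_of_theta
    (a := fun l : L.lattice => star (w + (l : ℂ)))
    (b := fun l : L.lattice => star (l : ℂ) * pairing (Real.pi / y) l w)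
    (p := fun l : L.lattice => ‖w + l‖ ^ 2 / y) (q := fun l : L.lattice => ‖0 + (l : ℂ)‖ ^ 2 / y)
    (δ := min (δ₁ ^ 2 / y) (δ₂ ^ 2 / y)) (by positivity) (fun l => by positivity)
    (fun l => by positivity)
    (fun l => (h₁ l).imp (fun h => by rw [h, star_zero]) fun h =>
      (min_le_left _ _).trans (by gcongr))
    (fun l => (h₂ l).imp (fun h => by rw [zero_add] at h; rw [h, star_zero, zero_mul]) fun h =>
      (min_le_right _ _).trans (by gcongr))
    (hsum w _ hww) (hsum 0 _ hψ) (fun t ht => by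
      have h := theta_functional_equation hτ (t := 1 / t) (by positivity) w
      have ht0 : (t : ℂ) ≠ 0 := ofReal_ne_zero.2 ht.ne'
      simp only [← hy] at h
      convert h using 1
      · refine tsum_congr fun l => ?_
        rw [ofReal_exp]
        congr 2
        push_cast
        ring
      · congr 1
        · push_cast; field_simp
        · refine tsum_congr fun l => ?_
          rw [ofReal_exp, zero_add]
          congr 2
          push_cast
          field_simp)
  have hlin : Differentiable ℂ fun s : ℂ => 1 + s / 2 := by fun_prop
  have hpow : Differentiable ℂ fun s : ℂ => (y : ℂ) ^ (-(1 + s / 2)) := fun s =>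
    (hlin.neg s).const_cpow (Or.inl hy0)
  refine ⟨(y : ℂ) ^ (-(1 + (0 : ℂ) / 2)) * A (1 + 0 / 2), ⟨1, one_pos,
    fun s => (y : ℂ) ^ (-(1 + s / 2)) * A (1 + s / 2),
      (hpow.mul (hA.comp hlin)).differentiableOn, fun s hs => ?_, rfl⟩, ⟨1, one_pos,
    fun s => (y : ℂ) ^ (-(1 + s / 2)) * B (1 + s / 2),
      (hpow.mul (hB.comp hlin)).differentiableOn, fun s hs => ?_, ?_⟩⟩
  · have hre : 2 < (1 + s / 2).re := by simp; linarith
    change (y : ℂ) ^ (-(1 + s / 2)) * A (1 + s / 2) = _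
    rw [hAs _ hre (summable_conj_div hτ w hww hre), ← tsum_mul_left, eisensteinSeries]
    refine tsum_congr fun l => ?_
    rw [add_comm (l : ℂ) w]
    split_ifs with h
    · simp [h]
    · rw [conj_div_cpow hτ h, pow_one]
  · have hre : 2 < (1 + s / 2).re := by simp; linarith
    change (y : ℂ) ^ (-(1 + s / 2)) * B (1 + s / 2) = _
    rw [hBs _ hre (summable_conj_div hτ 0 hψ hre), ← tsum_mul_left, charSeries]
    refine tsum_congr fun l => ?_
    simp only [zero_add]
    split_ifs with h
    · simp [h]
    · rw [← conj_div_cpow hτ h]; ring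
  · simp [hAB]

/-! ### Homotheties, the fundamental domain and the pairing on the torus -/

/-- Every lattice is homothetic to ℤτ + ℤ with τ in the standard fundamental domain. This lets the
theta computation, done only for such lattices, and the study of the zeros of E₂(0) apply to any
lattice. -/
lemma exists_fd_basis (L : PeriodPair) : ∃ (lam τ : ℂ) (hτ : 0 < τ.im), lam ≠ 0 ∧
    |τ.re| ≤ 1 / 2 ∧ 1 ≤ normSq τ ∧
    ∀ z, lam * z ∈ L.lattice ↔ z ∈ (tauPair τ hτ).lattice := by
  have h2 : L.ω₂ ≠ 0 := L.indep.ne_zero 1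
  have him : (L.ω₁ / L.ω₂).im ≠ 0 := by
    intro h
    have hr : L.ω₁ / L.ω₂ = ((L.ω₁ / L.ω₂).re : ℂ) := by
      apply Complex.ext <;> simp [h]
    have h3 := LinearIndependent.pair_iff.mp L.indep 1 (-(L.ω₁ / L.ω₂).re) (by
      rw [real_smul, real_smul]
      push_cast
      rw [← hr]; field_simp; ring)
    simp at h3
  obtain ⟨τ₀, hτ₀, hL⟩ : ∃ τ₀ : ℂ, 0 < τ₀.im ∧
      ∀ z, L.ω₂ * z ∈ L.lattice ↔ ∃ m n : ℤ, m * τ₀ + n = z := by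
    -- A negatively oriented basis is corrected by changing the sign of the quotient.
    rcases lt_or_gt_of_ne him with h | h
    · refine ⟨-(L.ω₁ / L.ω₂), by simpa using h, fun z => ?_⟩
      rw [PeriodPair.mem_lattice]
      constructor
      · rintro ⟨m, n, e⟩
        refine ⟨-m, n, ?_⟩
        push_cast
        field_simp
        linear_combination e
      · rintro ⟨m, n, rfl⟩
        refine ⟨-m, n, ?_⟩
        push_cast
        field_simp
    · refine ⟨L.ω₁ / L.ω₂, h, fun z => ?_⟩
      rw [PeriodPair.mem_lattice]
      constructor
      · rintro ⟨m, n, e⟩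
        refine ⟨m, n, ?_⟩
        field_simp
        linear_combination e
      · rintro ⟨m, n, rfl⟩
        refine ⟨m, n, ?_⟩
        field_simp
  obtain ⟨g, hg⟩ := ModularGroup.exists_smul_mem_fd (⟨τ₀, hτ₀⟩ : UpperHalfPlane)
  set z₀ : UpperHalfPlane := ⟨τ₀, hτ₀⟩
  have hz : ((g • z₀ : UpperHalfPlane) : ℂ) =
      ((g 0 0 : ℤ) * τ₀ + (g 0 1 : ℤ)) / ((g 1 0 : ℤ) * τ₀ + (g 1 1 : ℤ)) := by
    rw [UpperHalfPlane.coe_specialLinearGroup_apply]; simp [z₀]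
  have hdet : ((g 0 0 : ℤ) : ℂ) * (g 1 1 : ℤ) - (g 0 1 : ℤ) * (g 1 0 : ℤ) = 1 := by
    have := g.det_coe
    rw [Matrix.det_fin_two] at this
    exact_mod_cast this
  set a := g 0 0
  set b := g 0 1
  set c := g 1 0
  set d := g 1 1
  have hden : (c : ℂ) * τ₀ + d ≠ 0 := by
    intro h
    have h1 := congrArg Complex.im h
    simp at h1
    rcases h1 with h1 | h1
    · rw [h1] at h hdet
      simp at h
      rw [h] at hdet
      simp at hdet
    · exact hτ₀.ne' h1
  -- Since (cτ₀ + d) · gτ₀ = aτ₀ + b, multiplication by cτ₀ + d carries the basis (gτ₀, 1) to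
  -- another basis of ℤτ₀ + ℤ.
  refine ⟨L.ω₂ * (c * τ₀ + d), (g • z₀ : UpperHalfPlane), (g • z₀).coe_im_pos, mul_ne_zero h2 hden,
    hg.2, hg.1, fun z => ?_⟩
  rw [mul_assoc, hL, mem_tauPair, hz]
  constructor
  · rintro ⟨m, n, e⟩
    refine ⟨d * m - c * n, -b * m + a * n, ?_⟩
    have : z = (m * τ₀ + n) / (c * τ₀ + d) := by rw [e]; field_simp
    rw [this]
    push_cast
    field_simp
    linear_combination (m * τ₀ + n) * hdet
  · rintro ⟨m, n, rfl⟩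
    refine ⟨m * a + n * c, m * b + n * d, ?_⟩
    push_cast
    field_simp
    ring

/-- The bijection `l ↦ lam * l` between a lattice and its multiple. -/
def scaleEquiv {Λ Λ' : Submodule ℤ ℂ} {lam : ℂ} (hlam : lam ≠ 0)
    (h : ∀ z, lam * z ∈ Λ' ↔ z ∈ Λ) : Λ ≃ Λ' where
  toFun l := ⟨lam * l, (h _).2 l.2⟩
  invFun l := ⟨lam⁻¹ * l, (h _).1 (by rw [mul_inv_cancel_left₀ hlam]; exact l.2)⟩
  left_inv l := by ext; simp [hlam]
  right_inv l := by ext; simp [hlam]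

lemma eisensteinSeries_scale {Λ Λ' : Submodule ℤ ℂ} {lam : ℂ} (hlam : lam ≠ 0)
    (h : ∀ z, lam * z ∈ Λ' ↔ z ∈ Λ) (k : ℕ) (z s : ℂ) :
    eisensteinSeries Λ' k (lam * z) s =
      (lam ^ k)⁻¹ * (‖lam‖ : ℂ) ^ (-s) * eisensteinSeries Λ k z s := by
  unfold eisensteinSeries
  rw [← (scaleEquiv hlam h).tsum_eq, ← tsum_mul_left]
  refine tsum_congr fun l => ?_
  have e : ((scaleEquiv hlam h l : Λ') : ℂ) + lam * z = lam * (l + z) := by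
    simp [scaleEquiv]; ring
  rw [e]
  by_cases h0 : (l : ℂ) + z = 0
  · simp [h0]
  · rw [if_neg (mul_ne_zero hlam h0), if_neg h0, mul_pow, mul_inv, norm_mul, ofReal_mul,
      mul_cpow_ofReal_nonneg (norm_nonneg _) (norm_nonneg _)]
    ring

lemma pairing_scale (β : ℝ) {lam : ℂ} (hlam : lam ≠ 0) (u w : ℂ) :
    pairing (β / ‖lam‖ ^ 2) (lam * u) (lam * w) = pairing β u w := by
  unfold pairing
  have e2 : lam * star lam = (‖lam‖ : ℂ) ^ 2 := by
    rw [Complex.star_def, mul_conj, normSq_eq_norm_sq]; push_cast; rfl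
  have h0 : (‖lam‖ : ℂ) ≠ 0 := ofReal_ne_zero.2 (norm_ne_zero_iff.2 hlam)
  congr 1
  rw [star_mul', star_mul']
  push_cast
  field_simp
  linear_combination (β * (u * star w - w * star u)) * e2

lemma charSeries_scale {Λ Λ' : Submodule ℤ ℂ} {lam : ℂ} (hlam : lam ≠ 0)
    (h : ∀ z, lam * z ∈ Λ' ↔ z ∈ Λ) (β : ℝ) (w s : ℂ) :
    charSeries (β / ‖lam‖ ^ 2) Λ' (lam * w) s =
      (lam ^ 1)⁻¹ * (‖lam‖ : ℂ) ^ (-s) * charSeries β Λ w s := by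
  unfold charSeries
  rw [← (scaleEquiv hlam h).tsum_eq, ← tsum_mul_left]
  refine tsum_congr fun l => ?_
  have e : ((scaleEquiv hlam h l : Λ') : ℂ) = lam * l := rfl
  rw [e]
  by_cases h0 : (l : ℂ) = 0
  · simp [h0]
  · rw [if_neg (mul_ne_zero hlam h0), if_neg h0, pairing_scale β hlam, mul_inv, norm_mul,
      ofReal_mul, mul_cpow_ofReal_nonneg (norm_nonneg _) (norm_nonneg _)]
    ring

lemma HasContinuedValueAtZero.const_mul_cpow {f g : ℂ → ℂ} {v : ℂ}
    (h : HasContinuedValueAtZero f v) (c : ℂ) {r : ℝ} (hr : 0 < r)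
    (hg : ∀ s : ℂ, 2 < s.re → g s = c * (r : ℂ) ^ (-s) * f s) :
    HasContinuedValueAtZero g (c * v) := by
  obtain ⟨ε, hε, F, hF, hFf, rfl⟩ := h
  refine ⟨ε, hε, fun s => c * (r : ℂ) ^ (-s) * F s, ?_, fun s hs => ?_, by simp⟩
  · refine DifferentiableOn.mul (Differentiable.differentiableOn ?_) hF
    refine Differentiable.const_mul (fun s => ?_) c
    exact differentiableAt_id.neg.const_cpow (Or.inl (ofReal_ne_zero.2 hr.ne'))
  · simp only [hFf s hs, hg s hs]

lemma hasContinuedValue_scale {Λ Λ' : Submodule ℤ ℂ} {lam : ℂ} (hlam : lam ≠ 0)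
    (h : ∀ z, lam * z ∈ Λ' ↔ z ∈ Λ) {k : ℕ} {z v : ℂ}
    (hv : HasContinuedValueAtZero (eisensteinSeries Λ k z) v) :
    HasContinuedValueAtZero (eisensteinSeries Λ' k (lam * z)) ((lam ^ k)⁻¹ * v) :=
  hv.const_mul_cpow _ (norm_pos_iff.2 hlam) fun s _ => eisensteinSeries_scale hlam h k z s

/-- In real coordinates the pairing is exp(2πi · det). Hence it is trivial on lattice vectors, and
only lattice vectors pair trivially with the whole lattice. -/
lemma pairing_tau_eq (τ : ℂ) (a b c d : ℝ) (hτ : τ.im ≠ 0) :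
    pairing (Real.pi / τ.im) (a * τ + b) (c * τ + d) =
      cexp (2 * Real.pi * I * ((a * d - b * c : ℝ) : ℂ)) := by
  unfold pairing
  congr 1
  have h0 : (τ.im : ℂ) ≠ 0 := ofReal_ne_zero.2 hτ
  have e : τ - star τ = 2 * τ.im * I := by
    apply Complex.ext <;> simp; ring
  simp only [star_add, star_mul', Complex.star_def, conj_ofReal]
  rw [Complex.star_def] at e
  push_cast
  field_simp
  linear_combination (a * d - b * c) * e

lemma exp_two_pi_real_eq_one {x : ℝ} (h : cexp (2 * Real.pi * I * (x : ℂ)) = 1) :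
    ∃ n : ℤ, x = n := by
  obtain ⟨n, hn⟩ := Complex.exp_eq_one_iff.1 h
  refine ⟨n, ?_⟩
  have h2 := Complex.two_pi_I_ne_zero
  have : (x : ℂ) = n := by
    apply mul_left_cancel₀ h2; linear_combination hn
  exact_mod_cast this

lemma tau_coords {τ : ℂ} (hτ : 0 < τ.im) (w : ℂ) : ∃ a b : ℝ, w = a * τ + b := by
  refine ⟨w.im / τ.im, w.re - w.im / τ.im * τ.re, ?_⟩
  apply Complex.ext
  · simp
  · simp [hτ.ne']

/-- Every lattice carries a perfect pairing of the torus with itself, and the value `E₁(w)` is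
the value at `0` of the continuation of the series `∑ ψ(l, w) l⁻¹ |l|⁻ˢ`. -/
theorem exists_pairing (L : PeriodPair) : ∃ β : ℝ,
    (∀ l ∈ L.lattice, ∀ m ∈ L.lattice, pairing β l m = 1) ∧
    (∀ w, (∀ l ∈ L.lattice, pairing β l w = 1) → w ∈ L.lattice) ∧
    ∀ w, HasContinuedValueAtZero (eisensteinSeries L.lattice 1 w) (E L.lattice 1 w) ∧
      HasContinuedValueAtZero (charSeries β L.lattice w) (E L.lattice 1 w) := by
  obtain ⟨lam, τ, hτ, hlam, -, -, h⟩ := exists_fd_basis L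
  refine ⟨Real.pi / τ.im / ‖lam‖ ^ 2, ?_, ?_, ?_⟩
  · intro l hl m hm
    rw [← mul_inv_cancel_left₀ hlam l, h, mem_tauPair] at hl
    rw [← mul_inv_cancel_left₀ hlam m, h, mem_tauPair] at hm
    obtain ⟨a, b, hab⟩ := hl
    obtain ⟨c, d, hcd⟩ := hm
    rw [← mul_inv_cancel_left₀ hlam l, ← mul_inv_cancel_left₀ hlam m, pairing_scale _ hlam,
      ← hab, ← hcd]
    have := pairing_tau_eq τ a b c d hτ.ne'
    push_cast at this
    rw [this, Complex.exp_eq_one_iff]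
    exact ⟨a * d - b * c, by push_cast; ring⟩
  · intro w hw
    rw [← mul_inv_cancel_left₀ hlam w, h, mem_tauPair]
    obtain ⟨a, b, hab⟩ := tau_coords hτ (lam⁻¹ * w)
    have key : ∀ c d : ℤ, pairing (Real.pi / τ.im) (c * τ + d) (lam⁻¹ * w) = 1 := by
      intro c d
      rw [← pairing_scale _ hlam, mul_inv_cancel_left₀ hlam]
      exact hw _ ((h _).2 ((mem_tauPair hτ).2 ⟨c, d, rfl⟩))
    have k1 := key 1 0
    have k2 := key 0 1
    rw [hab] at k1 k2
    have p1 := pairing_tau_eq τ 1 0 a b hτ.ne'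
    have p2 := pairing_tau_eq τ 0 1 a b hτ.ne'
    push_cast at k1 k2 p1 p2
    rw [k1] at p1
    rw [k2] at p2
    obtain ⟨n, hn⟩ := exp_two_pi_real_eq_one (x := 1 * b - 0 * a) (by push_cast; exact p1.symm)
    obtain ⟨m, hm⟩ := exp_two_pi_real_eq_one (x := 0 * b - 1 * a) (by push_cast; exact p2.symm)
    refine ⟨-m, n, ?_⟩
    have hb : b = n := by linarith
    have ha : a = -m := by linarith
    rw [hab, ha, hb]; push_cast; ring
  · intro w
    obtain ⟨v, hv1, hv2⟩ := hecke_continuation_tau hτ (lam⁻¹ * w)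
    have h1 := hasContinuedValue_scale hlam h hv1
    have h2 := hv2.const_mul_cpow ((lam ^ 1)⁻¹) (norm_pos_iff.2 hlam)
      fun s _ => charSeries_scale hlam h (Real.pi / τ.im) (lam⁻¹ * w) s
    rw [mul_inv_cancel_left₀ hlam] at h1 h2
    have e : E L.lattice 1 w = (lam ^ 1)⁻¹ * v := h1.eq
    rw [e]
    exact ⟨h1, h2⟩

/-! ### Taylor expansion of the Eisenstein terms: E₁ as a corrected Weierstrass zeta function -/

/-- The function `u⁻¹ |u|⁻ˢ`. -/
def absPow (s u : ℂ) : ℂ := u⁻¹ * (‖u‖ : ℂ) ^ (-s)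

lemma absPow_mul (s u v : ℂ) : absPow s (u * v) = absPow s u * absPow s v := by
  unfold absPow
  rw [norm_mul, ofReal_mul, mul_cpow_ofReal_nonneg (norm_nonneg _) (norm_nonneg _), mul_inv]
  ring

lemma norm_absPow (s : ℂ) {u : ℂ} (hu : u ≠ 0) : ‖absPow s u‖ = ‖u‖ ^ (-1 - s.re) := by
  have hn : 0 < ‖u‖ := norm_pos_iff.2 hu
  rw [absPow, norm_mul, norm_cpow_eq_rpow_re_of_pos hn, norm_inv, sub_eq_add_neg,
    Real.rpow_add hn, Real.rpow_neg_one, neg_re]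

/-- Near 1 the function is (1+x)^(-1-s/2) (1+x̄)^(-s/2). As a single exponential of logarithms it
can be expanded in x and x̄ with constants uniform in s. -/
lemma absPow_one_add (s : ℂ) {x : ℂ} (hx : ‖x‖ < 1) :
    absPow s (1 + x) = cexp (-(1 + s / 2) * log (1 + x) - s / 2 * log (1 + star x)) := by
  have hsl : ∀ y : ℂ, ‖y‖ < 1 → 1 + y ∈ slitPlane := fun y hy => mem_slitPlane_of_norm_lt_one hy
  have h0 : (1 + x) ≠ 0 := slitPlane_ne_zero (hsl x hx)
  have hn : 0 < ‖1 + x‖ := norm_pos_iff.2 h0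
  have e1 : log (1 + star x) = star (log (1 + x)) := by
    have := log_conj (1 + x) (slitPlane_arg_ne_pi (hsl x hx))
    simpa using this
  have e2 : log (1 + x) + star (log (1 + x)) = ((2 * Real.log ‖1 + x‖ : ℝ) : ℂ) := by
    rw [Complex.star_def, add_conj, log_re]
  rw [absPow, cpow_def_of_ne_zero (ofReal_ne_zero.2 hn.ne'), e1, ← ofReal_log hn.le]
  have e3 : (1 + x)⁻¹ = cexp (-log (1 + x)) := by rw [Complex.exp_neg, exp_log h0]
  rw [e3, ← Complex.exp_add]
  congr 1
  push_cast at e2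
  linear_combination (s / 2) * e2

lemma absPow_taylor {R : ℝ} (hR : 0 ≤ R) : ∃ K : ℝ, 0 ≤ K ∧ ∀ s : ℂ, ‖s‖ ≤ R → ∀ x : ℂ,
    ‖x‖ ≤ 1 / 2 → ‖absPow s (1 + x) - 1 + ((1 + s / 2) * x + s / 2 * star x)‖ ≤ K * ‖x‖ ^ 2 := by
  refine ⟨(1 + R) + (9 / 4) * (1 + R) ^ 2 * Real.exp (1 + R), by positivity, fun s hs x hx => ?_⟩
  have hx1 : ‖x‖ < 1 := by linarith
  have hsx : ‖star x‖ = ‖x‖ := norm_star x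
  have hs2 : ‖s / 2‖ ≤ R / 2 := by rw [norm_div]; norm_num; linarith
  have hs1 : ‖1 + s / 2‖ ≤ 1 + R / 2 := (norm_add_le _ _).trans (by rw [norm_one]; linarith)
  set A := log (1 + x)
  set B := log (1 + star x)
  have hA1 : ‖A‖ ≤ 3 / 2 * ‖x‖ := norm_log_one_add_half_le_self hx
  have hB1 : ‖B‖ ≤ 3 / 2 * ‖x‖ := by
    have := norm_log_one_add_half_le_self (z := star x) (by rwa [hsx])
    rwa [hsx] at this
  have hq : ‖x‖ ^ 2 * (1 - ‖x‖)⁻¹ / 2 ≤ ‖x‖ ^ 2 := by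
    have : (1 - ‖x‖)⁻¹ ≤ 2 := by
      rw [inv_le_comm₀ (by linarith) (by norm_num)]; linarith
    nlinarith [sq_nonneg ‖x‖]
  have hA2 : ‖A - x‖ ≤ ‖x‖ ^ 2 := (norm_log_one_add_sub_self_le hx1).trans hq
  have hB2 : ‖B - star x‖ ≤ ‖x‖ ^ 2 := by
    have := norm_log_one_add_sub_self_le (z := star x) (by rwa [hsx])
    rw [hsx] at this
    exact this.trans hq
  set X := -(1 + s / 2) * A - s / 2 * B with hX
  have hXn : ‖X‖ ≤ (1 + R) * (3 / 2 * ‖x‖) := by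
    calc ‖X‖ ≤ ‖-(1 + s / 2) * A‖ + ‖s / 2 * B‖ := norm_sub_le _ _
      _ = ‖1 + s / 2‖ * ‖A‖ + ‖s / 2‖ * ‖B‖ := by rw [norm_mul, norm_mul, norm_neg]
      _ ≤ (1 + R / 2) * (3 / 2 * ‖x‖) + R / 2 * (3 / 2 * ‖x‖) := by gcongr
      _ = _ := by ring
  have hXn1 : ‖X‖ ≤ 1 + R := hXn.trans (by nlinarith)
  have hexp : ‖cexp X - 1 - X‖ ≤ ‖X‖ ^ 2 * Real.exp ‖X‖ := by
    have := norm_exp_sub_sum_le_norm_mul_exp X 2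
    simpa [Finset.sum_range_succ, sub_sub] using this
  have e : absPow s (1 + x) - 1 + ((1 + s / 2) * x + s / 2 * star x) =
      (cexp X - 1 - X) + (-(1 + s / 2) * (A - x) - s / 2 * (B - star x)) := by
    rw [absPow_one_add s hx1, ← hX, hX]; ring
  rw [e]
  calc _ ≤ ‖cexp X - 1 - X‖ + ‖-(1 + s / 2) * (A - x) - s / 2 * (B - star x)‖ := norm_add_le _ _
    _ ≤ ((1 + R) * (3 / 2 * ‖x‖)) ^ 2 * Real.exp (1 + R) +
        ((1 + R / 2) * ‖x‖ ^ 2 + R / 2 * ‖x‖ ^ 2) := by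
        refine add_le_add (hexp.trans ?_) ((norm_sub_le _ _).trans ?_)
        · gcongr
        · rw [norm_mul, norm_mul, norm_neg]
          gcongr
    _ = _ := by ring

/-- The second order Taylor remainder of `absPow s` at `l`. -/
def absPowRem (s l z : ℂ) : ℂ :=
  absPow s (l + z) - absPow s l + ((1 + s / 2) * z * ((l ^ 2)⁻¹ * (‖l‖ : ℂ) ^ (-s)) +
    s / 2 * star z * (‖l‖ : ℂ) ^ (-2 - s))

lemma absPowRem_eq {s l z : ℂ} (hl : l ≠ 0) : absPowRem s l z =
    absPow s l * (absPow s (1 + z / l) - 1 + ((1 + s / 2) * (z / l) + s / 2 * star (z / l))) := by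
  have h0 : (‖l‖ : ℂ) ≠ 0 := ofReal_ne_zero.2 (norm_ne_zero_iff.2 hl)
  have hs : star l ≠ 0 := by simpa using hl
  have e2 : l * star l = (‖l‖ : ℂ) ^ 2 := by
    rw [Complex.star_def, mul_conj, normSq_eq_norm_sq]; push_cast; rfl
  have e1 : l + z = l * (1 + z / l) := by field_simp
  have e3 : (‖l‖ : ℂ) ^ (-2 - s) = (l * star l)⁻¹ * (‖l‖ : ℂ) ^ (-s) := by
    rw [e2, sub_eq_add_neg, cpow_add _ _ h0, cpow_neg]
    norm_cast
  unfold absPowRem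
  rw [e1, absPow_mul, e3, star_div₀]
  unfold absPow
  field_simp

/-- Removing the constant and linear terms gains two powers of |l|. The remainder is summable over
the lattice for Re s > -1, in particular around s = 0. -/
lemma norm_absPowRem_le {R : ℝ} (hR : 0 ≤ R) : ∃ K : ℝ, 0 ≤ K ∧ ∀ s : ℂ, ‖s‖ ≤ R → ∀ l z : ℂ,
    l ≠ 0 → 2 * ‖z‖ ≤ ‖l‖ → ‖absPowRem s l z‖ ≤ K * ‖z‖ ^ 2 * ‖l‖ ^ (-3 - s.re) := by
  obtain ⟨K, hK0, hK⟩ := absPow_taylor hR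
  refine ⟨K, hK0, fun s hs l z hl hz => ?_⟩
  have hn : 0 < ‖l‖ := norm_pos_iff.2 hl
  have h := hK s hs (z / l) (by rw [norm_div, div_le_iff₀ hn]; linarith)
  rw [absPowRem_eq hl, norm_mul, norm_absPow s hl]
  calc _ ≤ ‖l‖ ^ (-1 - s.re) * (K * ‖z / l‖ ^ 2) := by gcongr
    _ = _ := by
      rw [norm_div, div_pow, show -1 - s.re = (-3 - s.re) + 2 by ring, Real.rpow_add hn,
        Real.rpow_two]
      field_simp

/-- A series of holomorphic functions, dominated by a summable sequence up to finitely many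
terms. -/
lemma tsum_cofinite_bound {ι : Type*} {F : ι → ℂ → ℂ} {U : Set ℂ} (hU : IsOpen U) {u : ι → ℝ}
    (hu : Summable u) (hF : ∀ i, DifferentiableOn ℂ (F i) U) {S : Set ι} (hS : S.Finite)
    (hle : ∀ i ∉ S, ∀ s ∈ U, ‖F i s‖ ≤ u i) :
    (∀ s ∈ U, Summable fun i => F i s) ∧ DifferentiableOn ℂ (fun s => ∑' i, F i s) U ∧
      ∀ s ∈ U, HasSum (fun i => deriv (F i) s) (deriv (fun s => ∑' i, F i s) s) := by
  classical
  set v : ι → ℝ := fun i => if i ∈ S then 0 else u i with hv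
  set G : ι → ℂ → ℂ := fun i s => if i ∈ S then 0 else F i s with hG
  have hvs : Summable v := by
    refine hu.congr_cofinite ?_
    have : ∀ᶠ i in cofinite, i ∉ S := hS.compl_mem_cofinite
    filter_upwards [this] with i hi
    simp [hv, hi]
  have hGd : ∀ i, DifferentiableOn ℂ (G i) U := fun i => by
    by_cases h : i ∈ S
    · simp only [hG, h, if_true]; exact differentiableOn_const _
    · simp only [hG, h, if_false]; exact hF i
  have hGle : ∀ i, ∀ s ∈ U, ‖G i s‖ ≤ v i := fun i s hs => by
    by_cases h : i ∈ S
    · simp [hG, hv, h]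
    · simpa [hG, hv, h] using hle i h s hs
  have hGs : ∀ s ∈ U, Summable fun i => G i s := fun s hs =>
    hvs.of_norm_bounded fun i => hGle i s hs
  have hFG : ∀ i s, F i s = G i s + if i ∈ hS.toFinset then F i s else 0 := fun i s => by
    by_cases h : i ∈ S <;> simp [hG, h]
  have hfin : ∀ s, HasSum (fun i => if i ∈ hS.toFinset then F i s else 0)
      (∑ i ∈ hS.toFinset, F i s) := fun s => by
    have : HasSum (fun i => if i ∈ hS.toFinset then F i s else 0)
        (∑ i ∈ hS.toFinset, if i ∈ hS.toFinset then F i s else 0) :=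
      hasSum_sum_of_ne_finset_zero fun b hb => by rw [if_neg hb]
    rwa [Finset.sum_congr rfl (fun i hi => if_pos hi)] at this
  have hsum : ∀ s ∈ U, HasSum (fun i => F i s) (∑' i, G i s + ∑ i ∈ hS.toFinset, F i s) := by
    intro s hs
    have := (hGs s hs).hasSum.add (hfin s)
    simpa only [← hFG] using this
  have hGdiff := Complex.differentiableOn_tsum_of_summable_norm hvs hGd hU hGle
  have hSdiff : DifferentiableOn ℂ (fun s => ∑ i ∈ hS.toFinset, F i s) U :=
    DifferentiableOn.fun_sum fun i _ => hF i
  refine ⟨fun s hs => (hsum s hs).summable, ?_, fun s hs => ?_⟩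
  · exact (hGdiff.add hSdiff).congr fun s hs => (hsum s hs).tsum_eq
  · have hnh := hU.mem_nhds hs
    have hev : (fun s => ∑' i, F i s) =ᶠ[𝓝 s] fun s => ∑' i, G i s + ∑ i ∈ hS.toFinset, F i s := by
      filter_upwards [hnh] with t ht using (hsum t ht).tsum_eq
    have hGd' := Complex.hasSum_deriv_of_summable_norm hvs hGd hU hGle hs
    rw [hev.deriv_eq, deriv_fun_add (hGdiff.differentiableAt hnh) (hSdiff.differentiableAt hnh),
      deriv_fun_sum fun i _ => (hF i).differentiableAt hnh]
    have hfin' : HasSum (fun i => if i ∈ hS.toFinset then deriv (F i) s else 0)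
        (∑ i ∈ hS.toFinset, deriv (F i) s) := by
      have : HasSum (fun i => if i ∈ hS.toFinset then deriv (F i) s else 0)
          (∑ i ∈ hS.toFinset, if i ∈ hS.toFinset then deriv (F i) s else 0) :=
        hasSum_sum_of_ne_finset_zero fun b hb => by rw [if_neg hb]
      rwa [Finset.sum_congr rfl (fun i hi => if_pos hi)] at this
    have e : (fun i => deriv (F i) s) =
        fun i => deriv (G i) s + if i ∈ hS.toFinset then deriv (F i) s else 0 := by
      funext i
      by_cases h : i ∈ S
      · simp [hG, h]
      · simp [hG, h]
    have h2 := hGd'.add hfin'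
    rwa [← e] at h2

lemma finite_lattice_le (L : PeriodPair) (R : ℝ) : {l : L.lattice | ‖(l : ℂ)‖ ≤ R}.Finite := by
  simpa using finite_lattice_norm_le L 0 R

lemma differentiable_absPow (u : ℂ) : Differentiable ℂ fun s => absPow s u := by
  unfold absPow
  by_cases h : u = 0
  · subst h; simp
  · exact Differentiable.const_mul (fun s => differentiableAt_id.neg.const_cpow
      (Or.inl (ofReal_ne_zero.2 (norm_ne_zero_iff.2 h)))) _

lemma differentiable_absPowRem {l : ℂ} (hl : l ≠ 0) (z : ℂ) :
    Differentiable ℂ fun s => absPowRem s l z := by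
  have h0 : (‖l‖ : ℂ) ≠ 0 := ofReal_ne_zero.2 (norm_ne_zero_iff.2 hl)
  unfold absPowRem
  have h1 := differentiable_absPow (l + z)
  have h2 := differentiable_absPow l
  have h3 : Differentiable ℂ fun s : ℂ => (‖l‖ : ℂ) ^ (-s) := fun s =>
    differentiableAt_id.neg.const_cpow (Or.inl h0)
  have h4 : Differentiable ℂ fun s : ℂ => (‖l‖ : ℂ) ^ (-2 - s) := fun s =>
    (differentiableAt_id.const_sub (-2)).const_cpow (Or.inl h0)
  fun_prop

open scoped Classical in
/-- The sum of the Taylor remainders over the non-zero lattice points. -/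
def remSum (L : PeriodPair) (z s : ℂ) : ℂ :=
  ∑' l : L.lattice, if l = 0 then 0 else absPowRem s l z

open scoped Classical in
lemma remSum_spec (L : PeriodPair) (z : ℂ) : DifferentiableOn ℂ (remSum L z) {s | -1 < s.re} ∧
    ∀ s : ℂ, -1 < s.re →
      Summable fun l : L.lattice => if l = 0 then 0 else absPowRem s l z := by
  have key : ∀ s₀ : ℂ, -1 < s₀.re → ∃ U : Set ℂ, IsOpen U ∧ s₀ ∈ U ∧
      DifferentiableOn ℂ (remSum L z) U ∧
      ∀ s ∈ U, Summable fun l : L.lattice => if l = 0 then 0 else absPowRem s l z := by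
    intro s₀ hs₀
    obtain ⟨K, hK0, hK⟩ := norm_absPowRem_le (R := ‖s₀‖ + 1) (by positivity)
    set σ := (s₀.re - 1) / 2 with hσ
    set U : Set ℂ := {s | σ < s.re} ∩ Metric.ball 0 (‖s₀‖ + 1) with hU
    have hUo : IsOpen U := (isOpen_lt continuous_const continuous_re).inter Metric.isOpen_ball
    have h := tsum_cofinite_bound (F := fun (l : L.lattice) s => if l = 0 then 0 else
      absPowRem s l z) hUo ((summable_lattice_rpow L (r := -3 - σ) (by linarith)).mul_left
        (K * ‖z‖ ^ 2)) (fun l => ?_) (finite_lattice_le L (max 1 (2 * ‖z‖))) ?_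
    · refine ⟨U, hUo, ⟨?_, by simp⟩, h.2.1, h.1⟩
      simp only [Set.mem_ofPred_eq, hσ]; linarith
    · by_cases hl : l = 0
      · simp only [hl, if_true]; exact differentiableOn_const _
      · simp only [hl, if_false]
        exact (differentiable_absPowRem (by simpa using hl) z).differentiableOn
    · intro l hl s hs
      simp only [Set.mem_ofPred_eq, not_le, max_lt_iff] at hl
      have hl0 : (l : ℂ) ≠ 0 := by rw [← norm_pos_iff]; linarith
      have hl0' : l ≠ 0 := by simpa using hl0
      rw [if_neg hl0']
      have hsn : ‖s‖ ≤ ‖s₀‖ + 1 := by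
        have := hs.2; simp only [Metric.mem_ball, dist_zero_right] at this; exact this.le
      refine (hK s hsn l z hl0 hl.2.le).trans ?_
      have : -3 - s.re ≤ -3 - σ := by
        have : σ < s.re := hs.1
        linarith
      gcongr
      exact hl.1.le
  refine ⟨fun s hs => ?_, fun s hs => ?_⟩
  · obtain ⟨U, hUo, hsU, hd, -⟩ := key s hs
    exact (hd.differentiableAt (hUo.mem_nhds hsU)).differentiableWithinAt
  · obtain ⟨U, hUo, hsU, -, hs'⟩ := key s hs
    exact hs' s hsU

open scoped Classical in
/-- The series `∑ |l|⁻²⁻ˢ` over the non-zero `l`. -/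
def epsteinSeries (L : PeriodPair) (s : ℂ) : ℂ :=
  ∑' l : L.lattice, if l = 0 then 0 else (‖(l : ℂ)‖ : ℂ) ^ (-2 - s)

lemma absPow_neg (s u : ℂ) : absPow s (-u) = -absPow s u := by
  simp [absPow, inv_neg]

/-- The constant Taylor terms cancel by l ↦ -l, and the two linear terms produce the E₂ series and
the Epstein series. The point l = 0 has no expansion and contributes `absPow s z` by itself. -/
lemma eisensteinSeries_one_eq {L : PeriodPair} {z : ℂ} (hz : z ∉ L.lattice) {s : ℂ}
    (hs : 2 < s.re) : eisensteinSeries L.lattice 1 z s = absPow s z + remSum L z s -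
      ((1 + s / 2) * z * eisensteinSeries L.lattice 2 0 s + s / 2 * star z * epsteinSeries L s) := by
  classical
  have hne : ∀ l : L.lattice, (l : ℂ) + z ≠ 0 := fun l h => hz (by
    rw [show z = -(l : ℂ) by linear_combination h]; exact L.lattice.neg_mem l.2)
  have e1 : eisensteinSeries L.lattice 1 z s = ∑' l : L.lattice, absPow s (l + z) := by
    unfold eisensteinSeries absPow
    refine tsum_congr fun l => ?_
    rw [if_neg (hne l), pow_one]
  set g : L.lattice → ℂ := fun l => ((l : ℂ) ^ 2)⁻¹ * (‖(l : ℂ)‖ : ℂ) ^ (-s) with hg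
  set y : L.lattice → ℂ := fun l => if l = 0 then 0 else (‖(l : ℂ)‖ : ℂ) ^ (-2 - s) with hy
  have e2 : eisensteinSeries L.lattice 2 0 s = ∑' l, g l := by
    unfold eisensteinSeries
    refine tsum_congr fun l => ?_
    split_ifs with h
    · rw [add_zero] at h
      simp [hg, h]
    · simp [hg]
  have hgs : Summable g := by
    refine Summable.of_norm_bounded (summable_lattice_rpow L (r := -2 - s.re) (by linarith)) ?_
    intro l
    by_cases h : (l : ℂ) = 0
    · simp only [hg, h]
      simp
      positivity
    · have hn : 0 < ‖(l : ℂ)‖ := norm_pos_iff.2 h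
      rw [hg, norm_mul, norm_cpow_eq_rpow_re_of_pos hn, norm_inv, norm_pow, sub_eq_add_neg,
        Real.rpow_add hn, neg_re, Real.rpow_neg hn.le 2, Real.rpow_two]
  have hys : Summable y := by
    refine Summable.of_norm_bounded (summable_lattice_rpow L (r := -2 - s.re) (by linarith)) ?_
    intro l
    by_cases h : l = 0
    · simp only [hy, h, if_true, norm_zero]; positivity
    · have hn : 0 < ‖(l : ℂ)‖ := by simpa using h
      simp only [hy, h, if_false]
      rw [norm_cpow_eq_rpow_re_of_pos hn]
      simp
  have hss : Summable fun l : L.lattice => absPow s l := by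
    refine Summable.of_norm_bounded (summable_lattice_rpow L (r := -1 - s.re) (by linarith)) ?_
    intro l
    by_cases h : (l : ℂ) = 0
    · simp only [h, absPow]
      simp
      positivity
    · rw [norm_absPow s h]
  have hodd : ∑' l : L.lattice, absPow s l = 0 := by
    have h1 := (Equiv.neg L.lattice).tsum_eq fun l : L.lattice => absPow s l
    simp only [Equiv.neg_apply, NegMemClass.coe_neg, absPow_neg, tsum_neg] at h1
    linear_combination (-1 / 2 : ℂ) * h1
  have hrem := (remSum_spec L z).2 s (by linarith)
  have hdelta : HasSum (fun l : L.lattice => if l = 0 then absPow s z else 0) (absPow s z) :=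
    hasSum_ite_eq 0 _
  have htot := ((hdelta.add hrem.hasSum).add hss.hasSum).sub
    ((hgs.hasSum.mul_left ((1 + s / 2) * z)).add (hys.hasSum.mul_left (s / 2 * star z)))
  rw [hodd, add_zero] at htot
  rw [e1, e2]
  refine Eq.trans (tsum_congr fun l => ?_) htot.tsum_eq
  by_cases h : l = 0
  · simp [h, hg, hy, absPow]
  · simp only [h, if_false, hg, hy, absPowRem]
    ring

open scoped Classical in
/-- The regular part at `0` of the Weierstrass zeta function. -/
def zetaReg (L : PeriodPair) (z : ℂ) : ℂ :=
  ∑' l : L.lattice, if l = 0 then 0 else (1 / (z - l) + 1 / l + z / (l : ℂ) ^ 2)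

lemma absPow_zero (u : ℂ) : absPow 0 u = u⁻¹ := by simp [absPow]

/-- At s = 0 the z̄-term carries the factor s/2 and drops out; l ↦ -l turns what remains into the
zeta series. -/
lemma remSum_zero (L : PeriodPair) (z : ℂ) : remSum L z 0 = zetaReg L z := by
  classical
  unfold remSum zetaReg
  rw [← (Equiv.neg L.lattice).tsum_eq]
  refine tsum_congr fun l => ?_
  by_cases h : l = 0
  · simp [h]
  · have h' : (l : ℂ) ≠ 0 := by simpa using h
    simp only [Equiv.neg_apply, neg_eq_zero, h, if_false, absPowRem, absPow_zero]
    simp only [NegMemClass.coe_neg, norm_neg]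
    simp
    rw [show -(l : ℂ) + z = z - l by ring]
    field_simp

/-- `E₁` is the Weierstrass zeta function up to an `ℝ`-linear function whose coefficient of `z`
is `-E₂(0)`. -/
theorem exists_E_one_formula (L : PeriodPair) : ∃ B : ℂ,
    HasContinuedValueAtZero (eisensteinSeries L.lattice 2 0) (E L.lattice 2 0) ∧
    ∀ z ∉ L.lattice, E L.lattice 1 z =
      z⁻¹ + zetaReg L z - E L.lattice 2 0 * z - B * star z := by
  obtain ⟨β, -, -, hE⟩ := exists_pairing L
  have hcont : ∀ z ∉ L.lattice, ∃ ε : ℝ, 0 < ε ∧ ε < 1 ∧ ∃ Φ : ℂ → ℂ,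
      DifferentiableOn ℂ Φ {s | -ε < s.re} ∧ (∀ s : ℂ, 2 < s.re → Φ s =
      -((1 + s / 2) * z * eisensteinSeries L.lattice 2 0 s + s / 2 * star z * epsteinSeries L s)) ∧
      Φ 0 = E L.lattice 1 z - z⁻¹ - zetaReg L z := by
    intro z hz
    obtain ⟨ε, hε, F, hF, hFf, hF0⟩ := (hE z).1
    refine ⟨min ε (1 / 2), by positivity, (min_le_right _ _).trans_lt (by norm_num),
      fun s => F s - absPow s z - remSum L z s, ?_, fun s hs => ?_, ?_⟩
    · refine ((hF.mono fun s hs => ?_).sub (differentiable_absPow z).differentiableOn).sub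
        ((remSum_spec L z).1.mono fun s hs => ?_)
      · have : -min ε (1 / 2) < s.re := hs
        have h2 := min_le_left ε (1 / 2)
        show -ε < s.re
        linarith
      · have : -min ε (1 / 2) < s.re := hs
        have h2 := min_le_right ε (1 / 2)
        show -1 < s.re
        linarith
    · simp only [hFf s hs, eisensteinSeries_one_eq hz hs]; ring
    · simp only [hF0, absPow_zero, remSum_zero]
  obtain ⟨δ, hδ, hδ'⟩ := exists_norm_lower_bound L 0
  have hsmall : ∀ z : ℂ, z ≠ 0 → ‖z‖ < δ → z ∉ L.lattice := by
    intro z hz hzn hzL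
    rcases hδ' ⟨z, hzL⟩ with h | h
    · simp at h; exact hz h
    · simp at h; linarith
  -- The continuation of E₂ is deduced from that of E₁. At z₀ and iz₀, both off the lattice, z
  -- changes by the factor i but z̄ by -i. This gives two independent linear equations for the two
  -- unknown series.
  set z₀ : ℂ := ((δ / 2 : ℝ) : ℂ) with hz₀
  have hz₀0 : z₀ ≠ 0 := ofReal_ne_zero.2 (by positivity)
  have hz₀n : ‖z₀‖ < δ := by
    rw [hz₀, norm_real, Real.norm_of_nonneg (by positivity)]; linarith
  have hz₀s : star z₀ = z₀ := by rw [hz₀, Complex.star_def, conj_ofReal]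
  obtain ⟨ε₁, hε₁, hε₁', Φ₁, hΦ₁, hΦ₁s, -⟩ := hcont z₀ (hsmall z₀ hz₀0 hz₀n)
  obtain ⟨ε₂, hε₂, hε₂', Φ₂, hΦ₂, hΦ₂s, -⟩ := hcont (I * z₀)
    (hsmall _ (mul_ne_zero I_ne_zero hz₀0) (by rwa [norm_mul, norm_I, one_mul]))
  set ε := min ε₁ ε₂
  have hεpos : 0 < ε := lt_min hε₁ hε₂
  have hεlt : ε < 1 := (min_le_left _ _).trans_lt hε₁'
  have hm1 : {s : ℂ | -ε < s.re} ⊆ {s | -ε₁ < s.re} := fun s hs => by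
    have h1 : -ε < s.re := hs
    have h2 : ε ≤ ε₁ := min_le_left _ _
    show -ε₁ < s.re
    linarith
  have hm2 : {s : ℂ | -ε < s.re} ⊆ {s | -ε₂ < s.re} := fun s hs => by
    have h1 : -ε < s.re := hs
    have h2 : ε ≤ ε₂ := min_le_right _ _
    show -ε₂ < s.re
    linarith
  have hden : ∀ s : ℂ, -1 < s.re → (1 + s / 2) ≠ 0 := fun s hs h => by
    have := congrArg Complex.re h
    simp at this
    linarith
  -- `Gc` and `Zc` solve this linear system. The bound ε < 1 keeps the divisor 1 + s/2 away from 0.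
  set Gc : ℂ → ℂ := fun s => (Φ₁ s - I * Φ₂ s) / (-2 * (1 + s / 2) * z₀) with hGc
  set Zc : ℂ → ℂ := fun s => (-(I * Φ₂ s) - Φ₁ s) / (2 * z₀) with hZc
  have hGd : DifferentiableOn ℂ Gc {s | -ε < s.re} := by
    refine ((hΦ₁.mono hm1).sub ((hΦ₂.mono hm2).const_mul I)).div (by fun_prop) fun s hs => ?_
    have h1 : -ε < s.re := hs
    exact mul_ne_zero (mul_ne_zero (by norm_num) (hden s (by linarith))) hz₀0
  have hZd : DifferentiableOn ℂ Zc {s | -ε < s.re} :=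
    (((hΦ₂.mono hm2).const_mul I).neg.sub (hΦ₁.mono hm1)).div_const _
  have hGs : ∀ s : ℂ, 2 < s.re → Gc s = eisensteinSeries L.lattice 2 0 s := fun s hs => by
    have := hden s (by linarith)
    simp only [hGc, hΦ₁s s hs, hΦ₂s s hs, star_mul', hz₀s, Complex.star_def, conj_I]
    rw [div_eq_iff (mul_ne_zero (mul_ne_zero (by norm_num) this) hz₀0)]
    linear_combination ((1 + s / 2) * z₀ * eisensteinSeries L.lattice 2 0 s -
      s / 2 * z₀ * epsteinSeries L s) * I_sq
  have hZs : ∀ s : ℂ, 2 < s.re → Zc s = s / 2 * epsteinSeries L s := fun s hs => by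
    simp only [hZc, hΦ₁s s hs, hΦ₂s s hs, star_mul', hz₀s, Complex.star_def, conj_I]
    field_simp
    ring_nf
    simp only [I_sq]
    ring
  have hG0 : HasContinuedValueAtZero (eisensteinSeries L.lattice 2 0) (Gc 0) :=
    ⟨ε, hεpos, Gc, hGd, hGs, rfl⟩
  have hE2 : E L.lattice 2 0 = Gc 0 := hG0.eq
  refine ⟨Zc 0, hE2 ▸ hG0, fun z hz => ?_⟩
  obtain ⟨ε₃, hε₃, -, Φ, hΦ, hΦs, hΦ0⟩ := hcont z hz
  have h1 : HasContinuedValueAtZero (fun s => -((1 + s / 2) * z * eisensteinSeries L.lattice 2 0 s +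
      s / 2 * star z * epsteinSeries L s)) (Φ 0) := ⟨ε₃, hε₃, Φ, hΦ, hΦs, rfl⟩
  have h2 : HasContinuedValueAtZero (fun s => -((1 + s / 2) * z * eisensteinSeries L.lattice 2 0 s +
      s / 2 * star z * epsteinSeries L s)) (-(z * Gc 0 + star z * Zc 0)) := by
    refine ⟨ε, hεpos, fun s => -((1 + s / 2) * z * Gc s + star z * Zc s), ?_, fun s hs => ?_, ?_⟩
    · refine DifferentiableOn.neg (DifferentiableOn.add (DifferentiableOn.mul ?_ hGd)
        (hZd.const_mul _))
      fun_prop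
    · simp only [hGs s hs, hZs s hs]; ring
    · simp
  -- For general z the same function is continued in two ways; equality at 0 is the required
  -- formula, with B = `Zc 0`.
  have h3 := h1.unique h2
  rw [hΦ0] at h3
  rw [hE2]
  linear_combination h3

/-! ### The Weierstrass zeta function, Liouville arguments and the addition theorem -/

lemma zetaReg_zero (L : PeriodPair) : zetaReg L 0 = 0 := by
  unfold zetaReg
  simp

open PeriodPair in
theorem hasDerivAt_zetaReg (L : PeriodPair) {z : ℂ} (hz : z ∉ L.lattice ∨ z = 0) :
    HasDerivAt (zetaReg L) (-(L.weierstrassPExcept 0 z)) z := by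
  classical
  set U : Set ℂ := Metric.ball 0 (‖z‖ + 1) ∩ ((L.lattice : Set ℂ) \ {0})ᶜ with hU
  have hUo : IsOpen U := Metric.isOpen_ball.inter L.isOpen_compl_lattice_sdiff
  have hzU : z ∈ U := ⟨by simp, fun h => by
    rcases hz with hz | hz
    · exact hz h.1
    · exact h.2 hz⟩
  have hne : ∀ s ∈ U, ∀ l : L.lattice, l ≠ 0 → s - (l : ℂ) ≠ 0 := fun s hs l hl h => hs.2
    ⟨by rw [sub_eq_zero.1 h]; exact l.2, fun h' => hl (by
      rw [Set.mem_singleton_iff] at h'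
      rw [h', zero_sub, neg_eq_zero] at h
      exact Subtype.ext h)⟩
  have hd : ∀ l : L.lattice, l ≠ 0 → ∀ s ∈ U, HasDerivAt
      (fun s : ℂ => 1 / (s - l) + 1 / l + s / (l : ℂ) ^ 2)
      (-(1 / (s - l) ^ 2 - 1 / (l : ℂ) ^ 2)) s := fun l hl s hs => by
    have h1 := ((((hasDerivAt_id s).sub_const (l : ℂ)).inv (hne s hs l hl)).add_const
      (1 / (l : ℂ))).add ((hasDerivAt_id s).div_const ((l : ℂ) ^ 2))
    refine (h1.congr_deriv ?_).congr_of_eventuallyEq (Eventually.of_forall fun w => ?_)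
    · simp only [id]; ring
    · simp [one_div]
  have h := tsum_cofinite_bound (F := fun (l : L.lattice) s => if l = 0 then 0 else
      (1 / (s - l) + 1 / l + s / (l : ℂ) ^ 2)) hUo ((summable_lattice_rpow L (r := -3)
        (by norm_num)).mul_left (2 * (‖z‖ + 1) ^ 2)) (fun l => ?_)
        (finite_lattice_le L (2 * (‖z‖ + 1))) ?_
  · have h2 := h.2.2 z hzU
    have h3 : (fun l : L.lattice => deriv (fun s => if l = 0 then 0 else
        (1 / (s - l) + 1 / l + s / (l : ℂ) ^ 2)) z) = fun l : L.lattice => -(if (l : ℂ) = 0 then 0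
          else (1 / (z - l) ^ 2 - 1 / (l : ℂ) ^ 2)) := by
      funext l
      by_cases hl : l = 0
      · simp [hl]
      · have hl' : (l : ℂ) ≠ 0 := by simpa using hl
        simp only [hl, hl', if_false]
        exact (hd l hl z hzU).deriv
    rw [h3] at h2
    have h4 := h2.unique (L.hasSum_weierstrassPExcept 0 z).neg
    rw [← h4]
    exact (h.2.1.differentiableAt (hUo.mem_nhds hzU)).hasDerivAt
  · by_cases hl : l = 0
    · simp only [hl, if_true]; exact differentiableOn_const _
    · simp only [hl, if_false]
      exact fun s hs => (hd l hl s hs).differentiableAt.differentiableWithinAt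
  · intro l hl s hs
    simp only [Set.mem_ofPred_eq, not_le] at hl
    have hl0 : 0 < ‖(l : ℂ)‖ := by have := norm_nonneg z; linarith
    have hl1 : (l : ℂ) ≠ 0 := norm_pos_iff.1 hl0
    have hl' : l ≠ 0 := by simpa using hl1
    have hsl := hne s hs l hl'
    rw [if_neg hl']
    have hsn : ‖s‖ < ‖z‖ + 1 := by simpa using hs.1
    have e : 1 / (s - l) + 1 / l + s / (l : ℂ) ^ 2 = s ^ 2 / ((l : ℂ) ^ 2 * (s - l)) := by
      field_simp; ring
    have hlow : ‖(l : ℂ)‖ / 2 ≤ ‖s - l‖ := by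
      rw [norm_sub_rev]
      exact le_trans (by linarith) (norm_sub_norm_le _ _)
    rw [e, norm_div, norm_mul, norm_pow, norm_pow, Real.rpow_neg hl0.le,
      show (3 : ℝ) = ((3 : ℕ) : ℝ) by norm_num, Real.rpow_natCast]
    calc ‖s‖ ^ 2 / (‖(l : ℂ)‖ ^ 2 * ‖s - l‖) ≤ (‖z‖ + 1) ^ 2 / (‖(l : ℂ)‖ ^ 2 * (‖(l : ℂ)‖ / 2)) := by
          gcongr
      _ = _ := by field_simp

/-- The Weierstrass zeta function. -/
def zetaW (L : PeriodPair) (z : ℂ) : ℂ := z⁻¹ + zetaReg L z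

lemma hasDerivAt_zetaW (L : PeriodPair) {z : ℂ} (hz : z ∉ L.lattice) :
    HasDerivAt (zetaW L) (-(L.weierstrassP z)) z := by
  have hz0 : z ≠ 0 := fun h => hz (h ▸ L.lattice.zero_mem)
  have h := (hasDerivAt_inv hz0).add (hasDerivAt_zetaReg L (Or.inl hz))
  refine h.congr_deriv ?_
  have := L.weierstrassPExcept_def 0 z
  simp only [ZeroMemClass.coe_zero] at this
  rw [this]
  simp

lemma E_one_neg (Λ : Submodule ℤ ℂ) (z : ℂ) (h : ∃ v, HasContinuedValueAtZero
    (eisensteinSeries Λ 1 z) v) : E Λ 1 (-z) = -E Λ 1 z := by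
  obtain ⟨v, hv⟩ := h
  have h1 : eisensteinSeries Λ 1 (-z) = fun s => -eisensteinSeries Λ 1 z s := by
    funext s
    unfold eisensteinSeries
    rw [← tsum_neg, ← (Equiv.neg Λ).tsum_eq]
    refine tsum_congr fun l => ?_
    simp only [Equiv.neg_apply, NegMemClass.coe_neg, ← neg_add, neg_eq_zero, norm_neg, pow_one,
      inv_neg]
    split_ifs <;> simp
  have h2 : HasContinuedValueAtZero (eisensteinSeries Λ 1 (-z)) (-v) := by
    obtain ⟨ε, hε, F, hF, hf, h0⟩ := hv
    exact ⟨ε, hε, fun s => -F s, hF.neg, fun s hs => by simp only [h1, ← hf s hs],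
      by simp only [h0]⟩
  rw [E, E, h2.eq, hv.eq]

lemma E_one_lattice_neg (L : PeriodPair) (z : ℂ) :
    E L.lattice 1 (-z) = -E L.lattice 1 z := by
  obtain ⟨β, -, -, hE⟩ := exists_pairing L
  exact E_one_neg _ _ ⟨_, (hE z).1⟩

lemma E_one_zero (L : PeriodPair) : E L.lattice 1 0 = 0 := by
  have := E_one_lattice_neg L 0
  rw [neg_zero] at this
  linear_combination (1 / 2 : ℂ) * this

/-- A function that is holomorphic off a closed discrete set, with limits at the points of that
set, extends to an entire function. -/
theorem exists_entire_extension {f : ℂ → ℂ} {B : Set ℂ} (hB : ∀ z, ∀ᶠ w in 𝓝[≠] z, w ∉ B)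
    (hf : ∀ z ∉ B, DifferentiableAt ℂ f z) (hl : ∀ z ∈ B, ∃ c, Tendsto f (𝓝[≠] z) (𝓝 c)) :
    ∃ g : ℂ → ℂ, Differentiable ℂ g ∧ (∀ z ∉ B, g z = f z) ∧
      ∀ z c, Tendsto f (𝓝[≠] z) (𝓝 c) → g z = c := by
  have hlim : ∀ z, Tendsto f (𝓝[≠] z) (𝓝 (limUnder (𝓝[≠] z) f)) := fun z => by
    by_cases h : z ∈ B
    · exact tendsto_nhds_limUnder (hl z h)
    · exact tendsto_nhds_limUnder ⟨f z, (hf z h).continuousAt.continuousWithinAt⟩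
  have heq : ∀ z ∉ B, limUnder (𝓝[≠] z) f = f z := fun z h =>
    Tendsto.limUnder_eq (hf z h).continuousAt.continuousWithinAt
  refine ⟨fun z => limUnder (𝓝[≠] z) f, fun z => ?_, heq, fun z c h => h.limUnder_eq⟩
  have hev : (fun w => limUnder (𝓝[≠] w) f) =ᶠ[𝓝[≠] z] f := by
    filter_upwards [hB z] with w hw using heq w hw
  have hnear : ∀ᶠ w in 𝓝[≠] z, DifferentiableAt ℂ (fun w => limUnder (𝓝[≠] w) f) w := by
    filter_upwards [eventually_eventually_nhdsWithin.2 (hB z), hB z, self_mem_nhdsWithin]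
      with w hw hwB hwz
    refine (hf w hwB).congr_of_eventuallyEq ?_
    rw [nhdsWithin_eq_nhds.2 (isOpen_compl_singleton.mem_nhds hwz)] at hw
    filter_upwards [hw] with v hv using heq v hv
  refine (Complex.analyticAt_of_differentiable_on_punctured_nhds_of_continuousAt hnear
    ?_).differentiableAt
  rw [continuousAt_iff_punctured_nhds]
  exact (hlim z).congr' hev.symm

lemma eventually_notMem_lattice (L : PeriodPair) (z : ℂ) : ∀ᶠ w in 𝓝[≠] z, w ∉ L.lattice := by
  have := L.compl_lattice_sdiff_singleton_mem_nhds z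
  filter_upwards [mem_nhdsWithin_of_mem_nhds this, self_mem_nhdsWithin] with w hw hwz h
  exact hw ⟨h, hwz⟩

lemma eq_of_eq_off {f g : ℂ → ℂ} {B : Set ℂ} (hB : ∀ z, ∀ᶠ w in 𝓝[≠] z, w ∉ B)
    (hf : Continuous f) (hg : Continuous g) (h : ∀ z ∉ B, f z = g z) : f = g := by
  funext z
  have h1 : Tendsto f (𝓝[≠] z) (𝓝 (f z)) := hf.continuousAt.continuousWithinAt
  have h2 : Tendsto g (𝓝[≠] z) (𝓝 (g z)) := hg.continuousAt.continuousWithinAt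
  refine tendsto_nhds_unique (h1.congr' ?_) h2
  filter_upwards [hB z] with w hw using h w hw

/-- An entire function that is periodic with respect to a lattice is constant. -/
theorem eq_of_entire_periodic (L : PeriodPair) {f : ℂ → ℂ} (hf : Differentiable ℂ f)
    (hp : ∀ l ∈ L.lattice, ∀ z, f (z + l) = f z) (z w : ℂ) : f z = f w := by
  refine hf.apply_eq_apply_of_bounded ?_ z w
  set b := L.basis with hb
  set R : ℝ := ∑ i, ‖b i‖
  have hcomp : IsCompact (f '' Metric.closedBall 0 R) :=
    (isCompact_closedBall 0 R).image hf.continuous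
  refine hcomp.isBounded.subset ?_
  rintro _ ⟨z, rfl⟩
  have hmem : -((ZSpan.floor b z : Submodule.span ℤ (Set.range b)) : ℂ) ∈ L.lattice := by
    rw [L.lattice_eq_span_range_basis]
    exact Submodule.neg_mem _ (ZSpan.floor b z).2
  refine ⟨ZSpan.fract b z, ?_, ?_⟩
  · rw [mem_closedBall_zero_iff]
    exact ZSpan.norm_fract_le b z
  · rw [ZSpan.fract_apply, sub_eq_add_neg, hp _ hmem]

/-- An entire function whose differences by lattice vectors are constant is affine. -/
theorem affine_of_entire_quasiperiodic (L : PeriodPair) {f : ℂ → ℂ} (hf : Differentiable ℂ f)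
    (hp : ∀ l ∈ L.lattice, ∃ c, ∀ z, f (z + l) = f z + c) :
    ∃ a b : ℂ, ∀ z, f z = a * z + b := by
  have hd : Differentiable ℂ (deriv f) := fun z => (hf.analyticAt z).deriv.differentiableAt
  have hper : ∀ l ∈ L.lattice, ∀ z, deriv f (z + l) = deriv f z := fun l hl z => by
    obtain ⟨c, hc⟩ := hp l hl
    rw [← deriv_comp_add_const, show (fun x => f (x + l)) = fun x => f x + c from funext hc,
      deriv_add_const]
  have hconst := eq_of_entire_periodic L hd hper
  refine ⟨deriv f 0, f 0, fun z => ?_⟩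
  have h1 : Differentiable ℂ fun z => f z - deriv f 0 * z := by fun_prop
  have h2 := is_const_of_deriv_eq_zero h1 (fun w => by
    have h3 : HasDerivAt (fun z => f z - deriv f 0 * z) (deriv f w - deriv f 0 * 1) w :=
      (hf w).hasDerivAt.sub ((hasDerivAt_id w).const_mul _)
    rw [h3.deriv, hconst w 0]; ring) z 0
  simp only [mul_zero, sub_zero] at h2
  linear_combination h2

lemma weierstrassP_add_mem (L : PeriodPair) {m : ℂ} (hm : m ∈ L.lattice) (z : ℂ) :
    L.weierstrassP (z + m) = L.weierstrassP z := L.weierstrassP_add_coe z ⟨m, hm⟩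

lemma weierstrassP_of_mem (L : PeriodPair) {m : ℂ} (hm : m ∈ L.lattice) :
    L.weierstrassP m = 0 := L.weierstrassP_coe ⟨m, hm⟩

lemma weierstrassPExcept_zero_eq (L : PeriodPair) (z : ℂ) :
    L.weierstrassPExcept 0 z = L.weierstrassP z - (z ^ 2)⁻¹ := by
  have := L.weierstrassPExcept_def 0 z
  simp only [ZeroMemClass.coe_zero] at this
  rw [this]; simp [sub_eq_add_neg]

lemma differentiableAt_weierstrassP (L : PeriodPair) {z : ℂ} (hz : z ∉ L.lattice) :
    DifferentiableAt ℂ L.weierstrassP z := (L.analyticOnNhd_weierstrassP z hz).differentiableAt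

lemma tendsto_weierstrassPExcept_zero (L : PeriodPair) :
    Tendsto (L.weierstrassPExcept 0) (𝓝[≠] 0) (𝓝 0) := by
  have h := (L.analyticAt_weierstrassPExcept 0).continuousAt
  have h2 : Tendsto (L.weierstrassPExcept 0) (𝓝[≠] 0) (𝓝 (L.weierstrassPExcept 0 0)) :=
    h.continuousWithinAt
  simpa using h2

/-- The square of a function with principal part `1/u` and vanishing constant term. -/
lemma tendsto_sq_sub_weierstrassP (L : PeriodPair) {h : ℂ → ℂ} {c : ℂ} (hd : HasDerivAt h c 0)
    (h0 : h 0 = 0) : Tendsto (fun u => (u⁻¹ + h u) ^ 2 - L.weierstrassP u) (𝓝[≠] 0)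
      (𝓝 (2 * c)) := by
  have h1 : Tendsto (fun u => u⁻¹ * h u) (𝓝[≠] 0) (𝓝 c) := by
    have := hd.tendsto_slope
    refine this.congr fun u => ?_
    simp [slope_def_field, h0, div_eq_inv_mul]
  have h2 : Tendsto h (𝓝[≠] 0) (𝓝 0) := by
    have : Tendsto h (𝓝[≠] 0) (𝓝 (h 0)) := hd.continuousAt.continuousWithinAt
    rwa [h0] at this
  have h3 := ((h1.const_mul 2).add (h2.pow 2)).sub (tendsto_weierstrassPExcept_zero L)
  have e : (2 * c + 0 ^ 2 - 0 : ℂ) = 2 * c := by ring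
  rw [e] at h3
  refine h3.congr fun u => ?_
  rw [weierstrassPExcept_zero_eq]
  ring

/-- The addition theorem `(E₁(u) + E₁(v) - E₁(u+v))² = ℘(u) + ℘(v) + ℘(u+v)`. -/
theorem E_one_add_sq (L : PeriodPair) {u v : ℂ} (hu : u ∉ L.lattice) (hv : v ∉ L.lattice)
    (huv : u + v ∉ L.lattice) :
    (E L.lattice 1 u + E L.lattice 1 v - E L.lattice 1 (u + v)) ^ 2 =
      L.weierstrassP u + L.weierstrassP v + L.weierstrassP (u + v) := by
  obtain ⟨C, -, hE⟩ := exists_E_one_formula L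
  set G := E L.lattice 2 0
  set e := E L.lattice 1 with he
  set B : Set ℂ := {u | u ∈ L.lattice ∨ u + v ∈ L.lattice} with hB
  -- In E₁(u) - E₁(u+v) the terms in u and ū cancel, so the difference of the two sides is
  -- meromorphic in u. It remains to see that it has no poles and vanishes at one point.
  set f : ℂ → ℂ := fun u => (zetaW L u - zetaW L (u + v) + e v + G * v + C * star v) ^ 2 -
    L.weierstrassP u - L.weierstrassP v - L.weierstrassP (u + v) with hf
  have hfe : ∀ u ∉ B, f u = (e u + e v - e (u + v)) ^ 2 - L.weierstrassP u - L.weierstrassP v -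
      L.weierstrassP (u + v) := fun u hu => by
    simp only [hB, Set.mem_ofPred_eq, not_or] at hu
    have h1 := hE u hu.1
    have h2 := hE (u + v) hu.2
    have h3 : e u + e v - e (u + v) = zetaW L u - zetaW L (u + v) + e v + G * v + C * star v := by
      rw [h1, h2]
      simp only [zetaW, star_add]
      ring
    rw [h3]
  have hfd : ∀ u ∉ B, DifferentiableAt ℂ f u := fun u hu => by
    simp only [hB, Set.mem_ofPred_eq, not_or] at hu
    have h1 := (hasDerivAt_zetaW L hu.1).differentiableAt
    have h2 := (hasDerivAt_zetaW L hu.2).differentiableAt.comp u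
      ((differentiableAt_id (𝕜 := ℂ)).add_const v)
    have h3 := differentiableAt_weierstrassP L hu.1
    have h4 := (differentiableAt_weierstrassP L hu.2).comp u
      ((differentiableAt_id (𝕜 := ℂ)).add_const v)
    exact ((((((h1.sub h2).add_const _).add_const _).add_const _).pow 2).sub h3).sub_const _ |>.sub
      h4
  have hBiso : ∀ z, ∀ᶠ w in 𝓝[≠] z, w ∉ B := fun z => by
    have h1 := eventually_notMem_lattice L (z + v)
    have h2 : Tendsto (fun w => w + v) (𝓝[≠] z) (𝓝[≠] (z + v)) := by
      refine tendsto_nhdsWithin_iff.2 ⟨?_, ?_⟩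
      · exact ((continuous_id.add continuous_const).tendsto z).mono_left nhdsWithin_le_nhds
      · filter_upwards [self_mem_nhdsWithin] with w hw
        simpa using hw
    filter_upwards [eventually_notMem_lattice L z, h2.eventually h1] with w hw1 hw2 h
    exact h.elim hw1 hw2
  have hBp : ∀ u, ∀ l ∈ L.lattice, (u + l ∈ B ↔ u ∈ B) := fun u l hl => by
    simp only [hB, Set.mem_ofPred_eq, add_right_comm u l v, L.lattice.add_mem_iff_left hl]
  have hper : ∀ u ∉ B, ∀ l ∈ L.lattice, f (u + l) = f u := fun u hu l hl => by
    rw [hfe u hu, hfe _ (fun h => hu ((hBp u l hl).1 h)), he, add_right_comm u l v,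
      E_add_mem _ _ _ hl, E_add_mem _ _ _ hl, weierstrassP_add_mem _ hl, weierstrassP_add_mem _ hl]
  have hBs : ∀ u, (-v - u ∈ B ↔ u ∈ B) := fun u => by
    simp only [hB, Set.mem_ofPred_eq]
    rw [show -v - u = -(u + v) by ring, show -(u + v) + v = -u by ring, neg_mem_iff, neg_mem_iff,
      or_comm]
  -- The reflection u ↦ -v - u exchanges the singularities on the lattice with those on -v + L, so
  -- only u = 0 has to be examined.
  have hsym : ∀ u ∉ B, f (-v - u) = f u := fun u hu => by
    rw [hfe u hu, hfe _ (fun h => hu ((hBs u).1 h)), he, show -v - u = -(u + v) by ring,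
      show -(u + v) + v = -u by ring, E_one_lattice_neg, E_one_lattice_neg, L.weierstrassP_neg,
      L.weierstrassP_neg]
    ring
  -- Near 0 the squared bracket is u⁻¹ + h(u) with h(0) = 0 and h'(0) = ℘(v). The limit is 2℘(v) -
  -- ℘(v) - ℘(v) = 0, which also fixes the Liouville constant.
  have hlim0 : Tendsto f (𝓝[≠] 0) (𝓝 0) := by
    have hdz : HasDerivAt (fun u => zetaReg L u - zetaW L (u + v) + zetaW L v)
        (L.weierstrassP v) 0 := by
      have h1 := hasDerivAt_zetaReg L (z := 0) (Or.inr rfl)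
      have h2 : HasDerivAt (fun u => zetaW L (u + v)) (-(L.weierstrassP v)) 0 := by
        have h3 : HasDerivAt (zetaW L) (-(L.weierstrassP v)) (0 + v) := by
          rw [zero_add]; exact hasDerivAt_zetaW L hv
        exact h3.comp_add_const 0 v
      refine ((h1.sub h2).add_const (zetaW L v)).congr_deriv ?_
      simp
    have h4 := tendsto_sq_sub_weierstrassP L hdz (by simp [zetaReg_zero])
    have h5 : Tendsto (fun u => L.weierstrassP (u + v)) (𝓝[≠] 0) (𝓝 (L.weierstrassP v)) := by
      have hc : ContinuousAt L.weierstrassP (0 + v) := by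
        rw [zero_add]
        exact (differentiableAt_weierstrassP L hv).continuousAt
      have h6 : ContinuousAt (fun u => L.weierstrassP (u + v)) 0 :=
        ContinuousAt.comp (f := fun u => u + v) hc (by fun_prop)
      have h7 : Tendsto (fun u => L.weierstrassP (u + v)) (𝓝[≠] 0) (𝓝 (L.weierstrassP (0 + v))) :=
        h6.continuousWithinAt
      rwa [zero_add] at h7
    have h8 := (h4.sub_const (L.weierstrassP v)).sub h5
    have e0 : 2 * L.weierstrassP v - L.weierstrassP v - L.weierstrassP v = 0 := by ring
    rw [e0] at h8
    refine h8.congr fun w => ?_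
    have h9 := hE v hv
    simp only [hf, h9, zetaW]
    ring_nf
  have hlimL : ∀ l ∈ L.lattice, Tendsto f (𝓝[≠] l) (𝓝 0) := fun l hl => by
    have h2 : Tendsto (fun w => w - l) (𝓝[≠] l) (𝓝[≠] 0) := by
      refine tendsto_nhdsWithin_iff.2 ⟨?_, ?_⟩
      · have : Tendsto (fun w => w - l) (𝓝 l) (𝓝 (l - l)) :=
          (continuous_id.sub continuous_const).tendsto l
        rw [sub_self] at this
        exact this.mono_left nhdsWithin_le_nhds
      · filter_upwards [self_mem_nhdsWithin] with w hw
        simpa [sub_eq_zero] using hw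
    refine (hlim0.comp h2).congr' ?_
    filter_upwards [hBiso l] with w hw
    have := hper w hw (-l) (neg_mem hl)
    simp only [Function.comp, sub_eq_add_neg, this]
  have hlimB : ∀ w ∈ B, Tendsto f (𝓝[≠] w) (𝓝 0) := fun w hw => by
    rcases hw with hw | hw
    · exact hlimL w hw
    · have hl : -v - w ∈ L.lattice := by
        rw [show -v - w = -(w + v) by ring]; exact neg_mem hw
      have h2 : Tendsto (fun x => -v - x) (𝓝[≠] w) (𝓝[≠] (-v - w)) := by
        refine tendsto_nhdsWithin_iff.2 ⟨?_, ?_⟩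
        · exact ((continuous_const.sub continuous_id).tendsto w).mono_left nhdsWithin_le_nhds
        · filter_upwards [self_mem_nhdsWithin] with x hx
          simpa using hx
      refine ((hlimL _ hl).comp h2).congr' ?_
      filter_upwards [hBiso w] with x hx
      exact hsym x hx
  obtain ⟨g, hg, hgf, hgl⟩ := exists_entire_extension hBiso hfd fun z hz => ⟨0, hlimB z hz⟩
  have hgp : ∀ l ∈ L.lattice, ∀ z, g (z + l) = g z := fun l hl z => by
    have := eq_of_eq_off (f := fun z => g (z + l)) (g := g) hBiso
      (hg.continuous.comp (by fun_prop)) hg.continuous fun z hz => by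
        rw [hgf z hz, hgf _ (fun h => hz ((hBp z l hl).1 h)), hper z hz l hl]
    exact congrFun this z
  have huB : u ∉ B := by simp only [hB, Set.mem_ofPred_eq, not_or]; exact ⟨hu, huv⟩
  have h1 := eq_of_entire_periodic L hg hgp u 0
  rw [hgl 0 0 hlim0, hgf u huB, hfe u huB] at h1
  linear_combination h1

/-! ### The q-expansion of the zeta function and of E₂(0) -/

/-- The Lambert type series `∑_{m ≥ 1} qᵐ s / (1 - qᵐ s)`. -/
def lambertA (q s : ℂ) : ℂ := ∑' m : ℕ, q ^ (m + 1) * s / (1 - q ^ (m + 1) * s)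

/-- The series `∑_{m ≥ 1} qᵐ / (1 - qᵐ)²`. -/
def lambertF (q : ℂ) : ℂ := ∑' m : ℕ, q ^ (m + 1) / (1 - q ^ (m + 1)) ^ 2

/-- On a bounded set the denominators with large m stay at distance at least 1/2 from 0; only
finitely many m require the hypothesis that their pole is avoided. -/
lemma lambertA_spec {q s : ℂ} (hq : ‖q‖ < 1) (hs : ∀ m : ℕ, q ^ (m + 1) * s ≠ 1) :
    (Summable fun m : ℕ => q ^ (m + 1) * s / (1 - q ^ (m + 1) * s)) ∧
    HasDerivAt (lambertA q) (∑' m : ℕ, q ^ (m + 1) / (1 - q ^ (m + 1) * s) ^ 2) s := by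
  set R := ‖s‖ + 1 with hR
  have hRpos : 0 < R := by positivity
  have hlim : Tendsto (fun m : ℕ => ‖q‖ ^ (m + 1) * R) atTop (𝓝 (0 * R)) :=
    ((tendsto_pow_atTop_nhds_zero_of_lt_one (norm_nonneg q) hq).comp
      (tendsto_add_atTop_nat 1)).mul_const R
  rw [zero_mul] at hlim
  obtain ⟨M, hM⟩ := eventually_atTop.1 (hlim.eventually (gt_mem_nhds (show (0 : ℝ) < 1 / 2 by
    norm_num)))
  set U : Set ℂ := Metric.ball 0 R ∩ ⋂ m ∈ Finset.range M, {w | q ^ (m + 1) * w ≠ 1} with hU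
  have hUo : IsOpen U := Metric.isOpen_ball.inter (isOpen_biInter_finset fun m _ =>
    isOpen_ne_fun (by fun_prop) (by fun_prop))
  have hsmall : ∀ m, M ≤ m → ∀ w ∈ U, ‖q ^ (m + 1) * w‖ ≤ 1 / 2 := fun m hm w hw => by
    rw [norm_mul, norm_pow]
    have h1 : ‖w‖ ≤ R := by have := hw.1; simp only [mem_ball_zero_iff] at this; exact this.le
    exact le_trans (by gcongr) (hM m hm).le
  have hUne : ∀ w ∈ U, ∀ m : ℕ, 1 - q ^ (m + 1) * w ≠ 0 := fun w hw m h => by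
    have h1 : q ^ (m + 1) * w = 1 := by linear_combination -h
    rcases lt_or_ge m M with hm | hm
    · have := Set.mem_iInter₂.1 hw.2 m (Finset.mem_range.2 hm)
      exact this h1
    · have := hsmall m hm w hw
      rw [h1] at this
      norm_num at this
  have hsU : s ∈ U := ⟨by simp [hR], Set.mem_iInter₂.2 fun m _ => hs m⟩
  have hd : ∀ (m : ℕ), ∀ w ∈ U, HasDerivAt (fun w => q ^ (m + 1) * w / (1 - q ^ (m + 1) * w))
      (q ^ (m + 1) / (1 - q ^ (m + 1) * w) ^ 2) w := fun m w hw => by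
    have h1 : HasDerivAt (fun w : ℂ => q ^ (m + 1) * w) (q ^ (m + 1) * 1) w :=
      (hasDerivAt_id w).const_mul _
    have h2 := h1.div (h1.const_sub 1) (hUne w hw m)
    refine h2.congr_deriv ?_
    congr 1
    ring
  have h := tsum_cofinite_bound (F := fun (m : ℕ) w => q ^ (m + 1) * w / (1 - q ^ (m + 1) * w)) hUo
    (u := fun m => ‖q‖ ^ (m + 1) * R * 2)
    ((((summable_nat_add_iff 1).2 (summable_geometric_of_lt_one (norm_nonneg q) hq)).mul_right
      R).mul_right 2) (fun m w hw => (hd m w hw).differentiableAt.differentiableWithinAt)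
      (Finset.finite_toSet (Finset.range M)) ?_
  · refine ⟨h.1 s hsU, ?_⟩
    have h1 := h.2.2 s hsU
    have h2 : (fun m : ℕ => deriv (fun w => q ^ (m + 1) * w / (1 - q ^ (m + 1) * w)) s) =
        fun m => q ^ (m + 1) / (1 - q ^ (m + 1) * s) ^ 2 := funext fun m => (hd m s hsU).deriv
    rw [h2] at h1
    rw [h1.tsum_eq]
    exact (h.2.1.differentiableAt (hUo.mem_nhds hsU)).hasDerivAt
  · intro m hm w hw
    simp only [Finset.coe_range, Set.mem_Iio, not_lt] at hm
    have h1 := hsmall m hm w hw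
    have h2 : 1 / 2 ≤ ‖1 - q ^ (m + 1) * w‖ := by
      have := norm_sub_norm_le (1 : ℂ) (q ^ (m + 1) * w)
      rw [norm_one] at this
      linarith
    have h3 : ‖w‖ ≤ R := by have := hw.1; simp only [mem_ball_zero_iff] at this; exact this.le
    rw [norm_div, norm_mul, norm_pow, div_le_iff₀ (by linarith)]
    calc ‖q‖ ^ (m + 1) * ‖w‖ ≤ ‖q‖ ^ (m + 1) * R * 2 * (1 / 2) := by
          rw [mul_assoc _ (2 : ℝ)]; norm_num; gcongr
      _ ≤ _ := by gcongr

lemma lambertA_mul {q s : ℂ} (hq : ‖q‖ < 1) (hs : ∀ m : ℕ, q ^ (m + 1) * s ≠ 1) :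
    lambertA q (q * s) = lambertA q s - q * s / (1 - q * s) := by
  have h := (lambertA_spec hq hs).1.tsum_eq_zero_add
  unfold lambertA
  rw [h]
  simp only [zero_add, pow_one, add_sub_cancel_left]
  refine tsum_congr fun m => ?_
  rw [show q ^ (m + 1) * (q * s) = q ^ (m + 1 + 1) * s by ring]

/-- The regular part of the cotangent at `0`. -/
lemma exists_cot_regular : ∃ h : ℂ → ℂ, DifferentiableAt ℂ h 0 ∧ ∀ᶠ z in 𝓝[≠] 0,
    -(Real.pi : ℂ) * I - 2 * Real.pi * I * (cexp (2 * Real.pi * I * z) /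
      (1 - cexp (2 * Real.pi * I * z))) = z⁻¹ + h z := by
  set c : ℂ := 2 * Real.pi * I with hc
  have hc0 : c ≠ 0 := by simp [hc, Real.pi_ne_zero]
  set f : ℂ → ℂ := fun z => -(Real.pi : ℂ) * I - c * (cexp (c * z) / (1 - cexp (c * z))) - z⁻¹
    with hf
  have hexp : HasDerivAt (fun z => cexp (c * z)) c 0 := by
    have := ((hasDerivAt_id (0 : ℂ)).const_mul c).cexp
    simpa using this
  have hslope : Tendsto (fun z : ℂ => z⁻¹ * (1 - cexp (c * z))) (𝓝[≠] 0) (𝓝 (-c)) := by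
    refine hexp.tendsto_slope.neg.congr fun z => ?_
    simp [slope_def_field]
    ring
  have hexp0 : Tendsto (fun z => cexp (c * z)) (𝓝[≠] 0) (𝓝 1) := by
    have : Tendsto (fun z => cexp (c * z)) (𝓝[≠] 0) (𝓝 (cexp (c * 0))) :=
      hexp.continuousAt.continuousWithinAt
    simpa using this
  have hid : Tendsto (fun z : ℂ => z) (𝓝[≠] 0) (𝓝 0) := tendsto_id.mono_left nhdsWithin_le_nhds
  have hne : ∀ᶠ z in 𝓝[≠] (0 : ℂ), 1 - cexp (c * z) ≠ 0 := by
    filter_upwards [hslope.eventually_ne (neg_ne_zero.2 hc0)] with z hz h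
    exact hz (by rw [h, mul_zero])
  have hfd : ∀ᶠ z in 𝓝[≠] (0 : ℂ), DifferentiableAt ℂ f z := by
    filter_upwards [hne, self_mem_nhdsWithin] with z hz hz0
    have hz0' : z ≠ 0 := hz0
    have : DifferentiableAt ℂ (fun z => cexp (c * z)) z := by fun_prop
    exact (((this.div (this.const_sub 1) hz).const_mul c).const_sub _).sub
      (differentiableAt_inv hz0')
  have hzf : Tendsto (fun z => z * (f z - f 0)) (𝓝[≠] 0) (𝓝 0) := by
    have h1 := ((hid.mul_const (-(Real.pi : ℂ) * I)).sub ((hexp0.mul (hslope.inv₀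
      (neg_ne_zero.2 hc0))).const_mul c)).sub_const 1 |>.sub (hid.mul_const (f 0))
    have e : (0 : ℂ) * (-(Real.pi : ℂ) * I) - c * (1 * (-c)⁻¹) - 1 - 0 * f 0 = 0 := by
      field_simp; ring
    rw [e] at h1
    refine h1.congr' ?_
    filter_upwards [self_mem_nhdsWithin, hne] with z hz hz1
    have hz' : z ≠ 0 := hz
    have h2 : z * z⁻¹ = 1 := mul_inv_cancel₀ hz'
    simp only [hf, mul_inv, inv_inv]
    linear_combination h2
  -- Since z(f(z) - f(0)) tends to 0, the simple poles cancel and the singularity is removable.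
  have hlit : (fun z => f z - f 0) =o[𝓝[≠] 0] fun z => (z - 0)⁻¹ := by
    refine (isLittleO_iff_tendsto' ?_).2 (hzf.congr fun z => ?_)
    · filter_upwards [self_mem_nhdsWithin] with z hz h
      have hz' : z ≠ 0 := hz
      simp [hz'] at h
    · simp only [sub_zero, div_inv_eq_mul, mul_comm]
  have hlim := Complex.tendsto_limUnder_of_differentiable_on_punctured_nhds_of_isLittleO hfd hlit
  refine ⟨Function.update f 0 (limUnder (𝓝[≠] 0) f), ?_, ?_⟩
  · have hev : f =ᶠ[𝓝[≠] 0] Function.update f 0 (limUnder (𝓝[≠] 0) f) := by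
      filter_upwards [self_mem_nhdsWithin] with z hz
      have hz' : z ≠ 0 := hz
      simp [hz']
    refine (Complex.analyticAt_of_differentiable_on_punctured_nhds_of_continuousAt ?_
      (continuousAt_update_same.2 hlim)).differentiableAt
    filter_upwards [hfd, self_mem_nhdsWithin] with z hz hz0
    refine hz.congr_of_eventuallyEq ?_
    filter_upwards [isOpen_compl_singleton.mem_nhds hz0] with w hw
    have hw' : w ≠ 0 := hw
    simp [hw']
  · filter_upwards [self_mem_nhdsWithin] with z hz
    have hz' : z ≠ 0 := hz
    simp [hz', hf]

/-- The value at `0` of the derivative of the regular part of the cotangent, up to sign. -/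
def cotConst : ℂ := -deriv exists_cot_regular.choose 0

/-- The `q`-expansion of the Weierstrass zeta function, without its linear term. -/
def zetaQ (q z : ℂ) : ℂ := -(Real.pi : ℂ) * I - 2 * Real.pi * I * (cexp (2 * Real.pi * I * z) /
    (1 - cexp (2 * Real.pi * I * z))) - 2 * Real.pi * I * (lambertA q (cexp (2 * Real.pi * I * z)) -
    lambertA q (cexp (-(2 * Real.pi * I * z))))

/-- The nome `exp (2πiτ)`. -/
def nome (τ : ℂ) : ℂ := cexp (2 * Real.pi * I * τ)

lemma norm_nome (τ : ℂ) : ‖nome τ‖ = Real.exp (-(2 * Real.pi * τ.im)) := by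
  rw [nome, norm_exp]
  simp

lemma norm_nome_lt_one {τ : ℂ} (hτ : 0 < τ.im) : ‖nome τ‖ < 1 := by
  rw [norm_nome, Real.exp_lt_one_iff]
  have := Real.pi_pos
  nlinarith [mul_pos this hτ]

lemma nome_pow_mul_exp (τ z : ℂ) (m : ℕ) : nome τ ^ m * cexp (2 * Real.pi * I * z) =
    cexp (2 * Real.pi * I * (m * τ + z)) := by
  rw [nome, ← Complex.exp_nat_mul, ← Complex.exp_add]
  congr 1; ring

lemma exp_two_pi_eq_one_iff {z : ℂ} : cexp (2 * Real.pi * I * z) = 1 ↔ ∃ n : ℤ, z = n := by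
  rw [Complex.exp_eq_one_iff]
  refine exists_congr fun n => ⟨fun h => ?_, fun h => by rw [h]; ring⟩
  have : (2 * Real.pi * I : ℂ) ≠ 0 := by simp [Real.pi_ne_zero]
  exact mul_left_cancel₀ this (by rw [h]; ring)

lemma nome_pow_mul_exp_ne_one {τ : ℂ} (hτ : 0 < τ.im) {z : ℂ}
    (hz : z ∉ (tauPair τ hτ).lattice ∨ ∃ n : ℤ, z = n) (m : ℕ) :
    nome τ ^ (m + 1) * cexp (2 * Real.pi * I * z) ≠ 1 := by
  rw [nome_pow_mul_exp, Ne, exp_two_pi_eq_one_iff]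
  rintro ⟨n, hn⟩
  rcases hz with hz | ⟨k, rfl⟩
  · refine hz ((mem_tauPair hτ).2 ⟨-(m + 1 : ℕ), n, ?_⟩)
    push_cast at hn ⊢
    linear_combination -hn
  · have := congrArg Complex.im hn
    simp at this
    have h1 : (0 : ℝ) < (m : ℝ) + 1 := by positivity
    rcases this with h | h
    · norm_cast at h
    · exact hτ.ne' h

lemma zetaQ_add_int (q z : ℂ) (n : ℤ) : zetaQ q (z + n) = zetaQ q z := by
  have h1 : cexp (2 * Real.pi * I * (z + n)) = cexp (2 * Real.pi * I * z) := by
    rw [mul_add, Complex.exp_add, exp_two_pi_eq_one_iff.2 ⟨n, rfl⟩, mul_one]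
  have h2 : cexp (-(2 * Real.pi * I * (z + n))) = cexp (-(2 * Real.pi * I * z)) := by
    rw [Complex.exp_neg, h1, Complex.exp_neg]
  simp only [zetaQ, h1, h2]

lemma exp_ne_one_of_notMem {τ : ℂ} (hτ : 0 < τ.im) {z : ℂ} (hz : z ∉ (tauPair τ hτ).lattice) :
    cexp (2 * Real.pi * I * z) ≠ 1 := fun h => by
  obtain ⟨n, rfl⟩ := exp_two_pi_eq_one_iff.1 h
  exact hz ((mem_tauPair hτ).2 ⟨0, n, by simp⟩)

/-- The shift by τ moves each Lambert series by one term. The boundary terms combine through t/(1-t)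
+ t⁻¹/(1-t⁻¹) = -1, whence the increment -2πi. -/
lemma zetaQ_add_tau {τ : ℂ} (hτ : 0 < τ.im) {z : ℂ} (hz : z ∉ (tauPair τ hτ).lattice) :
    zetaQ (nome τ) (z + τ) = zetaQ (nome τ) z - 2 * Real.pi * I := by
  set t := cexp (2 * Real.pi * I * z) with ht
  have ht0 : t ≠ 0 := Complex.exp_ne_zero _
  set q := nome τ with hq
  have hq0 : q ≠ 0 := Complex.exp_ne_zero _
  have hq1 := norm_nome_lt_one hτ
  have e1 : cexp (2 * Real.pi * I * (z + τ)) = q * t := by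
    rw [hq, nome, ht, ← Complex.exp_add]; congr 1; ring
  have e2 : cexp (-(2 * Real.pi * I * (z + τ))) = (q * t)⁻¹ := by rw [Complex.exp_neg, e1]
  have e3 : cexp (-(2 * Real.pi * I * z)) = t⁻¹ := by rw [Complex.exp_neg, ht]
  have hzτ : -(z + τ) ∉ (tauPair τ hτ).lattice := fun h => hz (by
    obtain ⟨m, n, h⟩ := (mem_tauPair hτ).1 h
    exact (mem_tauPair hτ).2 ⟨-m - 1, -n, by push_cast; linear_combination -h⟩)
  have h1 := lambertA_mul hq1 (fun m => nome_pow_mul_exp_ne_one hτ (Or.inl hz) m)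
  have h2 := lambertA_mul hq1 (fun m => nome_pow_mul_exp_ne_one hτ (Or.inl hzτ) m)
  rw [mul_neg, e2] at h2
  have e4 : q * (q * t)⁻¹ = t⁻¹ := by field_simp
  rw [e4] at h2
  have ht1 : 1 - t ≠ 0 := sub_ne_zero.2 (exp_ne_one_of_notMem hτ hz).symm
  have e5 : t⁻¹ / (1 - t⁻¹) = -1 - t / (1 - t) := by
    have : 1 - t⁻¹ ≠ 0 := fun h => ht1 (by field_simp at h; linear_combination -h)
    have h6 : t - 1 ≠ 0 := fun h => ht1 (by linear_combination -h)
    field_simp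
    ring
  rw [← hq, ← ht] at h1
  simp only [zetaQ, e1, e2, e3, ← ht]
  linear_combination (-2 * Real.pi * I) * h1 - (2 * Real.pi * I) * h2 + (2 * Real.pi * I) * e5

lemma mem_tauPair_add {τ : ℂ} (hτ : 0 < τ.im) (m n : ℤ) :
    (m : ℂ) * τ + n ∈ (tauPair τ hτ).lattice := (mem_tauPair hτ).2 ⟨m, n, rfl⟩

lemma zetaQ_add {τ : ℂ} (hτ : 0 < τ.im) {z : ℂ} (hz : z ∉ (tauPair τ hτ).lattice) (m n : ℤ) :
    zetaQ (nome τ) (z + (m * τ + n)) = zetaQ (nome τ) z - 2 * Real.pi * I * m := by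
  have hm : ∀ k : ℕ, ∀ w ∉ (tauPair τ hτ).lattice,
      zetaQ (nome τ) (w + k * τ) = zetaQ (nome τ) w - 2 * Real.pi * I * k := by
    intro k
    induction k with
    | zero => intro w _; simp
    | succ k ih =>
      intro w hw
      have hk : w + k * τ ∉ (tauPair τ hτ).lattice := fun h => hw (by
        have := (tauPair τ hτ).lattice.sub_mem h (mem_tauPair_add hτ k 0)
        simpa using this)
      rw [show w + ((k + 1 : ℕ) : ℂ) * τ = w + k * τ + τ by push_cast; ring, zetaQ_add_tau hτ hk,
        ih w hw]
      push_cast; ring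
  rw [← add_assoc, zetaQ_add_int]
  obtain ⟨k, rfl | rfl⟩ := m.eq_nat_or_neg
  · simpa using hm k z hz
  · have hk : z + -k * τ ∉ (tauPair τ hτ).lattice := fun h => hz (by
      have := (tauPair τ hτ).lattice.add_mem h (mem_tauPair_add hτ k 0)
      simpa using this)
    have := hm k _ hk
    rw [show z + -(k : ℂ) * τ + k * τ = z by ring] at this
    push_cast
    linear_combination -this

lemma hasDerivAt_lambertA_exp {τ : ℂ} (hτ : 0 < τ.im) (c : ℂ) (hc : c = 1 ∨ c = -1) {z : ℂ}
    (hz : z ∉ (tauPair τ hτ).lattice ∨ z = 0) :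
    HasDerivAt (fun z => lambertA (nome τ) (cexp (c * (2 * Real.pi * I * z))))
      ((∑' m : ℕ, nome τ ^ (m + 1) / (1 - nome τ ^ (m + 1) * cexp (c * (2 * Real.pi * I * z))) ^ 2) *
        (cexp (c * (2 * Real.pi * I * z)) * (c * (2 * Real.pi * I)))) z := by
  have h1 : HasDerivAt (fun z => cexp (c * (2 * Real.pi * I * z)))
      (cexp (c * (2 * Real.pi * I * z)) * (c * (2 * Real.pi * I * 1))) z :=
    (((hasDerivAt_id z).const_mul (2 * Real.pi * I : ℂ)).const_mul c).cexp
  rw [mul_one] at h1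
  have hne : ∀ m : ℕ, nome τ ^ (m + 1) * cexp (c * (2 * Real.pi * I * z)) ≠ 1 := fun m => by
    rw [show c * (2 * Real.pi * I * z) = 2 * Real.pi * I * (c * z) by ring]
    refine nome_pow_mul_exp_ne_one hτ ?_ m
    rcases hz with hz | rfl
    · left
      rcases hc with rfl | rfl
      · rwa [one_mul]
      · rwa [neg_one_mul, neg_mem_iff]
    · exact Or.inr ⟨0, by simp⟩
  exact ((lambertA_spec (norm_nome_lt_one hτ) hne).2).comp z h1

lemma differentiableAt_zetaQ {τ : ℂ} (hτ : 0 < τ.im) {z : ℂ} (hz : z ∉ (tauPair τ hτ).lattice) :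
    DifferentiableAt ℂ (zetaQ (nome τ)) z := by
  have h1 := (hasDerivAt_lambertA_exp hτ 1 (Or.inl rfl) (Or.inl hz)).differentiableAt
  have h2 := (hasDerivAt_lambertA_exp hτ (-1) (Or.inr rfl) (Or.inl hz)).differentiableAt
  simp only [one_mul, neg_one_mul] at h1 h2
  have h3 : DifferentiableAt ℂ (fun z => cexp (2 * Real.pi * I * z)) z := by fun_prop
  exact ((((h3.div (h3.const_sub 1) (sub_ne_zero.2 (exp_ne_one_of_notMem hτ hz).symm)).const_mul
    _).const_sub _)).sub ((h1.sub h2).const_mul _)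

/-- The Legendre relation and the `q`-expansion of `E₂(0)`. -/
theorem E_two_tau {τ : ℂ} (hτ : 0 < τ.im) :
    E (tauPair τ hτ).lattice 2 0 = cotConst - 8 * Real.pi ^ 2 * lambertF (nome τ) -
      Real.pi / τ.im ∧
    ∀ z ∉ (tauPair τ hτ).lattice, E (tauPair τ hτ).lattice 1 z = zetaW (tauPair τ hτ) z -
      E (tauPair τ hτ).lattice 2 0 * z - Real.pi / τ.im * star z := by
  obtain ⟨B, -, hE⟩ := exists_E_one_formula (tauPair τ hτ)
  set L := tauPair τ hτ with hL
  set G := E L.lattice 2 0 with hG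
  obtain ⟨hd, hcot⟩ := exists_cot_regular.choose_spec
  set h0 := exists_cot_regular.choose with hh0
  have hcc : cotConst = -deriv h0 0 := rfl
  have hζ : ∀ z ∉ L.lattice, ∀ l ∈ L.lattice, zetaW L (z + l) = zetaW L z + G * l + B * star l := by
    intro z hz l hl
    have hzl : z + l ∉ L.lattice := fun h => hz ((L.lattice.add_mem_iff_left hl).1 h)
    have h1 := hE z hz
    have h2 := hE _ hzl
    rw [E_add_mem _ _ _ hl, h1] at h2
    simp only [zetaW, star_add] at h2 ⊢
    linear_combination -h2
  -- Subtracting (G + B)z removes the increment of ζ under z ↦ z + 1, which `zetaQ` does not have.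
  -- All increments of `K` are constants and its poles cancel, so it extends to an entire affine
  -- function.
  set K : ℂ → ℂ := fun z => zetaW L z - (G + B) * z - zetaQ (nome τ) z with hK
  have hKd : ∀ z ∉ L.lattice, DifferentiableAt ℂ K z := fun z hz =>
    ((hasDerivAt_zetaW L hz).differentiableAt.sub (differentiableAt_id.const_mul _)).sub
      (differentiableAt_zetaQ hτ hz)
  have hKadd : ∀ z ∉ L.lattice, ∀ m n : ℤ, K (z + (m * τ + n)) =
      K z + (B * (star (m * τ + n : ℂ) - (m * τ + n)) + 2 * Real.pi * I * m) := by
    intro z hz m n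
    simp only [hK, hζ z hz _ (mem_tauPair_add hτ m n), zetaQ_add hτ hz]
    ring
  set k : ℂ → ℂ := fun z => zetaReg L z - (G + B) * z - h0 z + 2 * Real.pi * I *
    (lambertA (nome τ) (cexp (1 * (2 * Real.pi * I * z))) -
      lambertA (nome τ) (cexp (-1 * (2 * Real.pi * I * z)))) with hk
  have hkd : HasDerivAt k (-(G + B) + cotConst - 8 * Real.pi ^ 2 * lambertF (nome τ)) 0 := by
    have h1 := hasDerivAt_zetaReg L (z := 0) (Or.inr rfl)
    have h2 := hasDerivAt_lambertA_exp hτ 1 (Or.inl rfl) (Or.inr (rfl : (0 : ℂ) = 0))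
    have h3 := hasDerivAt_lambertA_exp hτ (-1) (Or.inr rfl) (Or.inr (rfl : (0 : ℂ) = 0))
    have h4 := ((h1.sub ((hasDerivAt_id (0 : ℂ)).const_mul (G + B))).sub hd.hasDerivAt).add
      ((h2.sub h3).const_mul (2 * Real.pi * I))
    refine h4.congr_deriv ?_
    simp only [PeriodPair.weierstrassPExcept_zero, mul_zero, Complex.exp_zero, mul_one, hcc]
    rw [lambertF]
    linear_combination (8 * (Real.pi : ℂ) ^ 2 *
      ∑' m : ℕ, nome τ ^ (m + 1) / (1 - nome τ ^ (m + 1)) ^ 2) * I_sq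
  have hKk : ∀ᶠ z in 𝓝[≠] 0, K z = k z := by
    filter_upwards [hcot] with z hz
    simp only [hK, hk, zetaW, zetaQ, one_mul, neg_one_mul]
    linear_combination -hz
  have hlim0 : Tendsto K (𝓝[≠] 0) (𝓝 (k 0)) := by
    have : Tendsto k (𝓝[≠] 0) (𝓝 (k 0)) := hkd.continuousAt.continuousWithinAt
    refine this.congr' ?_
    filter_upwards [hKk] with z hz using hz.symm
  obtain ⟨g, hg, hgK, hgl⟩ := exists_entire_extension (eventually_notMem_lattice L) hKd
    fun l hl => by
      obtain ⟨m, n, rfl⟩ := (mem_tauPair hτ).1 hl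
      refine ⟨k 0 + (B * (star (m * τ + n : ℂ) - (m * τ + n)) + 2 * Real.pi * I * m), ?_⟩
      have h2 : Tendsto (fun w => w - (m * τ + n : ℂ)) (𝓝[≠] (m * τ + n : ℂ)) (𝓝[≠] 0) := by
        refine tendsto_nhdsWithin_iff.2 ⟨?_, ?_⟩
        · have : Tendsto (fun w => w - (m * τ + n : ℂ)) (𝓝 (m * τ + n : ℂ))
              (𝓝 ((m * τ + n : ℂ) - (m * τ + n : ℂ))) :=
            (continuous_id.sub continuous_const).tendsto _
          rw [sub_self] at this
          exact this.mono_left nhdsWithin_le_nhds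
        · filter_upwards [self_mem_nhdsWithin] with w hw
          simpa [sub_eq_zero] using hw
      refine ((hlim0.comp h2).add_const _).congr' ?_
      filter_upwards [eventually_notMem_lattice L (m * τ + n)] with w hw
      have hw' : w - (m * τ + n) ∉ L.lattice := fun h => hw
        ((L.lattice.sub_mem_iff_left hl).1 h)
      rw [Function.comp, ← hKadd _ hw', sub_add_cancel]
  have hgadd : ∀ m n : ℤ, ∀ z, g (z + (m * τ + n)) = g z +
      (B * (star (m * τ + n : ℂ) - (m * τ + n)) + 2 * Real.pi * I * m) := fun m n z => by
    have hgc := hg.continuous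
    refine congrFun (eq_of_eq_off (f := fun z => g (z + (m * τ + n))) (g := fun z => g z +
      (B * (star (m * τ + n : ℂ) - (m * τ + n)) + 2 * Real.pi * I * m))
      (eventually_notMem_lattice L) (by fun_prop) (by fun_prop) fun z hz => ?_) z
    have hz' : z + (m * τ + n) ∉ L.lattice := fun h => hz
      ((L.lattice.add_mem_iff_left (mem_tauPair_add hτ m n)).1 h)
    simp only [hgK _ hz', hgK z hz, hKadd z hz]
  obtain ⟨a, b, hab⟩ := affine_of_entire_quasiperiodic L hg fun l hl => by
    obtain ⟨m, n, rfl⟩ := (mem_tauPair hτ).1 hl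
    exact ⟨_, hgadd m n⟩
  -- The translation by 1 has increment 0.
  have ha : a = 0 := by
    have := hgadd 0 1 0
    simp [hab] at this
    exact this
  -- The translation by τ must also have increment 0, that is B(τ̄ - τ) + 2πi = 0: the Legendre
  -- relation.
  have hB : B = Real.pi / τ.im := by
    have h1 := hgadd 1 0 0
    simp only [hab, ha] at h1
    have h2 : star τ - τ = -2 * I * τ.im := by
      apply Complex.ext
      · simp
      · simp; ring
    simp only [Int.cast_one, Int.cast_zero, one_mul, add_zero, h2] at h1
    have h3 : (τ.im : ℂ) ≠ 0 := ofReal_ne_zero.2 hτ.ne'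
    rw [eq_div_iff h3]
    have h4 : (2 * I : ℂ) ≠ 0 := by simp
    apply mul_left_cancel₀ h4
    linear_combination h1
  have hgk : g =ᶠ[𝓝 0] k := by
    have h1 : ∀ᶠ z in 𝓝[≠] 0, g z = k z := by
      filter_upwards [hKk, eventually_notMem_lattice L 0] with z hz hz2
      rw [hgK z hz2, hz]
    rw [eventually_nhdsWithin_iff] at h1
    filter_upwards [h1] with z hz
    by_cases h : z = 0
    · rw [h]; exact hgl 0 _ hlim0
    · exact hz h
  -- The extended function is constant, so its derivative at 0 vanishes; computing that derivative
  -- term by term gives the q-expansion of E₂(0).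
  have hfin : -(G + B) + cotConst - 8 * Real.pi ^ 2 * lambertF (nome τ) = 0 := by
    have h1 := (hkd.congr_of_eventuallyEq hgk).deriv
    have h2 : g = fun _ => b := by funext z; rw [hab, ha]; ring
    rw [h2, deriv_const] at h1
    exact h1.symm
  refine ⟨by rw [← hB]; linear_combination -hfin, fun z hz => ?_⟩
  rw [hE z hz, zetaW, hB]

/-! ### Estimates for the Lambert series and the zeros of E₂(0) -/

lemma norm_pow_sub_pow_le {p q : ℂ} (hp : ‖p‖ ≤ 1 / 100) (hq : ‖q‖ ≤ 1 / 100) (m : ℕ) :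
    ‖q ^ (m + 1) - p ^ (m + 1)‖ ≤ (1 / 50) ^ m * ‖q - p‖ := by
  induction m with
  | zero => simp
  | succ m ih =>
    have e : q ^ (m + 1 + 1) - p ^ (m + 1 + 1) = q * (q ^ (m + 1) - p ^ (m + 1)) +
      (q - p) * p ^ (m + 1) := by ring
    have h1 : ‖p ^ (m + 1)‖ ≤ (1 / 50) ^ m * (1 / 100) := by
      rw [norm_pow, pow_succ]
      have : ‖p‖ ≤ 1 / 50 := by linarith
      gcongr
    calc _ ≤ ‖q‖ * ‖q ^ (m + 1) - p ^ (m + 1)‖ + ‖q - p‖ * ‖p ^ (m + 1)‖ := by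
          rw [e, ← norm_mul, ← norm_mul]; exact norm_add_le _ _
      _ ≤ 1 / 100 * ((1 / 50) ^ m * ‖q - p‖) + ‖q - p‖ * ((1 / 50) ^ m * (1 / 100)) := by gcongr
      _ = _ := by ring

/-- The first Lambert term is u + 2u² + ⋯. The factor u - v splits off exactly, and its cofactor is
small on the disc of radius 1/100. -/
lemma norm_div_one_sub_sq_sub_le {u v : ℂ} (hu : ‖u‖ ≤ 1 / 100) (hv : ‖v‖ ≤ 1 / 100) :
    ‖u / (1 - u) ^ 2 - v / (1 - v) ^ 2 - (u - v)‖ ≤ 1 / 20 * ‖u - v‖ := by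
  have hlow : ∀ w : ℂ, ‖w‖ ≤ 1 / 100 → 99 / 100 ≤ ‖1 - w‖ := fun w hw => by
    have := norm_sub_norm_le (1 : ℂ) w
    rw [norm_one] at this
    linarith
  have h1 : 1 - u ≠ 0 := norm_pos_iff.1 (by linarith [hlow u hu])
  have h2 : 1 - v ≠ 0 := norm_pos_iff.1 (by linarith [hlow v hv])
  set N : ℂ := 2 * (u + v) - u ^ 2 - v ^ 2 - 5 * (u * v) + 2 * (u * v) * (u + v) - (u * v) ^ 2
  have e : u / (1 - u) ^ 2 - v / (1 - v) ^ 2 - (u - v) =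
      (u - v) * (N / ((1 - u) ^ 2 * (1 - v) ^ 2)) := by
    field_simp
    ring
  have huv : ‖u * v‖ ≤ 1 / 100 * (1 / 100) := by rw [norm_mul]; gcongr
  have hs : ‖u + v‖ ≤ 1 / 50 := (norm_add_le _ _).trans (by linarith)
  have hN : ‖N‖ ≤ 45 / 1000 := by
    have a1 : ‖2 * (u + v)‖ ≤ 1 / 25 := by rw [norm_mul]; norm_num; linarith
    have a2 : ‖u ^ 2‖ ≤ (1 / 100) ^ 2 := by rw [norm_pow]; gcongr
    have a3 : ‖v ^ 2‖ ≤ (1 / 100) ^ 2 := by rw [norm_pow]; gcongr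
    have a4 : ‖5 * (u * v)‖ ≤ 5 / 10000 := by rw [norm_mul]; norm_num at huv ⊢; linarith
    have a5 : ‖2 * (u * v) * (u + v)‖ ≤ 2 * (1 / 100 * (1 / 100)) * (1 / 50) := by
      rw [norm_mul, norm_mul, Complex.norm_ofNat]; gcongr
    have a6 : ‖(u * v) ^ 2‖ ≤ (1 / 100 * (1 / 100)) ^ 2 := by rw [norm_pow]; gcongr
    have b1 := norm_sub_le (2 * (u + v)) (u ^ 2)
    have b2 := norm_sub_le (2 * (u + v) - u ^ 2) (v ^ 2)
    have b3 := norm_sub_le (2 * (u + v) - u ^ 2 - v ^ 2) (5 * (u * v))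
    have b4 := norm_add_le (2 * (u + v) - u ^ 2 - v ^ 2 - 5 * (u * v)) (2 * (u * v) * (u + v))
    have b5 := norm_sub_le (2 * (u + v) - u ^ 2 - v ^ 2 - 5 * (u * v) + 2 * (u * v) * (u + v))
      ((u * v) ^ 2)
    change ‖2 * (u + v) - u ^ 2 - v ^ 2 - 5 * (u * v) + 2 * (u * v) * (u + v) - (u * v) ^ 2‖ ≤ _
    linarith
  have hD : 9 / 10 ≤ ‖(1 - u) ^ 2 * (1 - v) ^ 2‖ := by
    rw [norm_mul, norm_pow, norm_pow]
    calc (9 / 10 : ℝ) ≤ (99 / 100) ^ 2 * (99 / 100) ^ 2 := by norm_num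
      _ ≤ _ := by gcongr <;> exact hlow _ ‹_›
  rw [e, norm_mul, norm_div, mul_comm]
  refine mul_le_mul_of_nonneg_right ?_ (norm_nonneg _)
  rw [div_le_iff₀ (by linarith)]
  linarith

lemma summable_lambertF {q : ℂ} (hq : ‖q‖ ≤ 1 / 100) :
    Summable fun m : ℕ => q ^ (m + 1) / (1 - q ^ (m + 1)) ^ 2 := by
  have hq1 : ‖q‖ < 1 := by linarith
  refine Summable.of_norm_bounded (g := fun m => ‖q‖ ^ (m + 1) * 2)
    (((summable_nat_add_iff 1).2 (summable_geometric_of_lt_one (norm_nonneg q) hq1)).mul_right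
      2) fun m => ?_
  have h0 : ‖q ^ (m + 1)‖ ≤ 1 / 100 := by
    rw [norm_pow]
    exact (pow_le_of_le_one (norm_nonneg _) hq1.le (by omega)).trans hq
  have h1 : 99 / 100 ≤ ‖1 - q ^ (m + 1)‖ := by
    have := norm_sub_norm_le (1 : ℂ) (q ^ (m + 1))
    rw [norm_one] at this
    linarith
  rw [norm_div, norm_pow (1 - _), div_le_iff₀ (by positivity), norm_pow, mul_assoc]
  refine le_mul_of_one_le_right (by positivity) ?_
  nlinarith

/-- `lambertF` is a small Lipschitz perturbation of the identity on this disc, hence injective there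
and increasing on its real points. The first term contributes 1/20 and the others at most (50/49) ·
21/1000, together less than 1/10. -/
lemma norm_lambertF_sub_le {p q : ℂ} (hp : ‖p‖ ≤ 1 / 100) (hq : ‖q‖ ≤ 1 / 100) :
    ‖lambertF q - lambertF p - (q - p)‖ ≤ 1 / 10 * ‖q - p‖ := by
  have hp0 := summable_lambertF hp
  have hq0 := summable_lambertF hq
  have hpow : ∀ w : ℂ, ‖w‖ ≤ 1 / 100 → ∀ m : ℕ, ‖w ^ (m + 1)‖ ≤ 1 / 100 := fun w hw m => by
    rw [norm_pow]
    exact (pow_le_of_le_one (norm_nonneg _) (by linarith) (by omega)).trans hw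
  set T : ℕ → ℂ := fun m => q ^ (m + 1 + 1) / (1 - q ^ (m + 1 + 1)) ^ 2 -
    p ^ (m + 1 + 1) / (1 - p ^ (m + 1 + 1)) ^ 2 with hT
  have hTs : Summable T := ((summable_nat_add_iff 1).2 hq0).sub ((summable_nat_add_iff 1).2 hp0)
  have e : lambertF q - lambertF p - (q - p) =
      (q / (1 - q) ^ 2 - p / (1 - p) ^ 2 - (q - p)) + ∑' m, T m := by
    unfold lambertF
    rw [hq0.tsum_eq_zero_add, hp0.tsum_eq_zero_add,
      ((summable_nat_add_iff 1).2 hq0).tsum_sub ((summable_nat_add_iff 1).2 hp0)]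
    simp only [zero_add, pow_one]
    ring
  have hTn : ∀ m, ‖T m‖ ≤ (1 / 50 : ℝ) ^ m * (21 / 1000 * ‖q - p‖) := fun m => by
    have h1 := norm_div_one_sub_sq_sub_le (hpow q hq (m + 1)) (hpow p hp (m + 1))
    have h2 := norm_pow_sub_pow_le hp hq (m + 1)
    have h3 := norm_add_le (T m - (q ^ (m + 1 + 1) - p ^ (m + 1 + 1)))
      (q ^ (m + 1 + 1) - p ^ (m + 1 + 1))
    rw [sub_add_cancel] at h3
    rw [pow_succ (1 / 50 : ℝ)] at h2
    calc _ ≤ _ := h3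
      _ ≤ 1 / 20 * ‖q ^ (m + 1 + 1) - p ^ (m + 1 + 1)‖ + ‖q ^ (m + 1 + 1) - p ^ (m + 1 + 1)‖ := by
        gcongr
      _ ≤ 21 / 20 * ((1 / 50) ^ m * (1 / 50) * ‖q - p‖) := by linarith
      _ = _ := by ring
  have hg : HasSum (fun m : ℕ => (1 / 50 : ℝ) ^ m * (21 / 1000 * ‖q - p‖))
      ((1 - 1 / 50)⁻¹ * (21 / 1000 * ‖q - p‖)) :=
    (hasSum_geometric_of_lt_one (by norm_num) (by norm_num)).mul_right _
  have h4 := tsum_of_norm_bounded hg hTn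
  have h5 := norm_div_one_sub_sq_sub_le hq hp
  rw [e]
  refine (norm_add_le _ _).trans ?_
  have := norm_nonneg (q - p)
  norm_num at h4 h5 ⊢
  linarith

lemma lambertF_star (q : ℂ) : lambertF (star q) = star (lambertF q) := by
  unfold lambertF
  rw [tsum_star]
  refine tsum_congr fun m => ?_
  simp

/-- `lambertF` commutes with conjugation and is injective near 0, so q and q̄ with the same real
value must coincide. -/
lemma im_eq_zero_of_lambertF {q : ℂ} (hq : ‖q‖ ≤ 1 / 100) (h : (lambertF q).im = 0) :
    q.im = 0 := by
  have h1 := norm_lambertF_sub_le (p := star q) (q := q) (by rwa [norm_star]) hq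
  rw [lambertF_star] at h1
  have h2 : star (lambertF q) = lambertF q := Complex.conj_eq_iff_im.2 h
  rw [h2, sub_self, zero_sub, norm_neg] at h1
  have h3 : ‖q - star q‖ = 0 := by have := norm_nonneg (q - star q); linarith
  have h4 : star q = q := by rw [norm_eq_zero, sub_eq_zero] at h3; exact h3.symm
  exact Complex.conj_eq_iff_im.1 h4

lemma abs_lambertF_sub_le {p q : ℝ} (hp : |p| ≤ 1 / 100) (hq : |q| ≤ 1 / 100) :
    |(lambertF q).re - (lambertF p).re - (q - p)| ≤ 1 / 10 * |q - p| := by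
  have h := norm_lambertF_sub_le (p := p) (q := q) (by simpa using hp) (by simpa using hq)
  rw [← ofReal_sub, norm_real, Real.norm_eq_abs] at h
  refine le_trans ?_ h
  have := abs_re_le_norm (lambertF q - lambertF p - ((q - p : ℝ) : ℂ))
  simpa using this

lemma multiplierRing_scale {Λ Λ' : Submodule ℤ ℂ} {lam : ℂ} (hlam : lam ≠ 0)
    (h : ∀ z, lam * z ∈ Λ' ↔ z ∈ Λ) : multiplierRing Λ' = multiplierRing Λ := by
  ext m
  refine ⟨fun hm l hl => ?_, fun hm l hl => ?_⟩
  · rw [← h, mul_left_comm]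
    exact hm _ ((h l).2 hl)
  · have h1 : lam⁻¹ * l ∈ Λ := by rw [← h, mul_inv_cancel_left₀ hlam]; exact hl
    have h2 := (h _).2 (hm _ h1)
    rwa [mul_left_comm, mul_inv_cancel_left₀ hlam] at h2

/-- As 1 lies in Λ, every multiplier is its own image of 1 and lies in Λ = ℤθ + ℤ. -/
lemma multiplierRing_eq_closure {Λ : Submodule ℤ ℂ} {θ : ℂ}
    (hmem : ∀ z, z ∈ Λ ↔ ∃ m n : ℤ, m * θ + n = z) (hθ : θ * θ ∈ Λ) :
    multiplierRing Λ = Subring.closure {θ} := by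
  have h1 : (1 : ℂ) ∈ Λ := (hmem 1).2 ⟨0, 1, by simp⟩
  have hθ1 : θ ∈ Λ := (hmem θ).2 ⟨1, 0, by simp⟩
  refine le_antisymm (fun x hx => ?_) (Subring.closure_le.2 ?_)
  · have h2 := hx 1 h1
    rw [mul_one] at h2
    obtain ⟨m, n, rfl⟩ := (hmem x).1 h2
    exact add_mem (mul_mem (intCast_mem _ m) (Subring.subset_closure rfl)) (intCast_mem _ n)
  · rw [Set.singleton_subset_iff]
    intro l hl
    obtain ⟨m, n, rfl⟩ := (hmem l).1 hl
    have := Λ.add_mem (Λ.smul_mem m hθ) (Λ.smul_mem n hθ1)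
    simp only [zsmul_eq_mul] at this
    rw [show θ * (m * θ + n) = m * (θ * θ) + n * θ by ring]
    exact this

/-- E₂(0) is homogeneous of degree -2 in the lattice, so a symmetry θ with θ² ≠ 1 forces it to
vanish. -/
lemma E_two_eq_zero_of_unit {L : PeriodPair} {θ : ℂ} (h0 : θ ≠ 0) (h1 : θ ^ 2 ≠ 1)
    (h : ∀ z, θ * z ∈ L.lattice ↔ z ∈ L.lattice) : E L.lattice 2 0 = 0 := by
  obtain ⟨-, hv, -⟩ := exists_E_one_formula L
  have h2 := hasContinuedValue_scale (k := 2) (z := 0) h0 h hv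
  rw [mul_zero] at h2
  have h3 := hv.unique h2
  by_contra hne
  have h4 : (θ ^ 2)⁻¹ = 1 := mul_right_cancel₀ hne (by rw [one_mul]; exact h3.symm)
  exact h1 (inv_eq_one.1 h4)

lemma E_two_scale {L M : PeriodPair} {lam : ℂ} (hlam : lam ≠ 0)
    (h : ∀ z, lam * z ∈ L.lattice ↔ z ∈ M.lattice) :
    E L.lattice 2 0 = (lam ^ 2)⁻¹ * E M.lattice 2 0 := by
  obtain ⟨-, hv, -⟩ := exists_E_one_formula M
  obtain ⟨-, hw, -⟩ := exists_E_one_formula L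
  have h2 := hasContinuedValue_scale (k := 2) (z := 0) hlam h hv
  rw [mul_zero] at h2
  exact hw.unique h2

lemma nome_of_re_zero {τ : ℂ} (h : τ.re = 0) :
    nome τ = ((Real.exp (-(2 * Real.pi * τ.im)) : ℝ) : ℂ) := by
  rw [nome, ofReal_exp]
  congr 1
  apply Complex.ext <;> simp [h]

lemma nome_of_re_half {τ : ℂ} (h : τ.re = 1 / 2 ∨ τ.re = -1 / 2) :
    nome τ = ((-Real.exp (-(2 * Real.pi * τ.im)) : ℝ) : ℂ) := by
  have e : τ = τ.re + τ.im * I := (re_add_im τ).symm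
  rw [nome, e, mul_add, Complex.exp_add]
  have h1 : cexp (2 * Real.pi * I * τ.re) = -1 := by
    rcases h with h | h
    · rw [h, ← Complex.exp_pi_mul_I]; congr 1; push_cast; ring
    · rw [h]
      rw [show (2 * Real.pi * I * ((-1 / 2 : ℝ) : ℂ)) = -(Real.pi * I) by push_cast; ring,
        Complex.exp_neg, Complex.exp_pi_mul_I]
      norm_num
  rw [h1]
  push_cast
  simp only [add_im, ofReal_im, mul_im, ofReal_re, I_im, mul_one, I_re, mul_zero, add_zero,
    zero_add]
  rw [show (2 * Real.pi * I * (τ.im * I) : ℂ) = -(2 * Real.pi * τ.im) by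
    linear_combination (2 * Real.pi * τ.im : ℂ) * I_sq]
  ring

lemma lambertF_ofReal_im (q : ℝ) : (lambertF q).im = 0 := by
  rw [← Complex.conj_eq_iff_im]
  have := lambertF_star q
  rw [Complex.star_def, conj_ofReal] at this
  exact this.symm

/-- The bound 173/200 = 0.865 lies just below √3/2, the least imaginary part in the fundamental
domain. The nome is thus well inside the disc where `lambertF` is controlled. -/
lemma exp_bound {y : ℝ} (hy : 173 / 200 ≤ y) : Real.exp (-(2 * Real.pi * y)) ≤ 1 / 200 := by
  have h1 : (5.4 : ℝ) ≤ 2 * Real.pi * y := by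
    have := Real.pi_gt_d2
    nlinarith
  have h2 : Real.exp (-(2 * Real.pi * y)) ≤ Real.exp (-5.4) := Real.exp_le_exp.2 (by linarith)
  refine h2.trans ?_
  rw [Real.exp_neg, inv_eq_one_div]
  refine one_div_le_one_div_of_le (by norm_num) ?_
  have h3 : Real.exp 5.4 = Real.exp 1 ^ 5 * Real.exp 0.4 := by
    rw [← Real.exp_nat_mul, ← Real.exp_add]; norm_num
  have h4 : (2.7 : ℝ) ^ 5 ≤ Real.exp 1 ^ 5 := by
    have := Real.exp_one_gt_d9
    gcongr
    linarith
  have h5 : (1.4 : ℝ) ≤ Real.exp 0.4 := by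
    have := Real.add_one_le_exp (0.4 : ℝ)
    linarith
  rw [h3]
  calc (200 : ℝ) ≤ 2.7 ^ 5 * 1.4 := by norm_num
    _ ≤ _ := by gcongr

lemma tauPair_unit {τ : ℂ} (hτ : 0 < τ.im) {p : ℤ} (h : τ ^ 2 = p * τ - 1) (z : ℂ) :
    τ * z ∈ (tauPair τ hτ).lattice ↔ z ∈ (tauPair τ hτ).lattice := by
  have hτ0 : τ ≠ 0 := fun h => by simp [h] at hτ
  simp only [mem_tauPair]
  constructor
  · rintro ⟨m, n, hm⟩
    refine ⟨-n, m + n * p, mul_left_cancel₀ hτ0 ?_⟩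
    push_cast
    linear_combination hm - n * h
  · rintro ⟨m, n, rfl⟩
    exact ⟨m * p + n, -m, by push_cast; linear_combination -m * h⟩

/-- The symmetry i of ℤ[i] makes E₂(0) vanish at τ = i. This expresses the constant through the
value of `lambertF` there, in exactly the form needed for comparison along the imaginary axis. -/
lemma cotConst_eq : ((cotConst : ℂ).im = 0) ∧
    (cotConst.re = 8 * Real.pi ^ 2 * (lambertF ((Real.exp (-(2 * Real.pi)) : ℝ) : ℂ)).re +
      Real.pi) := by
  have hI : 0 < (I : ℂ).im := by simp
  have h1 := (E_two_tau hI).1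
  have h2 : E (tauPair I hI).lattice 2 0 = 0 := by
    refine E_two_eq_zero_of_unit (θ := I) I_ne_zero (by norm_num [I_sq]) fun z => ?_
    exact tauPair_unit hI (p := 0) (by simp) z
  rw [h2, nome_of_re_zero (by simp)] at h1
  simp only [I_im, mul_one, ofReal_one, div_one] at h1
  have h3 : cotConst = 8 * (Real.pi : ℂ) ^ 2 *
    lambertF ((Real.exp (-(2 * Real.pi)) : ℝ) : ℂ) + Real.pi := by linear_combination -h1
  have h4 : (8 * (Real.pi : ℂ) ^ 2) = ((8 * Real.pi ^ 2 : ℝ) : ℂ) := by push_cast; ring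
  rw [h4] at h3
  have h5 := lambertF_ofReal_im (Real.exp (-(2 * Real.pi)))
  rw [h3]
  simp only [add_im, re_ofReal_mul, im_ofReal_mul, ofReal_im, add_re, ofReal_re, h5]
  simp

lemma fd_im_ge {τ : ℂ} (hτ : 0 < τ.im) (h1 : |τ.re| ≤ 1 / 2) (h2 : 1 ≤ normSq τ) :
    Real.sqrt 3 / 2 ≤ τ.im := by
  rw [normSq_apply] at h2
  have h3 : τ.re * τ.re ≤ 1 / 4 := by
    have := abs_mul_abs_self τ.re
    nlinarith [abs_nonneg τ.re]
  have h4 : Real.sqrt 3 ≤ 2 * τ.im := by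
    rw [Real.sqrt_le_left (by linarith)]
    nlinarith
  linarith

lemma sqrt_three_bounds : (1.73 : ℝ) < Real.sqrt 3 ∧ Real.sqrt 3 < 1.7321 := by
  constructor
  · rw [Real.lt_sqrt (by norm_num)]; norm_num
  · rw [Real.sqrt_lt' (by norm_num)]; norm_num

/-- On the lines Re τ = ±1/2 a zero of E₂(0) is a solution of 8π²F(-e^(-2πy)) = const - π/y, with F
the function `lambertF`. Above the corner y₀ the left side grows by at most the quantity on the left
here, and the right side by the quantity on the right, so no second solution exists. -/
lemma exp_sub_exp_lt {y₀ y : ℝ} (h0 : 0.865 < y₀) (h1 : y₀ < 0.867) (h : y₀ < y) :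
    8 * Real.pi ^ 2 * (11 / 10 * (Real.exp (-(2 * Real.pi * y₀)) - Real.exp (-(2 * Real.pi * y)))) <
      Real.pi * (1 / y₀ - 1 / y) := by
  have hpi := Real.pi_pos
  have hp2 := Real.pi_lt_d2
  obtain ⟨δ, rfl⟩ : ∃ δ, y = y₀ + δ := ⟨y - y₀, by ring⟩
  have hδ0 : 0 < δ := by linarith
  have hq1 := exp_bound (y := y₀) (by linarith)
  set X := Real.exp (-(2 * Real.pi * δ)) with hX
  have h4 : Real.exp (-(2 * Real.pi * (y₀ + δ))) = Real.exp (-(2 * Real.pi * y₀)) * X := by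
    rw [hX, ← Real.exp_add]; congr 1; ring
  have h12 : 1 - X ≤ 2 * Real.pi * δ := by
    have := Real.add_one_le_exp (-(2 * Real.pi * δ))
    linarith
  have h13 : 1 - X < 1 := by
    have := Real.exp_pos (-(2 * Real.pi * δ))
    linarith
  have h5 : 0 ≤ 1 - X := sub_nonneg.2 (Real.exp_le_one_iff.2 (by
    have : 0 < Real.pi * δ := by positivity
    linarith))
  have h6 : Real.exp (-(2 * Real.pi * y₀)) - Real.exp (-(2 * Real.pi * y₀)) * X ≤
      1 / 200 * (1 - X) := by
    have := mul_le_mul_of_nonneg_right hq1 h5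
    linarith
  have hden : 0 < y₀ * (y₀ + δ) := by positivity
  have hmain : 8 * 3.15 * (11 / 2000 * (1 - X)) * (y₀ * (y₀ + δ)) < δ := by
    -- For small δ the linear bound 1 - X ≤ 2πδ suffices; for larger δ the trivial bound 1 - X < 1
    -- does.
    rcases le_or_gt δ 0.2 with hd | hd
    · have h14 : y₀ * (y₀ + δ) ≤ 0.867 * 1.067 :=
        mul_le_mul h1.le (by linarith) (by positivity) (by norm_num)
      have h15 : 1 - X ≤ 6.3 * δ := by nlinarith
      calc _ ≤ 8 * 3.15 * (11 / 2000 * (6.3 * δ)) * (0.867 * 1.067) := by gcongr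
        _ < δ := by linarith
    · have h16 : y₀ * (y₀ + δ) ≤ 0.867 * (0.867 + δ) :=
        mul_le_mul h1.le (by linarith) (by positivity) (by norm_num)
      calc _ ≤ 8 * 3.15 * (11 / 2000 * 1) * (0.867 * (0.867 + δ)) := by gcongr
        _ < δ := by linarith
  have h11 : 1 / y₀ - 1 / (y₀ + δ) = δ / (y₀ * (y₀ + δ)) := by
    have : y₀ + δ ≠ 0 := by positivity
    have : y₀ ≠ 0 := by positivity
    field_simp
    ring
  have h20 : 8 * 3.15 * (11 / 2000 * (1 - X)) < 1 / y₀ - 1 / (y₀ + δ) := by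
    rw [h11, lt_div_iff₀ hden]; exact hmain
  rw [h4]
  calc _ ≤ 8 * Real.pi ^ 2 * (11 / 10 * (1 / 200 * (1 - X))) := by gcongr
    _ = Real.pi * (8 * Real.pi * (11 / 2000 * (1 - X))) := by ring
    _ ≤ Real.pi * (8 * 3.15 * (11 / 2000 * (1 - X))) := by gcongr
    _ < _ := by gcongr

/-- The zeros of `E₂(0)` in the fundamental domain are `i` and the sixth roots of unity. -/
theorem E_two_tau_zero {τ : ℂ} (hτ : 0 < τ.im) (h1 : |τ.re| ≤ 1 / 2) (h2 : 1 ≤ normSq τ)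
    (h : E (tauPair τ hτ).lattice 2 0 = 0) : τ = I ∨
      τ.im = Real.sqrt 3 / 2 ∧ (τ.re = 1 / 2 ∨ τ.re = -1 / 2) := by
  obtain ⟨hc1, hc2⟩ := cotConst_eq
  have hs := sqrt_three_bounds
  have hyge := fd_im_ge hτ h1 h2
  have hpi := Real.pi_pos
  set y := τ.im with hy
  have hq := exp_bound (y := y) (by linarith)
  have hE := (E_two_tau hτ).1
  rw [h] at hE
  have hEq : ((8 * Real.pi ^ 2 : ℝ) : ℂ) * lambertF (nome τ) = cotConst - ((Real.pi / y : ℝ) : ℂ) := by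
    push_cast
    linear_combination hE
  have hre := congrArg Complex.re hEq
  have him := congrArg Complex.im hEq
  simp only [re_ofReal_mul, im_ofReal_mul, sub_re, sub_im, ofReal_re, ofReal_im, hc1, sub_zero]
    at hre him
  -- The other terms of the q-expansion are real, so a zero forces a real Lambert value, hence a
  -- real nome, hence 2 Re τ ∈ ℤ.
  have hF0 : (lambertF (nome τ)).im = 0 := by
    exact (mul_eq_zero.1 him).resolve_left (by positivity)
  have hq0 : (nome τ).im = 0 := im_eq_zero_of_lambertF (by rw [norm_nome]; linarith) hF0
  have hsin : Real.sin (2 * Real.pi * τ.re) = 0 := by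
    rw [nome, exp_im] at hq0
    rcases mul_eq_zero.1 hq0 with h | h
    · exact absurd h (Real.exp_ne_zero _)
    · simpa using h
  obtain ⟨n, hn⟩ := Real.sin_eq_zero_iff.1 hsin
  have hn2 : (n : ℝ) = 2 * τ.re := by
    apply mul_right_cancel₀ hpi.ne'
    rw [hn]; ring
  obtain ⟨hl, hr⟩ := abs_le.1 h1
  have hn3 : -1 ≤ n ∧ n ≤ 1 := by
    constructor
    · have : (-1 : ℝ) ≤ n := by rw [hn2]; linarith
      exact_mod_cast this
    · have : (n : ℝ) ≤ 1 := by rw [hn2]; linarith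
      exact_mod_cast this
  have hexp0 : ∀ x : ℝ, |Real.exp x| = Real.exp x := fun x => abs_of_pos (Real.exp_pos x)
  have hcases : τ.re = 0 ∨ (τ.re = 1 / 2 ∨ τ.re = -1 / 2) := by
    have : n = -1 ∨ n = 0 ∨ n = 1 := by omega
    rcases this with h | h | h <;> rw [h] at hn2 <;> push_cast at hn2
    · right; right; linarith
    · left; linarith
    · right; left; linarith
  rcases hcases with hx | hx
  · left
    have hy1 : 1 ≤ y := by
      rw [normSq_apply, hx] at h2
      nlinarith
    rw [nome_of_re_zero hx] at hre
    have hq1 := exp_bound (y := 1) (by norm_num)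
    rw [mul_one] at hq1
    have h3 := abs_lambertF_sub_le (p := Real.exp (-(2 * Real.pi)))
      (q := Real.exp (-(2 * Real.pi * y))) (by rw [hexp0]; linarith) (by rw [hexp0]; linarith)
    have h4 : Real.exp (-(2 * Real.pi * y)) ≤ Real.exp (-(2 * Real.pi)) :=
      Real.exp_le_exp.2 (by nlinarith)
    -- On the imaginary axis y ≥ 1, and monotonicity puts the Lambert value below the one at i.
    -- Comparing the two vanishing equations gives π ≤ π/y, so y = 1.
    have h5 : (lambertF ((Real.exp (-(2 * Real.pi * y)) : ℝ) : ℂ)).re ≤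
        (lambertF ((Real.exp (-(2 * Real.pi)) : ℝ) : ℂ)).re := by
      rw [abs_of_nonpos (sub_nonpos.2 h4)] at h3
      have := (abs_le.1 h3).2
      linarith
    have h6 : Real.pi ≤ Real.pi / y := by
      have h7 : 0 ≤ 8 * Real.pi ^ 2 := by positivity
      have := mul_le_mul_of_nonneg_left h5 h7
      linarith
    have h8 : y ≤ 1 := by
      rw [le_div_iff₀ hτ] at h6
      nlinarith
    exact Complex.ext (by simp [hx]) (by simp [← hy]; linarith)
  · right
    refine ⟨?_, hx⟩
    by_contra hne
    set y₀ := Real.sqrt 3 / 2 with hy₀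
    have hlt : y₀ < y := lt_of_le_of_ne hyge (Ne.symm hne)
    have hq1 := exp_bound (y := y₀) (by linarith)
    rw [nome_of_re_half hx] at hre
    -- The sixth root of unity ρ is itself a symmetry of ℤρ + ℤ, so the corner is a zero and serves
    -- as the reference solution.
    have hρ : 8 * Real.pi ^ 2 * (lambertF ((-Real.exp (-(2 * Real.pi * y₀)) : ℝ) : ℂ)).re =
        cotConst.re - Real.pi / y₀ := by
      set ρ : ℂ := ⟨1 / 2, y₀⟩ with hρ
      have hρi : 0 < ρ.im := by simp only [hρ]; linarith
      have hρ2 : ρ ^ 2 = (1 : ℤ) * ρ - 1 := by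
        have h33 : Real.sqrt 3 * Real.sqrt 3 = 3 := Real.mul_self_sqrt (by norm_num)
        apply Complex.ext
        · simp [hρ, pow_two]; nlinarith
        · simp [hρ, pow_two]; ring
      have h3 := (E_two_tau hρi).1
      have h4 : E (tauPair ρ hρi).lattice 2 0 = 0 := by
        refine E_two_eq_zero_of_unit (θ := ρ) ?_ ?_ fun z => tauPair_unit hρi hρ2 z
        · intro h; rw [h] at hρi; simp at hρi
        · intro h
          have := congrArg Complex.im h
          rw [hρ2] at this
          simp [hρ] at this
          linarith
      rw [h4, nome_of_re_half (Or.inl rfl)] at h3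
      have h5 : ((8 * Real.pi ^ 2 : ℝ) : ℂ) *
          lambertF ((-Real.exp (-(2 * Real.pi * y₀)) : ℝ) : ℂ) =
            cotConst - ((Real.pi / y₀ : ℝ) : ℂ) := by
        push_cast at h3 ⊢
        linear_combination h3
      have h6 := congrArg Complex.re h5
      simpa only [re_ofReal_mul, sub_re, ofReal_re] using h6
    have h3 := abs_lambertF_sub_le (p := -Real.exp (-(2 * Real.pi * y₀)))
      (q := -Real.exp (-(2 * Real.pi * y))) (by rw [abs_neg, hexp0]; linarith)
      (by rw [abs_neg, hexp0]; linarith)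
    have h7 := exp_sub_exp_lt (by linarith) (by linarith) hlt
    have h8 : Real.exp (-(2 * Real.pi * y)) ≤ Real.exp (-(2 * Real.pi * y₀)) :=
      Real.exp_le_exp.2 (by nlinarith)
    rw [abs_of_nonneg (a := -Real.exp (-(2 * Real.pi * y)) - -Real.exp (-(2 * Real.pi * y₀)))
      (by linarith)] at h3
    have h9 := (abs_le.1 h3).2
    have h10 : 0 ≤ 8 * Real.pi ^ 2 := by positivity
    have h11 := mul_le_mul_of_nonneg_left h9 h10
    have e1 : Real.pi * (1 / y₀ - 1 / y) = Real.pi / y₀ - Real.pi / y := by ring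
    rw [e1] at h7
    linarith

/-- `E₂(0)` does not vanish for a lattice that is not similar to `ℤ[i]` or `ℤ[(1 - √-3)/2]`. -/
theorem E_two_ne_zero {L : PeriodPair} (hi : multiplierRing L.lattice ≠ Subring.closure {I})
    (hρ : multiplierRing L.lattice ≠ Subring.closure {(1 - I * (Real.sqrt 3 : ℂ)) / 2}) :
    E L.lattice 2 0 ≠ 0 := by
  obtain ⟨lam, τ, hτ, hlam, h1, h2, h⟩ := exists_fd_basis L
  intro h0
  rw [E_two_scale hlam h, mul_eq_zero] at h0
  rcases h0 with h0 | h0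
  · exact hlam (by simpa using h0)
  rw [multiplierRing_scale hlam h] at hi hρ
  rcases E_two_tau_zero hτ h1 h2 h0 with rfl | ⟨hy, hx⟩
  · exact hi (multiplierRing_eq_closure (fun z => mem_tauPair hτ)
      ((mem_tauPair hτ).2 ⟨0, -1, by simp⟩))
  · have h33 : (Real.sqrt 3 : ℂ) * Real.sqrt 3 = 3 := by
      rw [← ofReal_mul, Real.mul_self_sqrt (by norm_num)]; norm_num
    set θ : ℂ := (1 - I * (Real.sqrt 3 : ℂ)) / 2 with hθ
    have hθ2 : θ * θ = θ - 1 := by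
      rw [hθ]
      linear_combination (Real.sqrt 3 : ℂ) * Real.sqrt 3 / 4 * I_sq - 1 / 4 * h33
    -- Both corners differ from -θ by an integer, so ℤτ + ℤ = ℤθ + ℤ.
    have hmem : ∃ k : ℤ, τ = k - θ := by
      rcases hx with hx | hx
      · exact ⟨1, Complex.ext (by simp [hθ, hx]; norm_num) (by simp [hθ, hy]; ring)⟩
      · exact ⟨0, Complex.ext (by simp [hθ, hx]; norm_num) (by simp [hθ, hy]; ring)⟩
    obtain ⟨k, hk⟩ := hmem
    refine hρ (multiplierRing_eq_closure (fun z => ?_) ((mem_tauPair hτ).2 ⟨-1, k - 1, ?_⟩))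
    · rw [mem_tauPair]
      constructor
      · rintro ⟨m, n, rfl⟩
        exact ⟨-m, n + m * k, by rw [hk]; push_cast; ring⟩
      · rintro ⟨m, n, rfl⟩
        exact ⟨-m, n + m * k, by rw [hk]; push_cast; ring⟩
    · rw [hθ2, hk]; push_cast; ring

/-! ### The addition theorem summed over finite subgroups -/

section Abstract

variable {X : Type*} [AddCommGroup X] {e p : X → ℂ}

open scoped Classical in
/-- The addition theorem extended to all pairs of points. -/
lemma mul_sub_mul_add (he0 : e 0 = 0) (hen : ∀ x, e (-x) = -e x) (hp0 : p 0 = 0)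
    (hpn : ∀ x, p (-x) = p x) (h : ∀ u v, u ≠ 0 → v ≠ 0 → u + v ≠ 0 →
      (e u + e v - e (u + v)) ^ 2 = p u + p v + p (u + v)) (u v : X) :
    2 * (e u * e v - e (u + v) * e u - e (u + v) * e v) =
      (p u - e u ^ 2) + (p v - e v ^ 2) + (p (u + v) - e (u + v) ^ 2) -
      2 * (if u = 0 then p v else 0) - 2 * (if v = 0 then p u else 0) -
      2 * (if v = -u then p u else 0) := by
  by_cases hu : u = 0
  · subst hu
    by_cases hv : v = 0
    · subst hv; simp [he0, hp0]
    · simp [he0, hp0, hv]; ring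
  by_cases hv : v = 0
  · subst hv
    have : ¬ (0 = -u) := fun h => hu (by rw [← neg_eq_zero, ← h])
    simp [he0, hp0, hu, this]; ring
  by_cases huv : v = -u
  · subst huv
    simp [he0, hp0, hu, hen, hpn]; ring
  · have huv' : u + v ≠ 0 := fun h => huv (eq_neg_of_add_eq_zero_right h)
    simp only [hu, hv, huv, if_false]
    linear_combination h u v hu hv huv'

lemma sum_odd_eq_zero (hen : ∀ x, e (-x) = -e x) (A : AddSubgroup X) [Fintype A] :
    ∑ u : A, e u = 0 := by
  have h := Equiv.sum_comp (Equiv.neg A) fun u : A => e u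
  simp only [Equiv.neg_apply, NegMemClass.coe_neg, hen, Finset.sum_neg_distrib] at h
  linear_combination (-1 / 2 : ℂ) * h

lemma sum_shift (f : X → ℂ) (A : AddSubgroup X) [Fintype A] (u : A) :
    ∑ v : A, f (u + v) = ∑ v : A, f v :=
  Equiv.sum_comp (Equiv.addLeft u) fun v : A => f v

variable (he0 : e 0 = 0) (hen : ∀ x, e (-x) = -e x) (hp0 : p 0 = 0)
    (hpn : ∀ x, p (-x) = p x) (h : ∀ u v, u ≠ 0 → v ≠ 0 → u + v ≠ 0 →
      (e u + e v - e (u + v)) ^ 2 = p u + p v + p (u + v))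
include he0 hen hp0 hpn h

/-- Sum the addition theorem over all pairs in A. The products vanish because e is odd; each of the
three squares gives |A| ∑ (p - e²), and each of the three degenerate lines u = 0, v = 0, u + v = 0
gives 2 ∑ p. -/
lemma card_mul_sum_subgroup (A : AddSubgroup X) [Fintype A] :
    (Fintype.card A : ℂ) * ∑ u : A, (p u - e u ^ 2) = 2 * ∑ u : A, p u := by
  classical
  have hs : ∑ u : A, ∑ v : A, (2 * (e u * e v - e (u + v) * e u - e (u + v) * e v)) =
      ∑ u : A, ∑ v : A, ((p u - e u ^ 2) + (p v - e v ^ 2) + (p (u + v) - e (u + v) ^ 2) -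
      2 * (if (u : X) = 0 then p v else 0) - 2 * (if (v : X) = 0 then p u else 0) -
      2 * (if (v : X) = -u then p u else 0)) :=
    Finset.sum_congr rfl fun u _ => Finset.sum_congr rfl fun v _ =>
      mul_sub_mul_add he0 hen hp0 hpn h u v
  have h1 : ∑ u : A, e u * ∑ v : A, e v = 0 := by
    simp [sum_odd_eq_zero hen]
  have h2 : ∑ u : A, ∑ v : A, e (u + v) * e u = 0 := by
    simp_rw [← Finset.sum_mul, sum_shift, sum_odd_eq_zero hen]; simp
  have h3 : ∑ u : A, ∑ v : A, e (u + v) * e v = 0 := by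
    rw [Finset.sum_comm]
    simp_rw [add_comm]
    exact h2
  have h4 : ∀ u : A, ∑ v : A, (p (u + v) - e (u + v) ^ 2) = ∑ v : A, (p v - e v ^ 2) := fun u =>
    sum_shift (fun x => p x - e x ^ 2) A u
  have h5 : ∑ u : A, ∑ v : A, (if (u : X) = 0 then p v else 0) = ∑ u : A, p u := by
    rw [Finset.sum_comm]
    refine Finset.sum_congr rfl fun v _ => ?_
    simp
  have h6 : ∑ u : A, ∑ v : A, (if (v : X) = 0 then p u else 0) = ∑ u : A, p u := by
    refine Finset.sum_congr rfl fun v _ => ?_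
    simp
  have h7 : ∑ u : A, ∑ v : A, (if (v : X) = -u then p u else 0) = ∑ u : A, p u := by
    refine Finset.sum_congr rfl fun u _ => ?_
    have : ∀ v : A, ((v : X) = -u ↔ v = -u) := fun v => by
      rw [← AddSubgroup.coe_neg, Subtype.coe_inj]
    simp [this]
  simp only [← Finset.mul_sum, Finset.sum_sub_distrib, Finset.sum_add_distrib, h1, h2, h3, h5, h6,
    h7] at hs
  have h8 : ∑ u : A, ∑ v : A, p (u + v) - ∑ u : A, ∑ v : A, e (u + v) ^ 2 =
      Fintype.card A * (∑ u : A, p u - ∑ u : A, e u ^ 2) := by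
    rw [← Finset.sum_sub_distrib]
    simp_rw [← Finset.sum_sub_distrib] at h4 ⊢
    rw [Finset.sum_congr rfl fun u _ => h4 u, Finset.sum_const, Finset.card_univ, nsmul_eq_mul]
  simp only [Finset.sum_const, Finset.card_univ, nsmul_eq_mul, ← Finset.mul_sum] at hs
  simp only [Finset.sum_sub_distrib]
  linear_combination (-1 / 3 : ℂ) * hs - (1 / 3 : ℂ) * h8

/-- The same summation over u ∈ A and v ∈ B. The cross terms no longer vanish: for torsion subgroups
the distribution relation turns their inner sums into Dedekind sums. -/
lemma sum_sum_disjoint_subgroups (A B : AddSubgroup X) [Fintype A] [Fintype B] (hAB : A ⊓ B = ⊥) :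
    -2 * (∑ u : A, (∑ v : B, e (u + v)) * e u + ∑ v : B, (∑ u : A, e (v + u)) * e v) =
      Fintype.card B * ∑ u : A, (p u - e u ^ 2) + Fintype.card A * ∑ u : B, (p u - e u ^ 2) +
      ∑ x : A × B, (p (x.1 + x.2) - e (x.1 + x.2) ^ 2) - 2 * ∑ u : A, p u - 2 * ∑ u : B, p u := by
  classical
  have hs : ∑ u : A, ∑ v : B, (2 * (e u * e v - e (u + v) * e u - e (u + v) * e v)) =
      ∑ u : A, ∑ v : B, ((p u - e u ^ 2) + (p v - e v ^ 2) + (p (u + v) - e (u + v) ^ 2) -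
      2 * (if (u : X) = 0 then p v else 0) - 2 * (if (v : X) = 0 then p u else 0) -
      2 * (if (v : X) = -u then p u else 0)) :=
    Finset.sum_congr rfl fun u _ => Finset.sum_congr rfl fun v _ =>
      mul_sub_mul_add he0 hen hp0 hpn h u v
  have h1 : ∑ u : A, e u * ∑ v : B, e v = 0 := by
    simp [sum_odd_eq_zero hen]
  have h5 : ∑ u : A, ∑ v : B, (if (u : X) = 0 then p v else 0) = ∑ u : B, p u := by
    rw [Finset.sum_comm]
    refine Finset.sum_congr rfl fun v _ => ?_
    simp
  have h6 : ∑ u : A, ∑ v : B, (if (v : X) = 0 then p u else 0) = ∑ u : A, p u := by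
    refine Finset.sum_congr rfl fun v _ => ?_
    simp
  -- The line u + v = 0 meets A × B only at the origin, where p is 0.
  have h7 : ∑ u : A, ∑ v : B, (if (v : X) = -u then p u else 0) = 0 := by
    refine Finset.sum_eq_zero fun u _ => Finset.sum_eq_zero fun v _ => ?_
    split_ifs with hv
    · have : (u : X) ∈ A ⊓ B := ⟨u.2, by
        rw [SetLike.mem_coe, ← neg_neg (u : X), ← hv]; exact B.neg_mem v.2⟩
      rw [hAB, AddSubgroup.mem_bot] at this
      rw [this, hp0]
    · rfl
  have h8 : ∑ v : B, (∑ u : A, e (v + u)) * e v = ∑ u : A, ∑ v : B, e (u + v) * e v := by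
    rw [Finset.sum_comm]
    refine Finset.sum_congr rfl fun v _ => ?_
    rw [Finset.sum_mul]
    simp_rw [add_comm]
  simp only [← Finset.mul_sum, Finset.sum_sub_distrib, Finset.sum_add_distrib, h1, h5, h6,
    h7] at hs
  rw [h8, Fintype.sum_prod_type]
  simp only [Finset.sum_const, Finset.card_univ, nsmul_eq_mul, ← Finset.mul_sum] at hs
  simp only [Finset.sum_sub_distrib, Finset.sum_mul]
  linear_combination hs

end Abstract

/-! ### Torsion of the complex torus, distribution relation and Fourier expansion -/

/-- `Λ` as a module over its ring of multipliers. -/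
def latticeModule (Λ : Submodule ℤ ℂ) : Submodule (multiplierRing Λ) ℂ where
  carrier := Λ
  add_mem' := Λ.add_mem
  zero_mem' := Λ.zero_mem
  smul_mem' c _ hx := c.2 _ hx

/-- The complex torus `ℂ / Λ`. -/
abbrev Torus (Λ : Submodule ℤ ℂ) := ℂ ⧸ latticeModule Λ

/-- The point of the torus given by a complex number. -/
abbrev toTorus (Λ : Submodule ℤ ℂ) (z : ℂ) : Torus Λ := Submodule.Quotient.mk z

/-- The function on the torus given by a periodic function. -/
def descend {Λ : Submodule ℤ ℂ} (φ : ℂ → ℂ) (x : Torus Λ) : ℂ := φ (Quotient.out x)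

lemma toTorus_out {Λ : Submodule ℤ ℂ} (x : Torus Λ) : toTorus Λ (Quotient.out x) = x :=
  Quotient.out_eq x

lemma toTorus_eq {Λ : Submodule ℤ ℂ} {z w : ℂ} : toTorus Λ z = toTorus Λ w ↔ z - w ∈ Λ :=
  Submodule.Quotient.eq _

lemma toTorus_eq_zero {Λ : Submodule ℤ ℂ} {z : ℂ} : toTorus Λ z = 0 ↔ z ∈ Λ :=
  Submodule.Quotient.mk_eq_zero _

lemma smul_toTorus {Λ : Submodule ℤ ℂ} (k : multiplierRing Λ) (z : ℂ) :
    k • toTorus Λ z = toTorus Λ (k * z) := rfl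

lemma toTorus_add {Λ : Submodule ℤ ℂ} (z w : ℂ) :
    toTorus Λ z + toTorus Λ w = toTorus Λ (z + w) := rfl

lemma toTorus_neg {Λ : Submodule ℤ ℂ} (z : ℂ) : -toTorus Λ z = toTorus Λ (-z) := rfl

lemma descend_toTorus {Λ : Submodule ℤ ℂ} {φ : ℂ → ℂ} (hφ : ∀ z, ∀ l ∈ Λ, φ (z + l) = φ z)
    (z : ℂ) : descend φ (toTorus Λ z) = φ z := by
  have h := toTorus_eq.1 (toTorus_out (toTorus Λ z))
  unfold descend
  have h2 := hφ z _ h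
  rw [add_sub_cancel] at h2
  exact h2

/-- The `k`-torsion of the torus. -/
def tor {Λ : Submodule ℤ ℂ} (k : multiplierRing Λ) : AddSubgroup (Torus Λ) :=
  (Submodule.torsionBy (multiplierRing Λ) (Torus Λ) k).toAddSubgroup

lemma mem_tor {Λ : Submodule ℤ ℂ} {k : multiplierRing Λ} {x : Torus Λ} :
    x ∈ tor k ↔ k • x = 0 := by
  unfold tor
  rw [Submodule.mem_toAddSubgroup, Submodule.mem_torsionBy_iff]

lemma toTorus_mem_tor {Λ : Submodule ℤ ℂ} {k : multiplierRing Λ} {z : ℂ} :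
    toTorus Λ z ∈ tor k ↔ k * z ∈ Λ := by
  rw [mem_tor, smul_toTorus, toTorus_eq_zero]

lemma mul_out_mem {Λ : Submodule ℤ ℂ} {k : multiplierRing Λ} (t : tor k) :
    k * Quotient.out (t : Torus Λ) ∈ Λ := by
  rw [← toTorus_mem_tor, toTorus_out]; exact t.2

/-- A lattice vector is `k` times the sum of a representative of a `k`-torsion point and a lattice
vector. -/
def torEquiv {Λ : Submodule ℤ ℂ} {k : multiplierRing Λ} (hk : k ≠ 0) : tor k × Λ ≃ Λ :=
  Equiv.ofBijective
    (fun x => ⟨k * (Quotient.out (x.1 : Torus Λ) + x.2), by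
      rw [mul_add]; exact Λ.add_mem (mul_out_mem x.1) (k.2 _ x.2.2)⟩) <| by
    have hk' : (k : ℂ) ≠ 0 := fun h => hk (Subtype.ext h)
    constructor
    · rintro ⟨t, l⟩ ⟨t', l'⟩ h
      have h1 : Quotient.out (t : Torus Λ) + (l : ℂ) = Quotient.out (t' : Torus Λ) + l' :=
        mul_left_cancel₀ hk' (congrArg Subtype.val h)
      have h2 : (t : Torus Λ) = t' := by
        rw [← toTorus_out (t : Torus Λ), ← toTorus_out (t' : Torus Λ), toTorus_eq]
        rw [show Quotient.out (t : Torus Λ) - Quotient.out (t' : Torus Λ) = l' - (l : ℂ) by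
          linear_combination h1]
        exact Λ.sub_mem l'.2 l.2
      have h3 : t = t' := Subtype.ext h2
      subst h3
      rw [add_right_inj] at h1
      rw [Subtype.ext h1]
    · intro m
      have hm : (k : ℂ) * ((k : ℂ)⁻¹ * m) = m := mul_inv_cancel_left₀ hk' _
      refine ⟨⟨⟨toTorus Λ ((k : ℂ)⁻¹ * m), by rw [toTorus_mem_tor, hm]; exact m.2⟩,
        ⟨(k : ℂ)⁻¹ * m - Quotient.out (toTorus Λ ((k : ℂ)⁻¹ * m)), ?_⟩⟩, ?_⟩
      · rw [← toTorus_eq, toTorus_out]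
      · ext
        simp only [add_sub_cancel, hm]

lemma torEquiv_apply {Λ : Submodule ℤ ℂ} {k : multiplierRing Λ} (hk : k ≠ 0) (t : tor k) (l : Λ) :
    (torEquiv hk (t, l) : ℂ) = k * (Quotient.out (t : Torus Λ) + l) := rfl

/-- Each torsion point has a representative in a period parallelogram, and k times it is a lattice
vector of bounded norm. -/
lemma finite_tor (L : PeriodPair) {k : multiplierRing L.lattice} (hk : k ≠ 0) :
    Finite (tor k) := by
  have hk' : (k : ℂ) ≠ 0 := fun h => hk (Subtype.ext h)
  set b := L.basis with hb
  set R : ℝ := ∑ i, ‖b i‖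
  have hfin := finite_lattice_le L (‖(k : ℂ)‖ * R)
  have : (tor k : Set (Torus L.lattice)) ⊆
      (fun l : L.lattice => toTorus L.lattice ((k : ℂ)⁻¹ * l)) ''
        {l : L.lattice | ‖(l : ℂ)‖ ≤ ‖(k : ℂ)‖ * R} := by
    intro x hx
    set z := Quotient.out x
    have hz : toTorus L.lattice z = x := toTorus_out x
    have hmem : ((ZSpan.floor b z : Submodule.span ℤ (Set.range b)) : ℂ) ∈ L.lattice := by
      rw [L.lattice_eq_span_range_basis]
      exact (ZSpan.floor b z).2
    have hz2 : toTorus L.lattice (ZSpan.fract b z) = x := by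
      rw [← hz, toTorus_eq, ZSpan.fract_apply, sub_sub_cancel_left]
      exact neg_mem hmem
    have h3 : (k : ℂ) * ZSpan.fract b z ∈ L.lattice := by
      rw [← toTorus_mem_tor, hz2]; exact hx
    refine ⟨⟨_, h3⟩, ?_, ?_⟩
    · simp only [Set.mem_ofPred_eq, norm_mul]
      gcongr
      exact ZSpan.norm_fract_le b z
    · simp only [inv_mul_cancel_left₀ hk']
      exact hz2
  exact (hfin.image _).subset this

/-- The convention 0⁻¹ = 0 makes `absPow` vanish at 0, which replaces the excluded term. -/
lemma eisensteinSeries_one {Λ : Submodule ℤ ℂ} (z s : ℂ) :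
    eisensteinSeries Λ 1 z s = ∑' l : Λ, absPow s (l + z) := by
  unfold eisensteinSeries absPow
  refine tsum_congr fun l => ?_
  split_ifs with h
  · simp [h]
  · rw [pow_one]

lemma summable_absPow (L : PeriodPair) (z : ℂ) {s : ℂ} (hs : 2 < s.re) :
    Summable fun l : L.lattice => absPow s (l + z) := by
  refine Summable.of_norm_bounded (summable_lattice_shift_rpow L z (r := -1 - s.re)
    (by linarith)) fun l => ?_
  by_cases h : (l : ℂ) + z = 0
  · rw [h]
    simp only [absPow, inv_zero, zero_mul, norm_zero]
    positivity
  · rw [norm_absPow s h, add_comm]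

lemma HasContinuedValueAtZero.finset_sum {ι : Type*} (S : Finset ι) {f : ι → ℂ → ℂ} {v : ι → ℂ}
    (h : ∀ i ∈ S, HasContinuedValueAtZero (f i) (v i)) (c : ι → ℂ) :
    HasContinuedValueAtZero (fun s => ∑ i ∈ S, c i * f i s) (∑ i ∈ S, c i * v i) := by
  classical
  induction S using Finset.induction_on with
  | empty => exact ⟨1, one_pos, fun _ => 0, differentiableOn_const _, fun s _ => by simp, by simp⟩
  | insert a S ha ih =>
    obtain ⟨ε, hε, F, hF, hFf, hF0⟩ := h a (Finset.mem_insert_self a S)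
    obtain ⟨δ, hδ, G, hG, hGf, hG0⟩ := ih fun i hi => h i (Finset.mem_insert_of_mem hi)
    refine ⟨min ε δ, lt_min hε hδ, fun s => c a * F s + G s, ?_, fun s hs => ?_, ?_⟩
    · refine ((hF.mono fun s hs => ?_).const_mul _).add (hG.mono fun s hs => ?_)
      · exact lt_of_le_of_lt (neg_le_neg (min_le_left ε δ)) hs
      · exact lt_of_le_of_lt (neg_le_neg (min_le_right ε δ)) hs
    · simp only [Finset.sum_insert ha, hFf s hs, hGf s hs]
    · simp only [Finset.sum_insert ha, hF0, hG0]

/-- A sum over the lattice, grouped by the classes modulo `k`. -/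
lemma tsum_absPow_torEquiv (L : PeriodPair) {k : multiplierRing L.lattice} (hk : k ≠ 0)
    [Fintype (tor k)] (c : L.lattice → ℂ) (c' : tor k → ℂ) (hc : ∀ t l, c (torEquiv hk (t, l)) = c' t)
    (hc1 : ∀ l, ‖c l‖ ≤ 1) (w : ℂ) {s : ℂ} (hs : 2 < s.re) :
    ∑' l : L.lattice, c l * absPow s (l + k * w) = (k : ℂ)⁻¹ * (‖(k : ℂ)‖ : ℂ) ^ (-s) *
      ∑ t : tor k, c' t * eisensteinSeries L.lattice 1 (Quotient.out (t : Torus L.lattice) + w) s := by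
  have hsum : Summable fun l : L.lattice => c l * absPow s (l + k * w) := by
    refine Summable.of_norm_bounded (summable_absPow L (k * w) hs).norm fun l => ?_
    rw [norm_mul]
    exact mul_le_of_le_one_left (norm_nonneg _) (hc1 l)
  have hprod := ((torEquiv hk).summable_iff.2 hsum).tsum_prod
  simp only [Function.comp_apply] at hprod
  rw [← (torEquiv hk).tsum_eq, hprod, tsum_fintype, Finset.mul_sum]
  refine Finset.sum_congr rfl fun t _ => ?_
  rw [eisensteinSeries_one, ← tsum_mul_left, ← tsum_mul_left]
  refine tsum_congr fun l => ?_
  rw [hc, torEquiv_apply, ← mul_add, absPow_mul,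
    show Quotient.out (t : Torus L.lattice) + (l : ℂ) + w =
      l + (Quotient.out (t : Torus L.lattice) + w) by ring]
  simp only [absPow]
  ring

lemma hasContinuedValue_E_one (L : PeriodPair) (w : ℂ) :
    HasContinuedValueAtZero (eisensteinSeries L.lattice 1 w) (E L.lattice 1 w) := by
  obtain ⟨β, -, -, hE⟩ := exists_pairing L
  exact (hE w).1

/-- The distribution relation. -/
theorem sum_E_one_tor (L : PeriodPair) {k : multiplierRing L.lattice} (hk : k ≠ 0)
    [Fintype (tor k)] (w : ℂ) :
    ∑ t : tor k, E L.lattice 1 (Quotient.out (t : Torus L.lattice) + w) =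
      k * E L.lattice 1 (k * w) := by
  have hk' : (k : ℂ) ≠ 0 := fun h => hk (Subtype.ext h)
  have h1 := (HasContinuedValueAtZero.finset_sum Finset.univ (fun (t : tor k) _ =>
    hasContinuedValue_E_one L (Quotient.out (t : Torus L.lattice) + w)) (fun _ => 1)).const_mul_cpow
      (g := eisensteinSeries L.lattice 1 (k * w)) ((k : ℂ)⁻¹) (norm_pos_iff.2 hk') fun s hs => by
    have h := tsum_absPow_torEquiv L hk (fun _ => 1) (fun _ => 1) (fun _ _ => rfl) (by simp) w hs
    rw [← h, eisensteinSeries_one]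
    simp
  rw [(hasContinuedValue_E_one L (k * w)).unique h1, mul_inv_cancel_left₀ hk']
  simp

lemma pairing_add_left (β : ℝ) (u v w : ℂ) :
    pairing β (u + v) w = pairing β u w * pairing β v w := by
  simp only [pairing, ← Complex.exp_add, star_add]
  congr 1; ring

lemma pairing_mul_left (β : ℝ) (k u w : ℂ) : pairing β (k * u) w = pairing β u (star k * w) := by
  simp only [pairing, star_mul', star_star]
  congr 1; ring

lemma pairing_swap (β : ℝ) (u w : ℂ) : pairing β u w = pairing β (-w) u := by
  simp only [pairing, star_neg]
  congr 1; ring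

/-- The finite Fourier expansion of `E₁` at a torsion point. -/
theorem E_one_fourier (L : PeriodPair) {β : ℝ}
    (hβ1 : ∀ l ∈ L.lattice, ∀ m ∈ L.lattice, pairing β l m = 1)
    (hβ2 : ∀ w, HasContinuedValueAtZero (charSeries β L.lattice w) (E L.lattice 1 w))
    {k : multiplierRing L.lattice} (hk : k ≠ 0) [Fintype (tor k)] {w : ℂ}
    (hw : star (k : ℂ) * w ∈ L.lattice) :
    k * E L.lattice 1 w = ∑ t : tor k, pairing β (k * Quotient.out (t : Torus L.lattice)) w *
      E L.lattice 1 (Quotient.out (t : Torus L.lattice)) := by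
  have hk' : (k : ℂ) ≠ 0 := fun h => hk (Subtype.ext h)
  have h1 := (HasContinuedValueAtZero.finset_sum Finset.univ (fun (t : tor k) _ =>
    hasContinuedValue_E_one L (Quotient.out (t : Torus L.lattice)))
      (fun t => pairing β (k * Quotient.out (t : Torus L.lattice)) w)).const_mul_cpow
      (g := charSeries β L.lattice w) ((k : ℂ)⁻¹) (norm_pos_iff.2 hk') fun s hs => by
    have h := tsum_absPow_torEquiv L hk (fun l => pairing β l w)
      (fun t => pairing β (k * Quotient.out (t : Torus L.lattice)) w) (fun t l => ?_)
      (fun l => (norm_pairing _ _ _).le) 0 hs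
    · simp only [mul_zero, add_zero] at h
      rw [← h]
      unfold charSeries
      refine tsum_congr fun l => ?_
      split_ifs with hl
      · simp [hl, absPow]
      · rfl
    -- ψ(kl, w) = ψ(l, k̄w) = 1 because k̄w lies in the lattice, so the character l ↦ ψ(l, w)
    -- depends only on l modulo kΛ.
    · rw [torEquiv_apply, mul_add, pairing_add_left, pairing_mul_left _ _ (l : ℂ),
        hβ1 l l.2 _ hw, mul_one]
  rw [(hβ2 w).unique h1, mul_inv_cancel_left₀ hk']

lemma zetaReg_scale {L M : PeriodPair} {lam : ℂ} (hlam : lam ≠ 0)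
    (h : ∀ z, lam * z ∈ L.lattice ↔ z ∈ M.lattice) (z : ℂ) :
    zetaReg L (lam * z) = lam⁻¹ * zetaReg M z := by
  classical
  unfold zetaReg
  rw [← (scaleEquiv hlam h).tsum_eq, ← tsum_mul_left]
  refine tsum_congr fun l => ?_
  have e : ((scaleEquiv hlam h l : L.lattice) : ℂ) = lam * l := rfl
  have e0 : scaleEquiv hlam h l = 0 ↔ l = 0 := by
    rw [← Subtype.coe_inj, e]
    simp [hlam]
  simp only [e0, e]
  split_ifs with hl
  · simp
  · have hl' : (l : ℂ) ≠ 0 := by simpa using hl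
    rw [← mul_sub]
    simp only [one_div, mul_inv]
    field_simp

lemma E_one_scale {L M : PeriodPair} {lam : ℂ} (hlam : lam ≠ 0)
    (h : ∀ z, lam * z ∈ L.lattice ↔ z ∈ M.lattice) (z : ℂ) :
    E L.lattice 1 (lam * z) = lam⁻¹ * E M.lattice 1 z := by
  have h1 := hasContinuedValue_scale hlam h (hasContinuedValue_E_one M z)
  rw [pow_one] at h1
  exact (hasContinuedValue_E_one L _).unique h1

/-- The formula for `E₁` in terms of the Weierstrass zeta function, with a non-zero
antiholomorphic term. -/
theorem exists_E_one_eq_zetaW (L : PeriodPair) : ∃ B : ℂ, B ≠ 0 ∧ ∀ z ∉ L.lattice,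
    E L.lattice 1 z = zetaW L z - E L.lattice 2 0 * z - B * star z := by
  obtain ⟨lam, τ, hτ, hlam, -, -, h⟩ := exists_fd_basis L
  refine ⟨lam⁻¹ * (Real.pi / τ.im) * (star lam)⁻¹, ?_, fun z hz => ?_⟩
  · have h1 : (τ.im : ℂ) ≠ 0 := ofReal_ne_zero.2 hτ.ne'
    have h2 : (Real.pi : ℂ) ≠ 0 := ofReal_ne_zero.2 Real.pi_ne_zero
    have h3 : star lam ≠ 0 := star_ne_zero.2 hlam
    positivity
  · obtain ⟨w, rfl⟩ : ∃ w, z = lam * w := ⟨lam⁻¹ * z, by rw [mul_inv_cancel_left₀ hlam]⟩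
    have hw : w ∉ (tauPair τ hτ).lattice := fun hw => hz ((h w).2 hw)
    have h3 : star lam ≠ 0 := star_ne_zero.2 hlam
    rw [E_one_scale hlam h, (E_two_tau hτ).2 w hw, E_two_scale hlam h, zetaW, zetaW,
      zetaReg_scale hlam h, mul_inv, star_mul']
    field_simp

/-- A complex derivative d would satisfy d c = β c̄ in every direction c; the directions 1 and i are
compatible only if β = 0. -/
lemma eq_zero_of_differentiableAt_star {β w : ℂ} (h : DifferentiableAt ℂ (fun z => β * star z) w) :
    β = 0 := by
  have h1 := h.hasDerivAt
  set d := deriv (fun z => β * star z) w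
  have key : ∀ c : ℂ, d * c = β * star c := fun c => by
    have h2 : HasDerivAt (fun t : ℝ => w + t * c) c 0 := by
      have := ((hasDerivAt_id (0 : ℝ)).ofReal_comp.mul_const c).const_add w
      simpa using this
    have h3 : HasDerivAt (fun z => β * star z) d (w + ((0 : ℝ) : ℂ) * c) := by simpa using h1
    have h4 := h3.comp (0 : ℝ) h2
    have h5 : HasDerivAt (fun t : ℝ => β * (star w + t * star c)) (β * star c) 0 := by
      have := (((hasDerivAt_id (0 : ℝ)).ofReal_comp.mul_const (star c)).const_add
        (star w)).const_mul β
      simpa using this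
    refine h4.unique (h5.congr_of_eventuallyEq (Eventually.of_forall fun t => ?_))
    simp
  have k1 := key 1
  have k2 := key I
  simp at k1 k2
  have : (2 * β) * I = 0 := by linear_combination k2 - I * k1
  simpa using this

lemma notMem_of_mul_notMem {L : PeriodPair} {k : multiplierRing L.lattice} {w : ℂ}
    (hw : k * w ∉ L.lattice) (t : tor k) :
    Quotient.out (t : Torus L.lattice) + w ∉ L.lattice := fun h => hw (by
  have h1 := L.lattice.sub_mem (k.2 _ h) (mul_out_mem t)
  rwa [mul_add, add_sub_cancel_left] at h1)

lemma eventually_mul_notMem (L : PeriodPair) {k : ℂ} (hk : k ≠ 0) (z : ℂ) :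
    ∀ᶠ w in 𝓝[≠] z, k * w ∉ L.lattice := by
  have h2 : Tendsto (fun w => k * w) (𝓝[≠] z) (𝓝[≠] (k * z)) := by
    refine tendsto_nhdsWithin_iff.2 ⟨?_, ?_⟩
    · exact ((continuous_const.mul continuous_id).tendsto z).mono_left nhdsWithin_le_nhds
    · filter_upwards [self_mem_nhdsWithin] with w hw
      simpa [hk] using hw
  exact h2.eventually (eventually_notMem_lattice L (k * z))

/-- Insert E₁ = ζ - E₂(0) z - B z̄ into the distribution relation. The combination of zeta functions
is holomorphic, so the coefficient B(N - k k̄) of w̄ must vanish; as B ≠ 0, this counts the torsion.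
Differentiating what remains and letting w tend to 0 gives the sum of ℘. -/
theorem card_tor_and_sum_weierstrassP (L : PeriodPair) {k : multiplierRing L.lattice} (hk : k ≠ 0)
    [Fintype (tor k)] : (Fintype.card (tor k) : ℂ) = k * star (k : ℂ) ∧
      ∑ t : tor k, L.weierstrassP (Quotient.out (t : Torus L.lattice)) =
        ((k : ℂ) ^ 2 - Fintype.card (tor k)) * E L.lattice 2 0 := by
  classical
  have hk' : (k : ℂ) ≠ 0 := fun h => hk (Subtype.ext h)
  obtain ⟨B, hB, hE⟩ := exists_E_one_eq_zetaW L
  set G := E L.lattice 2 0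
  set N := Fintype.card (tor k) with hN
  set o : tor k → ℂ := fun t => Quotient.out (t : Torus L.lattice) with ho
  set H : ℂ → ℂ := fun w => ∑ t : tor k, zetaW L (o t + w) - k * zetaW L (k * w) with hH
  set C : ℂ := ∑ t : tor k, (G * o t + B * star (o t)) with hC
  have hHeq : ∀ w : ℂ, k * w ∉ L.lattice → H w = (N - (k : ℂ) ^ 2) * G * w +
      B * (N - k * star (k : ℂ)) * star w + C := fun w hw => by
    have h1 := sum_E_one_tor L hk w
    rw [hE _ hw] at h1
    have h2 : ∀ t : tor k, E L.lattice 1 (o t + w) = zetaW L (o t + w) -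
        ((G * o t + B * star (o t)) + (G * w + B * star w)) := fun t => by
      rw [hE _ (notMem_of_mul_notMem hw t), star_add]; ring
    have h3 : ∑ t : tor k, E L.lattice 1 (o t + w) = ∑ t : tor k, zetaW L (o t + w) -
        (C + N * (G * w + B * star w)) := by
      rw [Finset.sum_congr rfl fun t _ => h2 t, Finset.sum_sub_distrib, Finset.sum_add_distrib]
      simp [hC, hN, mul_add]
    change ∑ t : tor k, E L.lattice 1 (o t + w) = _ at h1
    rw [h3, star_mul'] at h1
    simp only [hH]
    linear_combination h1
  have hHd : ∀ w : ℂ, k * w ∉ L.lattice → HasDerivAt H (∑ t : tor k, -L.weierstrassP (o t + w) +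
      (k : ℂ) ^ 2 * L.weierstrassP (k * w)) w := fun w hw => by
    have h1 : HasDerivAt (fun w => ∑ t : tor k, zetaW L (o t + w))
        (∑ t : tor k, -L.weierstrassP (o t + w)) w := by
      refine HasDerivAt.fun_sum fun t _ => ?_
      exact (hasDerivAt_zetaW L (notMem_of_mul_notMem hw t)).comp_const_add (o t) w
    have h2 : HasDerivAt (fun w => zetaW L (k * w)) (-L.weierstrassP (k * w) * (k * 1)) w :=
      (hasDerivAt_zetaW L hw).comp w ((hasDerivAt_id w).const_mul (k : ℂ))
    refine (h1.sub (h2.const_mul (k : ℂ))).congr_deriv ?_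
    ring
  have hopen : ∀ w : ℂ, k * w ∉ L.lattice → ∀ᶠ v : ℂ in 𝓝 w, k * v ∉ L.lattice := fun w hw => by
    have : IsOpen {v : ℂ | (k : ℂ) * v ∉ L.lattice} :=
      L.isClosed_lattice.isOpen_compl.preimage (continuous_const.mul continuous_id)
    exact this.mem_nhds hw
  have hstar : ∀ w : ℂ, k * w ∉ L.lattice → DifferentiableAt ℂ
      (fun w => B * (N - k * star (k : ℂ)) * star w) w := fun w hw => by
    have h1 : DifferentiableAt ℂ (fun w => H w - (N - (k : ℂ) ^ 2) * G * w - C) w :=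
      ((hHd w hw).differentiableAt.sub (differentiableAt_id.const_mul _)).sub_const _
    refine h1.congr_of_eventuallyEq ?_
    filter_upwards [hopen w hw] with v hv
    rw [hHeq v hv]; ring
  obtain ⟨w₀, hw₀⟩ := (eventually_mul_notMem L hk' 0).exists
  have hNk : (N : ℂ) = k * star (k : ℂ) := by
    have := eq_zero_of_differentiableAt_star (hstar w₀ hw₀)
    exact sub_eq_zero.1 ((mul_eq_zero.1 this).resolve_left hB)
  refine ⟨hNk, ?_⟩
  have hder : ∀ w : ℂ, k * w ∉ L.lattice → ∑ t : tor k, -L.weierstrassP (o t + w) +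
      (k : ℂ) ^ 2 * L.weierstrassP (k * w) = (N - (k : ℂ) ^ 2) * G := fun w hw => by
    have h1 : HasDerivAt (fun w => (N - (k : ℂ) ^ 2) * G * w + C) ((N - (k : ℂ) ^ 2) * G * 1) w :=
      ((hasDerivAt_id w).const_mul _).add_const C
    rw [mul_one] at h1
    refine (hHd w hw).unique (h1.congr_of_eventuallyEq ?_)
    filter_upwards [hopen w hw] with v hv
    rw [hHeq v hv, hNk]; ring
  have ho0 : o 0 ∈ L.lattice := by
    rw [← toTorus_eq_zero, ho, toTorus_out]; rfl
  have hon : ∀ t : tor k, t ≠ 0 → o t ∉ L.lattice := fun t ht h => ht (by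
    rw [← toTorus_eq_zero, ho, toTorus_out] at h; exact Subtype.ext h)
  -- The double poles of k²℘(kw) and of the t = 0 term cancel, so both may be replaced by the
  -- regular part of ℘, which vanishes at 0. The value 0 of `weierstrassP` at lattice points makes
  -- the t = 0 term harmless in the final sum.
  have hlim : Tendsto (fun w => ∑ t ∈ Finset.univ.erase (0 : tor k), -L.weierstrassP (o t + w) +
      ((k : ℂ) ^ 2 * L.weierstrassPExcept 0 (k * w) - L.weierstrassPExcept 0 w)) (𝓝[≠] 0)
      (𝓝 (∑ t ∈ Finset.univ.erase (0 : tor k), -L.weierstrassP (o t) + ((k : ℂ) ^ 2 * 0 - 0))) := by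
    refine Tendsto.add (tendsto_finsetSum _ fun t ht => Tendsto.neg ?_) (Tendsto.sub
      (Tendsto.const_mul _ ?_) (tendsto_weierstrassPExcept_zero L))
    · have hc : ContinuousAt L.weierstrassP (o t + 0) := by
        rw [add_zero]
        exact (differentiableAt_weierstrassP L (hon t (Finset.ne_of_mem_erase ht))).continuousAt
      have h6 : ContinuousAt (fun u => L.weierstrassP (o t + u)) 0 :=
        ContinuousAt.comp (f := fun u => o t + u) hc (by fun_prop)
      have h7 : Tendsto (fun u => L.weierstrassP (o t + u)) (𝓝[≠] 0)
        (𝓝 (L.weierstrassP (o t + 0))) := h6.continuousWithinAt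
      rwa [add_zero] at h7
    · have h2 : Tendsto (fun w => (k : ℂ) * w) (𝓝[≠] 0) (𝓝[≠] 0) := by
        refine tendsto_nhdsWithin_iff.2 ⟨?_, ?_⟩
        · have := ((continuous_const.mul continuous_id).tendsto (0 : ℂ)).mono_left
            (nhdsWithin_le_nhds (s := {(0 : ℂ)}ᶜ)) (f := fun w => (k : ℂ) * w)
          simpa using this
        · filter_upwards [self_mem_nhdsWithin] with w hw
          simpa [hk'] using hw
      exact (tendsto_weierstrassPExcept_zero L).comp h2
  have hconst : Tendsto (fun w => ∑ t ∈ Finset.univ.erase (0 : tor k), -L.weierstrassP (o t + w) +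
      ((k : ℂ) ^ 2 * L.weierstrassPExcept 0 (k * w) - L.weierstrassPExcept 0 w)) (𝓝[≠] 0)
      (𝓝 ((N - (k : ℂ) ^ 2) * G)) := by
    refine tendsto_const_nhds.congr' ?_
    filter_upwards [eventually_mul_notMem L hk' 0, self_mem_nhdsWithin] with w hw hw0
    have hw0' : w ≠ 0 := hw0
    rw [← hder w hw, ← Finset.add_sum_erase _ _ (Finset.mem_univ (0 : tor k)),
      weierstrassPExcept_zero_eq, weierstrassPExcept_zero_eq, add_comm (o 0) w,
      weierstrassP_add_mem L ho0]
    field_simp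
    ring
  have hfin := tendsto_nhds_unique hlim hconst
  have hsplit := Finset.add_sum_erase Finset.univ (fun t : tor k => L.weierstrassP (o t))
    (Finset.mem_univ (0 : tor k))
  rw [weierstrassP_of_mem L ho0, zero_add] at hsplit
  rw [← hsplit]
  rw [Finset.sum_neg_distrib] at hfin
  linear_combination -hfin

/-! ### Dedekind sums over torsion points and the reciprocity law -/

lemma descend_E_one {Λ : Submodule ℤ ℂ} (z : ℂ) :
    descend (E Λ 1) (toTorus Λ z) = E Λ 1 z :=
  descend_toTorus (fun w _ hl => E_add_mem Λ 1 w hl) z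

lemma descend_weierstrassP (L : PeriodPair) (z : ℂ) :
    descend L.weierstrassP (toTorus L.lattice z) = L.weierstrassP z :=
  descend_toTorus (fun w _ hl => weierstrassP_add_mem L hl w) z

/-- The elliptic Dedekind sum as a sum over the torsion of the torus. -/
theorem D_eq_sum_tor {Λ : Submodule ℤ ℂ} (h : multiplierRing Λ) {k : multiplierRing Λ} (hk : k ≠ 0)
    [Fintype (tor k)] : D Λ h k =
      1 / (k : ℂ) * ∑ t : tor k, descend (E Λ 1) (h • (t : Torus Λ)) *
      descend (E Λ 1) (t : Torus Λ) := by
  have hk' : (k : ℂ) ≠ 0 := fun h => hk (Subtype.ext h)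
  unfold D
  congr 1
  rw [← finsum_eq_sum_of_fintype]
  refine (finsum_eq_of_bijective (fun t : tor k => (Submodule.Quotient.mk
    (⟨k * Quotient.out (t : Torus Λ), mul_out_mem t⟩ : Λ) : Λ ⧸ LinearMap.range (mulEnd Λ k)))
    ⟨fun t t' htt => ?_, fun μ => ?_⟩ fun t => ?_).symm
  · obtain ⟨l, hl⟩ := (Submodule.Quotient.eq _).1 htt
    have hl' : (k : ℂ) * l = k * Quotient.out (t : Torus Λ) - k * Quotient.out (t' : Torus Λ) :=
      congrArg Subtype.val hl
    have h1 : Quotient.out (t : Torus Λ) - Quotient.out (t' : Torus Λ) = l :=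
      mul_left_cancel₀ hk' (by rw [hl', mul_sub])
    refine Subtype.ext ?_
    rw [← toTorus_out (t : Torus Λ), ← toTorus_out (t' : Torus Λ), toTorus_eq, h1]
    exact l.2
  · induction μ using Submodule.Quotient.induction_on with
    | H m =>
      have hm : (k : ℂ) * ((k : ℂ)⁻¹ * m) = m := mul_inv_cancel_left₀ hk' _
      refine ⟨⟨toTorus Λ ((k : ℂ)⁻¹ * m), by rw [toTorus_mem_tor, hm]; exact m.2⟩, ?_⟩
      refine (Submodule.Quotient.eq _).2 ⟨⟨Quotient.out (toTorus Λ ((k : ℂ)⁻¹ * m)) -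
        (k : ℂ)⁻¹ * m, ?_⟩, ?_⟩
      · rw [← toTorus_eq, toTorus_out]
      · ext
        simp only [mulEnd, LinearMap.coe_mk, AddHom.coe_mk, mul_sub, hm, AddSubgroupClass.coe_sub]
  · have h1 : descend (E Λ 1) (h • (t : Torus Λ)) =
        E Λ 1 ((h : ℂ) * (k * Quotient.out (t : Torus Λ)) / k) := by
      rw [mul_left_comm, mul_div_cancel_left₀ _ hk', ← descend_E_one, ← smul_toTorus, toTorus_out]
    have h2 : descend (E Λ 1) (t : Torus Λ) = E Λ 1 ((k * Quotient.out (t : Torus Λ)) / k) := by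
      rw [mul_div_cancel_left₀ _ hk']; rfl
    rw [h1, h2]
    rfl

section
variable (L : PeriodPair)

lemma descend_zero : descend (E L.lattice 1) (0 : Torus L.lattice) = 0 ∧ descend L.weierstrassP (0 : Torus L.lattice) =
    0 := by
  have h : (0 : Torus L.lattice) = toTorus L.lattice 0 := rfl
  rw [h, descend_E_one, descend_weierstrassP, E_one_zero, L.weierstrassP_zero]
  exact ⟨rfl, rfl⟩

lemma descend_neg (x : Torus L.lattice) : descend (E L.lattice 1) (-x) = -descend (E L.lattice 1) x ∧
    descend L.weierstrassP (-x) = descend L.weierstrassP x := by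
  rw [← toTorus_out x, toTorus_neg, descend_E_one, descend_E_one, descend_weierstrassP,
    descend_weierstrassP, E_one_lattice_neg, L.weierstrassP_neg]
  exact ⟨rfl, rfl⟩

lemma descend_add_sq (u v : Torus L.lattice) (hu : u ≠ 0) (hv : v ≠ 0) (huv : u + v ≠ 0) :
    (descend (E L.lattice 1) u + descend (E L.lattice 1) v - descend (E L.lattice 1) (u + v)) ^ 2 =
      descend L.weierstrassP u + descend L.weierstrassP v + descend L.weierstrassP (u + v) := by
  rw [← toTorus_out u] at hu huv ⊢
  rw [← toTorus_out v] at hv huv ⊢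
  rw [toTorus_add] at huv ⊢
  simp only [descend_E_one, descend_weierstrassP]
  exact E_one_add_sq L (fun h => hu (toTorus_eq_zero.2 h)) (fun h => hv (toTorus_eq_zero.2 h))
    (fun h => huv (toTorus_eq_zero.2 h))

variable {L}

lemma sum_descend_tor {k : multiplierRing L.lattice} (hk : k ≠ 0) [Fintype (tor k)]
    (x : Torus L.lattice) : ∑ t : tor k, descend (E L.lattice 1) (x + (t : Torus L.lattice)) =
      k * descend (E L.lattice 1) (k • x) := by
  rw [← toTorus_out x, smul_toTorus, descend_E_one, ← sum_E_one_tor L hk]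
  refine Finset.sum_congr rfl fun t _ => ?_
  rw [← toTorus_out (t : Torus L.lattice), toTorus_add, descend_E_one, toTorus_out, add_comm]

lemma coe_ne_zero {k : multiplierRing L.lattice} (hk : k ≠ 0) : (k : ℂ) ≠ 0 :=
  fun h => hk (Subtype.ext h)

/-- The sum of `℘ - E₁²` over the torsion. -/
lemma sum_descend_sub_sq {k : multiplierRing L.lattice} (hk : k ≠ 0) [Fintype (tor k)] :
    ∑ t : tor k, (descend L.weierstrassP (t : Torus L.lattice) -
      descend (E L.lattice 1) (t : Torus L.lattice) ^ 2) =
      2 * (k / star (k : ℂ) - 1) * E L.lattice 2 0 := by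
  have hk' := coe_ne_zero hk
  have hk'' : star (k : ℂ) ≠ 0 := star_ne_zero.2 hk'
  obtain ⟨hN, hW⟩ := card_tor_and_sum_weierstrassP L hk
  have h := card_mul_sum_subgroup (e := descend (E L.lattice 1)) (p := descend L.weierstrassP)
    (descend_zero L).1 (fun x => (descend_neg L x).1) (descend_zero L).2
    (fun x => (descend_neg L x).2) (descend_add_sq L) (tor k)
  change _ = 2 * ∑ t : tor k, L.weierstrassP (Quotient.out (t : Torus L.lattice)) at h
  rw [hW, hN] at h
  apply mul_left_cancel₀ (mul_ne_zero hk' hk'')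
  rw [h]
  field_simp

/-- For coprime `h` and `k` the `hk`-torsion is the sum of the `h`-torsion and the `k`-torsion. -/
lemma sum_tor_mul {h k : multiplierRing L.lattice} (hhk : IsCoprime h k)
    [Fintype (tor h)] [Fintype (tor k)] [Fintype (tor (h * k))] (φ : Torus L.lattice → ℂ) :
    tor h ⊓ tor k = ⊥ ∧ ∑ x : tor h × tor k, φ (x.1 + x.2) = ∑ t : tor (h * k), φ t := by
  obtain ⟨a, b, hab⟩ := hhk
  have hdis : ∀ x, x ∈ tor h → x ∈ tor k → x = 0 := fun x h1 h2 => by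
    rw [mem_tor] at h1 h2
    rw [← one_smul (multiplierRing L.lattice) x, ← hab, add_smul, mul_smul, mul_smul, h1, h2,
      smul_zero, smul_zero, add_zero]
  refine ⟨(AddSubgroup.eq_bot_iff_forall _).2 fun x hx => hdis x hx.1 hx.2, ?_⟩
  refine Fintype.sum_bijective (fun x : tor h × tor k => (⟨x.1 + x.2, ?_⟩ : tor (h * k)))
    ⟨?_, ?_⟩ _ _ fun x => rfl
  · have h1 := mem_tor.1 x.1.2
    have h2 := mem_tor.1 x.2.2
    rw [mem_tor, smul_add, mul_smul, mul_smul, h2, smul_zero, add_zero, smul_comm, h1, smul_zero]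
  · rintro ⟨u, v⟩ ⟨u', v'⟩ huv
    have h1 : (u : Torus L.lattice) + v = u' + v' := congrArg Subtype.val huv
    have h2 : (u : Torus L.lattice) - u' = v' - v := by
      rw [sub_eq_sub_iff_add_eq_add, h1, add_comm]
    have h3 := hdis _ ((tor h).sub_mem u.2 u'.2) (h2 ▸ (tor k).sub_mem v'.2 v.2)
    rw [h3] at h2
    rw [Prod.mk.injEq, ← Subtype.coe_inj, ← Subtype.coe_inj]
    exact ⟨sub_eq_zero.1 h3, (sub_eq_zero.1 h2.symm).symm⟩
  · rintro ⟨x, hx⟩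
    rw [mem_tor] at hx
    refine ⟨⟨⟨(b * k) • x, ?_⟩, ⟨(a * h) • x, ?_⟩⟩, ?_⟩
    · rw [mem_tor, ← mul_smul, show h * (b * k) = b * (h * k) by ring, mul_smul, hx, smul_zero]
    · rw [mem_tor, ← mul_smul, show k * (a * h) = a * (h * k) by ring, mul_smul, hx, smul_zero]
    · ext
      simp only
      rw [← add_smul, add_comm, hab, one_smul]

/-- The reciprocity law for elliptic Dedekind sums. -/
theorem D_reciprocity {h k : multiplierRing L.lattice} (hh : h ≠ 0) (hk : k ≠ 0)
    (hhk : IsCoprime h k) : D L.lattice h k + D L.lattice k h = E L.lattice 2 0 *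
      ((h / k + k / h + 1 / (h * k) : ℂ) - star (h / k + k / h + 1 / (h * k) : ℂ)) := by
  have hh' := coe_ne_zero hh
  have hk' := coe_ne_zero hk
  have hh'' : star (h : ℂ) ≠ 0 := star_ne_zero.2 hh'
  have hk'' : star (k : ℂ) ≠ 0 := star_ne_zero.2 hk'
  have := finite_tor L hh
  have := finite_tor L hk
  have := finite_tor L (mul_ne_zero hh hk)
  let _ := Fintype.ofFinite (tor h)
  let _ := Fintype.ofFinite (tor k)
  let _ := Fintype.ofFinite (tor (h * k))
  obtain ⟨hdis, hsum⟩ := sum_tor_mul hhk (fun x => descend L.weierstrassP x -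
    descend (E L.lattice 1) x ^ 2)
  have hmain := sum_sum_disjoint_subgroups (e := descend (E L.lattice 1))
    (p := descend L.weierstrassP) (descend_zero L).1 (fun x => (descend_neg L x).1)
    (descend_zero L).2 (fun x => (descend_neg L x).2) (descend_add_sq L) (tor h) (tor k) hdis
  rw [hsum, sum_descend_sub_sq hh, sum_descend_sub_sq hk, sum_descend_sub_sq (mul_ne_zero hh hk)]
    at hmain
  obtain ⟨hNh, hWh⟩ := card_tor_and_sum_weierstrassP L hh
  obtain ⟨hNk, hWk⟩ := card_tor_and_sum_weierstrassP L hk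
  change ∑ t : tor h, descend L.weierstrassP (t : Torus L.lattice) = _ at hWh
  change ∑ t : tor k, descend L.weierstrassP (t : Torus L.lattice) = _ at hWk
  rw [hWh, hWk, hNh, hNk] at hmain
  -- The distribution relation evaluates ∑ e(u + v) over the k-torsion as k e(ku), so the cross
  -- terms become multiples of D(k,h) and D(h,k).
  simp only [sum_descend_tor hh, sum_descend_tor hk, mul_assoc, ← Finset.mul_sum] at hmain
  have hD1 : ∑ t : tor k, descend (E L.lattice 1) (h • (t : Torus L.lattice)) *
      descend (E L.lattice 1) (t : Torus L.lattice) = k * D L.lattice h k := by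
    rw [D_eq_sum_tor h hk, ← mul_assoc, mul_one_div_cancel hk', one_mul]
  have hD2 : ∑ t : tor h, descend (E L.lattice 1) (k • (t : Torus L.lattice)) *
      descend (E L.lattice 1) (t : Torus L.lattice) = h * D L.lattice k h := by
    rw [D_eq_sum_tor k hh, ← mul_assoc, mul_one_div_cancel hh', one_mul]
  rw [hD1, hD2] at hmain
  have hne : (-2 * (h * k) : ℂ) ≠ 0 := mul_ne_zero (by norm_num) (mul_ne_zero hh' hk')
  apply mul_left_cancel₀ hne
  refine Eq.trans (by ring) (hmain.trans ?_)
  simp only [star_add, star_div₀, star_mul', star_one, Subring.coe_mul]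
  field_simp
  ring

/-- `D(q, p)` vanishes if `p` divides `1 + q²`. -/
theorem D_eq_zero_of_mul_eq {p q r : multiplierRing L.lattice} (hp : p ≠ 0)
    (h : p * r = 1 + q ^ 2) : D L.lattice q p = 0 := by
  have := finite_tor L hp
  let _ := Fintype.ofFinite (tor p)
  rw [D_eq_sum_tor q hp]
  -- On the p-torsion q² acts as -1, so t ↦ qt is a permutation. It sends e(qt)e(t) to e(-t)e(qt),
  -- that is to its negative.
  have hq : ∀ t ∈ tor p, q • q • t = -t := fun t ht => by
    have h1 : (p * r) • t = 0 := by rw [mul_comm, mul_smul, mem_tor.1 ht, smul_zero]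
    rw [h, add_smul, one_smul, pow_two, mul_smul] at h1
    exact eq_neg_of_add_eq_zero_right h1
  have hmem : ∀ t ∈ tor p, q • t ∈ tor p := fun t ht => by
    rw [mem_tor, smul_comm, mem_tor.1 ht, smul_zero]
  let φ : tor p ≃ tor p :=
    { toFun := fun t => ⟨q • (t : Torus L.lattice), hmem t t.2⟩
      invFun := fun t => ⟨-(q • (t : Torus L.lattice)), (tor p).neg_mem (hmem t t.2)⟩
      left_inv := fun t => by ext; simp [hq t t.2]
      right_inv := fun t => by ext; simp [hq t t.2] }
  have h1 := Equiv.sum_comp φ fun t : tor p =>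
    descend (E L.lattice 1) (q • (t : Torus L.lattice)) * descend (E L.lattice 1) (t : Torus L.lattice)
  have h2 : ∑ t : tor p, descend (E L.lattice 1) (q • (φ t : Torus L.lattice)) *
      descend (E L.lattice 1) (φ t : Torus L.lattice) = -∑ t : tor p,
        descend (E L.lattice 1) (q • (t : Torus L.lattice)) * descend (E L.lattice 1) (t : Torus L.lattice) := by
    rw [← Finset.sum_neg_distrib]
    refine Finset.sum_congr rfl fun t _ => ?_
    change descend (E L.lattice 1) (q • q • (t : Torus L.lattice)) *
      descend (E L.lattice 1) (q • (t : Torus L.lattice)) = _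
    rw [hq t t.2, (descend_neg L _).1]
    ring
  rw [h2] at h1
  rw [show ∑ t : tor p, descend (E L.lattice 1) (q • (t : Torus L.lattice)) *
      descend (E L.lattice 1) (t : Torus L.lattice) = 0 by linear_combination (-1 / 2 : ℂ) * h1, mul_zero]

/-- Reciprocity with the companion sum equal to 0; the relation p r = 1 + q² collapses p/q + q/p +
1/(pq) to (p+r)/q. -/
theorem D_eq_of_mul_eq {p q r : multiplierRing L.lattice} (hp : p ≠ 0) (hq : q ≠ 0)
    (h : p * r = 1 + q ^ 2) : D L.lattice p q =
      E L.lattice 2 0 * (2 * I * (((p + r : ℂ) / q).im : ℂ)) := by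
  have hp' := coe_ne_zero hp
  have hq' := coe_ne_zero hq
  have hco : IsCoprime p q := ⟨r, -q, by linear_combination h⟩
  have h1 := D_reciprocity hp hq hco
  rw [D_eq_zero_of_mul_eq hp h, add_zero] at h1
  have h' : (p : ℂ) * r = 1 + q ^ 2 := congrArg Subtype.val h
  have h2 : (p / q + q / p + 1 / (p * q) : ℂ) = (p + r) / q := by
    field_simp
    linear_combination -h'
  rw [h1, h2]
  congr 1
  rw [Complex.star_def, Complex.sub_conj]
  push_cast
  ring

end

/-! ### Density of the values -/

lemma normalizedD_eq_of_mul_eq {L : PeriodPair} (hE : E L.lattice 2 0 ≠ 0) {d : ℤ} (hd : d ≠ 0)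
    {p q r : multiplierRing L.lattice} (hp : p ≠ 0) (hq : q ≠ 0) (h : p * r = 1 + q ^ 2) :
    normalizedD L.lattice d p q = ((2 / Real.sqrt |(d : ℝ)| * ((p + r : ℂ) / q).im : ℝ) : ℂ) := by
  have hs : (Real.sqrt |(d : ℝ)| : ℂ) ≠ 0 := by
    rw [ofReal_ne_zero]
    have : (d : ℝ) ≠ 0 := by exact_mod_cast hd
    positivity
  rw [normalizedD, D_eq_of_mul_eq hp hq h]
  push_cast
  field_simp

/-- The values of the normalized elliptic Dedekind sums accumulate at the numbers
`2 / √|d| · Im (a / c + c / a)`. -/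
lemma mem_closure_of_coprime {L : PeriodPair} (hE : E L.lattice 2 0 ≠ 0) {d : ℤ} (hd : d ≠ 0)
    {a c : multiplierRing L.lattice} (ha : a ≠ 0) (hc : c ≠ 0) (hac : IsCoprime a c) :
    2 / Real.sqrt |(d : ℝ)| * ((a : ℂ) / c + c / a).im ∈
      closure {x : ℝ | ∃ a c : multiplierRing L.lattice, c ≠ 0 ∧
        normalizedD L.lattice d a c = (x : ℂ)} := by
  obtain ⟨u, v, huv⟩ := hac
  have ha' := coe_ne_zero ha
  have hc' := coe_ne_zero hc
  set b : ℕ → multiplierRing L.lattice := fun M => -v + M * a with hb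
  set e : ℕ → multiplierRing L.lattice := fun M => u + M * c with he
  have hae : ∀ M, a * e M - b M * c = 1 := fun M => by
    simp only [hb, he]; linear_combination huv
  -- With γ the matrix with rows (a, b) and (c, e), of determinant 1, the numbers p, q, r are the
  -- entries of γγᵀ, and p r - q² = 1 is its determinant. Growing M adds multiples of (a, c) to the
  -- second column.
  set p : ℕ → multiplierRing L.lattice := fun M => a ^ 2 + b M ^ 2 with hp
  set q : ℕ → multiplierRing L.lattice := fun M => a * c + b M * e M with hq
  set r : ℕ → multiplierRing L.lattice := fun M => c ^ 2 + e M ^ 2 with hr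
  have hpr : ∀ M, p M * r M = 1 + q M ^ 2 := fun M => by
    have := hae M
    simp only [hp, hq, hr]
    linear_combination (a * e M - b M * c + 1) * this
  have hinv : Tendsto (fun M : ℕ => ((M : ℂ))⁻¹) atTop (𝓝 0) := tendsto_inv_atTop_nhds_zero_nat
  have hbl : Tendsto (fun M : ℕ => ((M : ℂ))⁻¹ * b M) atTop (𝓝 a) := by
    have h1 := (hinv.mul_const (-(v : ℂ))).add_const (a : ℂ)
    rw [zero_mul, zero_add] at h1
    refine h1.congr' ?_
    filter_upwards [eventually_ne_atTop 0] with M hM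
    have hM' : (M : ℂ) ≠ 0 := by exact_mod_cast hM
    simp only [hb]
    push_cast
    field_simp
  have hel : Tendsto (fun M : ℕ => ((M : ℂ))⁻¹ * e M) atTop (𝓝 c) := by
    have h1 := (hinv.mul_const (u : ℂ)).add_const (c : ℂ)
    rw [zero_mul, zero_add] at h1
    refine h1.congr' ?_
    filter_upwards [eventually_ne_atTop 0] with M hM
    have hM' : (M : ℂ) ≠ 0 := by exact_mod_cast hM
    simp only [he]
    push_cast
    field_simp
  have hpl : Tendsto (fun M : ℕ => ((M : ℂ))⁻¹ ^ 2 * p M) atTop (𝓝 ((a : ℂ) ^ 2)) := by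
    have h1 := ((hinv.pow 2).mul_const ((a : ℂ) ^ 2)).add (hbl.pow 2)
    rw [show (0 : ℂ) ^ 2 * (a : ℂ) ^ 2 + (a : ℂ) ^ 2 = (a : ℂ) ^ 2 by ring] at h1
    refine h1.congr fun M => ?_
    simp only [hp]; push_cast; ring
  have hrl : Tendsto (fun M : ℕ => ((M : ℂ))⁻¹ ^ 2 * r M) atTop (𝓝 ((c : ℂ) ^ 2)) := by
    have h1 := ((hinv.pow 2).mul_const ((c : ℂ) ^ 2)).add (hel.pow 2)
    rw [show (0 : ℂ) ^ 2 * (c : ℂ) ^ 2 + (c : ℂ) ^ 2 = (c : ℂ) ^ 2 by ring] at h1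
    refine h1.congr fun M => ?_
    simp only [hr]; push_cast; ring
  have hql : Tendsto (fun M : ℕ => ((M : ℂ))⁻¹ ^ 2 * q M) atTop (𝓝 ((a : ℂ) * c)) := by
    have h1 := ((hinv.pow 2).mul_const ((a : ℂ) * c)).add (hbl.mul hel)
    rw [show (0 : ℂ) ^ 2 * ((a : ℂ) * c) + a * c = a * c by ring] at h1
    refine h1.congr fun M => ?_
    simp only [hq]; push_cast; ring
  have hac' : (a : ℂ) * c ≠ 0 := mul_ne_zero ha' hc'
  -- After division by M² the entries p, q, r tend to a², ac, c², so (p+r)/q tends to (a² +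
  -- c²)/(ac).
  have hquot : Tendsto (fun M : ℕ => ((p M + r M : ℂ) / q M)) atTop (𝓝 ((a : ℂ) / c + c / a)) := by
    have h1 := (hpl.add hrl).div hql hac'
    rw [show ((a : ℂ) ^ 2 + c ^ 2) / (a * c) = a / c + c / a by field_simp] at h1
    refine h1.congr' ?_
    filter_upwards [eventually_ne_atTop 0] with M hM
    have hM' : ((M : ℂ))⁻¹ ^ 2 ≠ 0 := pow_ne_zero _ (inv_ne_zero (by exact_mod_cast hM))
    simp only [Pi.div_apply]
    rw [← mul_add, mul_div_mul_left _ _ hM']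
  refine mem_closure_of_tendsto ((Complex.continuous_im.tendsto _).comp hquot |>.const_mul
    (2 / Real.sqrt |(d : ℝ)|)) ?_
  filter_upwards [hpl.eventually_ne (pow_ne_zero 2 ha'), hql.eventually_ne hac'] with M hM1 hM2
  have hp0 : p M ≠ 0 := fun h => hM1 (by rw [h]; simp)
  have hq0 : q M ≠ 0 := fun h => hM2 (by rw [h]; simp)
  exact ⟨p M, q M, hq0, normalizedD_eq_of_mul_eq hE hd hp0 hq0 (hpr M)⟩

lemma coe_two {Λ : Submodule ℤ ℂ} : ((2 : multiplierRing Λ) : ℂ) = 2 := rfl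

/-- The quotients `(1 + 2 x) / 2ⁿ` with `x` in the ring accumulate everywhere. -/
lemma exists_tendsto_div {L : PeriodPair} {ω : ℂ} (hω : ω ∈ multiplierRing L.lattice)
    (hωi : ω.im ≠ 0) (z : ℂ) : ∃ x : ℕ → multiplierRing L.lattice,
      Tendsto (fun n => ((1 + 2 * x n : multiplierRing L.lattice) : ℂ) / 2 ^ n) atTop (𝓝 z) := by
  set v : ℝ := z.im / ω.im with hv
  set u : ℝ := z.re - v * ω.re with hu
  have hz : z = u + v * ω := by
    apply Complex.ext
    · simp [hu]
    · simp [hv, hωi]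
  -- The coordinates of z are halved to absorb the factor 2 in 1 + 2x; the summand 1 is negligible
  -- after division by 2ⁿ.
  refine ⟨fun n => (⌊(2 : ℝ) ^ n * (u / 2)⌋ : ℤ) + (⌊(2 : ℝ) ^ n * (v / 2)⌋ : ℤ) * ⟨ω, hω⟩, ?_⟩
  have hfl : ∀ x : ℝ, Tendsto (fun n : ℕ => ((⌊(2 : ℝ) ^ n * x⌋ : ℤ) : ℂ) / 2 ^ n) atTop
      (𝓝 (x : ℂ)) := fun x => by
    have h1 : Tendsto (fun n : ℕ => ((⌊(2 : ℝ) ^ n * x⌋ : ℤ) : ℝ) / 2 ^ n) atTop (𝓝 x) := by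
      have hp : Tendsto (fun n : ℕ => (1 / 2 : ℝ) ^ n) atTop (𝓝 0) :=
        tendsto_pow_atTop_nhds_zero_of_lt_one (by norm_num) (by norm_num)
      refine tendsto_of_tendsto_of_tendsto_of_le_of_le (g := fun n : ℕ => x - (1 / 2 : ℝ) ^ n)
        (h := fun _ => x) (by simpa using hp.const_sub x) tendsto_const_nhds (fun n => ?_)
        fun n => ?_
      · have h2 := Int.lt_floor_add_one ((2 : ℝ) ^ n * x)
        simp only [div_pow, one_pow]
        rw [le_div_iff₀ (by positivity), sub_mul, one_div_mul_cancel (by positivity)]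
        linarith
      · have h2 := Int.floor_le ((2 : ℝ) ^ n * x)
        simp only
        rw [div_le_iff₀ (by positivity)]
        linarith
    have h3 := (Complex.continuous_ofReal.tendsto x).comp h1
    refine h3.congr fun n => ?_
    simp
  have hpow : Tendsto (fun n : ℕ => (1 : ℂ) / 2 ^ n) atTop (𝓝 0) := by
    have := tendsto_pow_atTop_nhds_zero_of_norm_lt_one (x := (1 / 2 : ℂ)) (by norm_num)
    refine this.congr fun n => ?_
    rw [div_pow, one_pow]
  have h := hpow.add (((hfl (u / 2)).add ((hfl (v / 2)).mul_const ω)).const_mul 2)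
  have e : (0 : ℂ) + 2 * (((u / 2 : ℝ) : ℂ) + ((v / 2 : ℝ) : ℂ) * ω) = z := by
    rw [hz]; push_cast; ring
  rw [e] at h
  refine h.congr fun n => ?_
  push_cast
  rw [coe_two]
  ring

/-- The values of the normalized elliptic Dedekind sums are dense. -/
theorem dense_normalizedD {L : PeriodPair} (hE : E L.lattice 2 0 ≠ 0) {d : ℤ} (hd : d ≠ 0)
    {ω : ℂ} (hω : ω ∈ multiplierRing L.lattice) (hωi : ω.im ≠ 0) :
    Dense {x : ℝ | ∃ a c : multiplierRing L.lattice, c ≠ 0 ∧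
      normalizedD L.lattice d a c = (x : ℂ)} := by
  intro y
  set s : ℝ := Real.sqrt |(d : ℝ)| with hs
  have hs0 : 0 < s := by
    have : (d : ℝ) ≠ 0 := by exact_mod_cast hd
    positivity
  -- Im(it + 1/(it)) = t - 1/t, so the target y is reached at z = it with t the positive root of t²
  -- - (sy/2) t - 1 = 0.
  obtain ⟨t, ht, htt⟩ : ∃ t : ℝ, 0 < t ∧ t - 1 / t = s * y / 2 := by
    set m := s * y / 2
    have h4 : |m| < Real.sqrt (m ^ 2 + 4) := by
      rw [← Real.sqrt_sq_eq_abs]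
      exact Real.sqrt_lt_sqrt (sq_nonneg m) (by linarith)
    have h5 := Real.sq_sqrt (show 0 ≤ m ^ 2 + 4 by positivity)
    have h6 := neg_abs_le m
    have h7 : 0 < m + Real.sqrt (m ^ 2 + 4) := by linarith
    refine ⟨(m + Real.sqrt (m ^ 2 + 4)) / 2, by positivity, ?_⟩
    field_simp
    nlinarith
  have ht0 : (t : ℂ) ≠ 0 := ofReal_ne_zero.2 ht.ne'
  set z : ℂ := t * I with hz
  have hz0 : z ≠ 0 := mul_ne_zero ht0 I_ne_zero
  obtain ⟨x, hx⟩ := exists_tendsto_div hω hωi z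
  have hlim : Tendsto (fun n => 2 / s * (((1 + 2 * x n : multiplierRing L.lattice) : ℂ) / 2 ^ n +
      2 ^ n / ((1 + 2 * x n : multiplierRing L.lattice) : ℂ)).im) atTop (𝓝 y) := by
    have h1 := ((Complex.continuous_im.tendsto _).comp (hx.add (hx.inv₀ hz0))).const_mul (2 / s)
    have e : 2 / s * (z + z⁻¹).im = y := by
      have : z⁻¹ = -((1 / t : ℝ) : ℂ) * I := by
        rw [hz, mul_inv, inv_I]; push_cast; ring
      rw [this, hz, add_im, neg_mul, neg_im, im_ofReal_mul, im_ofReal_mul, I_im, mul_one, mul_one,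
        ← sub_eq_add_neg, htt]
      field_simp
    rw [e] at h1
    refine h1.congr fun n => ?_
    simp only [Function.comp, inv_div]
  rw [← closure_closure]
  refine mem_closure_of_tendsto hlim ?_
  filter_upwards [hx.eventually_ne hz0] with n hn
  have h2 : (2 : multiplierRing L.lattice) ≠ 0 := fun h => two_ne_zero (α := ℂ) (congrArg Subtype.val h)
  -- An element 1 + 2x is coprime to 2, hence to 2ⁿ, in any commutative ring; no class group
  -- argument is needed.
  have h3 := mem_closure_of_coprime hE hd (a := 1 + 2 * x n) (c := 2 ^ n)
    (fun h => hn (by rw [h]; simp)) (pow_ne_zero n h2) (IsCoprime.pow_right ⟨1, -x n, by ring⟩)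
  rwa [Subring.coe_pow, coe_two] at h3

/-! ### Complex conjugation and reality of the normalized sums -/

/-- The complex conjugate of a lattice. -/
def conjPair (L : PeriodPair) : PeriodPair where
  ω₁ := star L.ω₁
  ω₂ := star L.ω₂
  indep := by
    have h := L.indep.map' (conjLIE.toLinearEquiv : ℂ →ₗ[ℝ] ℂ) (LinearEquiv.ker _)
    have e : ![star L.ω₁, star L.ω₂] =
        (conjLIE.toLinearEquiv : ℂ →ₗ[ℝ] ℂ) ∘ ![L.ω₁, L.ω₂] := by
      funext i
      fin_cases i <;> rfl
    rw [e]
    exact h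

lemma mem_conjPair {L : PeriodPair} {z : ℂ} : z ∈ (conjPair L).lattice ↔ star z ∈ L.lattice := by
  simp only [PeriodPair.mem_lattice]
  refine exists_congr fun m => exists_congr fun n => ?_
  rw [← star_inj]
  simp [conjPair]

/-- Conjugation as a bijection between a lattice and its conjugate. -/
def conjEquiv (L : PeriodPair) : L.lattice ≃ (conjPair L).lattice where
  toFun l := ⟨star (l : ℂ), by rw [mem_conjPair, star_star]; exact l.2⟩
  invFun l := ⟨star (l : ℂ), mem_conjPair.1 l.2⟩
  left_inv l := by ext; simp
  right_inv l := by ext; simp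

lemma eisensteinSeries_conj (L : PeriodPair) (k : ℕ) (z s : ℂ) :
    eisensteinSeries (conjPair L).lattice k (star z) (star s) =
      star (eisensteinSeries L.lattice k z s) := by
  unfold eisensteinSeries
  rw [tsum_star, ← (conjEquiv L).tsum_eq]
  refine tsum_congr fun l => ?_
  have e : ((conjEquiv L l : (conjPair L).lattice) : ℂ) = star (l : ℂ) := rfl
  simp only [e, ← star_add, star_eq_zero, norm_star]
  split_ifs with h
  · simp
  · rw [star_mul', star_inv₀, star_pow, ← star_neg]
    congr 1
    have := Complex.cpow_conj ((‖(l : ℂ) + z‖ : ℝ) : ℂ) (-s) (by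
      rw [arg_ofReal_of_nonneg (norm_nonneg _)]; exact Real.pi_ne_zero.symm)
    rw [conj_ofReal] at this
    exact this

lemma HasContinuedValueAtZero.conj {f g : ℂ → ℂ} {v : ℂ} (h : HasContinuedValueAtZero f v)
    (hg : ∀ s, g (star s) = star (f s)) : HasContinuedValueAtZero g (star v) := by
  obtain ⟨ε, hε, F, hF, hFf, rfl⟩ := h
  have hopen : IsOpen {s : ℂ | -ε < s.re} := isOpen_lt continuous_const continuous_re
  refine ⟨ε, hε, fun s => star (F (star s)), fun s hs => ?_, fun s hs => ?_, by simp⟩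
  · have hs' : star s ∈ {s : ℂ | -ε < s.re} := by simpa using hs
    have h1 := (hF.differentiableAt (hopen.mem_nhds hs')).conj_conj
    have h2 : (starRingEnd ℂ) (star s) = s := by simp
    rw [h2] at h1
    exact h1.differentiableWithinAt
  · have h1 := hFf (star s) (by simpa using hs)
    have h2 := hg (star s)
    rw [star_star] at h2
    simp only [h1, h2]

lemma E_one_conj (L : PeriodPair) (z : ℂ) :
    E (conjPair L).lattice 1 (star z) = star (E L.lattice 1 z) :=
  (hasContinuedValue_E_one _ _).unique
    ((hasContinuedValue_E_one L z).conj fun s => eisensteinSeries_conj L 1 z s)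

lemma E_two_conj (L : PeriodPair) :
    E (conjPair L).lattice 2 0 = star (E L.lattice 2 0) := by
  obtain ⟨-, h1, -⟩ := exists_E_one_formula L
  obtain ⟨-, h2, -⟩ := exists_E_one_formula (conjPair L)
  refine h2.unique (h1.conj fun s => ?_)
  have := eisensteinSeries_conj L 2 0 s
  rwa [star_zero] at this

lemma pairing_congr {L : PeriodPair} {β : ℝ}
    (hβ : ∀ l ∈ L.lattice, ∀ m ∈ L.lattice, pairing β l m = 1) {c w z z' : ℂ}
    (hw : star c * w ∈ L.lattice) (hz : z - z' ∈ L.lattice) :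
    pairing β (c * z) w = pairing β (c * z') w := by
  rw [show c * z = c * z' + c * (z - z') by ring, pairing_add_left, pairing_mul_left _ c (z - z'),
    hβ _ hz _ hw, mul_one]

/-- Conjugating both arguments of an elliptic Dedekind sum changes its sign. -/
theorem D_conj_conj (L : PeriodPair) {a c a' c' : multiplierRing L.lattice} (hc : c ≠ 0)
    (ha' : (a' : ℂ) = star (a : ℂ)) (hc' : (c' : ℂ) = star (c : ℂ)) :
    D L.lattice a' c' = -D L.lattice a c := by
  obtain ⟨β, hβ, -, hE⟩ := exists_pairing L
  have hcc := coe_ne_zero hc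
  have hcc' : (c' : ℂ) ≠ 0 := by rw [hc']; exact star_ne_zero.2 hcc
  have hc0' : c' ≠ 0 := fun h => hcc' (by rw [h]; rfl)
  have := finite_tor L hc
  have := finite_tor L hc0'
  let _ := Fintype.ofFinite (tor c)
  let _ := Fintype.ofFinite (tor c')
  set o : Torus L.lattice → ℂ := fun t => Quotient.out t with ho
  set e := E L.lattice 1 with he
  have hsmul : ∀ (b : multiplierRing L.lattice) (t : Torus L.lattice),
      descend e (b • t) = e (b * o t) := fun b t => by
    rw [he, ← descend_E_one, ← smul_toTorus, toTorus_out]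
  -- For t in the c-torsion, multiplication by c = conj(c') sends a · t into the lattice, so E₁
  -- there has a Fourier expansion over the c'-torsion. The roles of c and c' are exchanged in `h2`.
  have h1 : ∀ t : tor c, c' * e (a * o t) =
      ∑ u : tor c', pairing β (c' * o u) (a * o t) * e (o u) := fun t =>
    E_one_fourier L hβ (fun w => (hE w).2) hc0' (by
      rw [hc', star_star, mul_left_comm]; exact a.2 _ (mul_out_mem t))
  have h2 : ∀ u : tor c', c * e (a' * o u) =
      -∑ t : tor c, pairing β (c * -o t) (a' * o u) * e (o t) := fun u => by
    have hw : star (c : ℂ) * (a' * o u) ∈ L.lattice := by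
      rw [← hc', mul_left_comm]; exact a'.2 _ (mul_out_mem u)
    rw [he, E_one_fourier L hβ (fun w => (hE w).2) hc hw, ← Equiv.sum_comp (Equiv.neg (tor c)),
      ← Finset.sum_neg_distrib]
    refine Finset.sum_congr rfl fun t _ => ?_
    simp only [Equiv.neg_apply, AddSubgroup.coe_neg]
    have h3 : Quotient.out (-(t : Torus L.lattice)) - -o t ∈ L.lattice := by
      rw [← toTorus_eq, toTorus_out, ← toTorus_neg, toTorus_out]
    rw [pairing_congr hβ hw h3]
    have h4 := (descend_neg L (t : Torus L.lattice)).1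
    change E L.lattice 1 (Quotient.out (-(t : Torus L.lattice))) = -E L.lattice 1 (o t) at h4
    rw [h4]
    ring
  -- Multipliers pass to the other argument of the pairing as their conjugates, and exchanging the
  -- arguments costs a sign. That sign is the one in D(ā, c̄) = -D(a,c).
  have h3 : ∀ (t : tor c) (u : tor c'), pairing β (c' * o u) (a * o t) =
      pairing β (c * -o t) (a' * o u) := fun t u => by
    have e1 : pairing β (c' * o u) (a * o t) = pairing β (a' * (c' * o u)) (o t) := by
      rw [pairing_mul_left β (a' : ℂ), ha', star_star]
    have e2 : pairing β (a' * (c' * o u)) (o t) = pairing β (a' * o u) (c * o t) := by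
      rw [show (a' : ℂ) * (c' * o u) = c' * (a' * o u) by ring, pairing_mul_left, hc', star_star]
    rw [e1, e2, pairing_swap, mul_neg]
  rw [D_eq_sum_tor a' hc0', D_eq_sum_tor a hc]
  -- Both sides are the same double sum of ψ · E₁(u) · E₁(t) over the two torsion groups, summed in
  -- opposite orders.
  have hkey : c' * ∑ t : tor c, descend e (a • (t : Torus L.lattice)) *
      descend e (t : Torus L.lattice) = -(c * ∑ u : tor c', descend e (a' • (u : Torus L.lattice)) *
      descend e (u : Torus L.lattice)) := by
    rw [Finset.mul_sum, Finset.mul_sum, ← Finset.sum_neg_distrib]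
    have e1 : ∀ t : tor c, (c' : ℂ) * (descend e (a • (t : Torus L.lattice)) *
        descend e (t : Torus L.lattice)) =
        ∑ u : tor c', pairing β (c * -o t) (a' * o u) * e (o u) * e (o t) := fun t => by
      rw [hsmul, ← mul_assoc, h1, Finset.sum_mul]
      exact Finset.sum_congr rfl fun u _ => by rw [h3]; rfl
    have e2 : ∀ u : tor c', -((c : ℂ) * (descend e (a' • (u : Torus L.lattice)) *
        descend e (u : Torus L.lattice))) =
        ∑ t : tor c, pairing β (c * -o t) (a' * o u) * e (o u) * e (o t) := fun u => by
      rw [hsmul, ← mul_assoc, h2, neg_mul, neg_neg, Finset.sum_mul]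
      exact Finset.sum_congr rfl fun t _ => by
        change _ * e (o u) = _
        ring
    rw [Finset.sum_congr rfl fun t _ => e1 t, Finset.sum_congr rfl fun u _ => e2 u,
      Finset.sum_comm]
  simp only [← he]
  field_simp
  linear_combination hkey

/-- If the conjugate of `Λ` is similar to `Λ`, then the normalized elliptic Dedekind sums are
real. -/
theorem normalizedD_real (L : PeriodPair) {μ : ℂ} (hμ : μ ≠ 0)
    (h : ∀ z, μ * z ∈ L.lattice ↔ star z ∈ L.lattice) (d : ℤ) {a c : multiplierRing L.lattice}
    (hc : c ≠ 0) : ∃ x : ℝ, normalizedD L.lattice d a c = (x : ℂ) := by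
  have hsc : ∀ z, μ * z ∈ L.lattice ↔ z ∈ (conjPair L).lattice := fun z => by
    rw [h, mem_conjPair]
  have hstar : ∀ m ∈ multiplierRing L.lattice, star m ∈ multiplierRing L.lattice := fun m hm l hl => by
    have h1 : star (μ⁻¹ * l) ∈ L.lattice := by rw [← h, mul_inv_cancel_left₀ hμ]; exact hl
    have h2 := hm _ h1
    rw [show m * star (μ⁻¹ * l) = star (star m * (μ⁻¹ * l)) by simp, ← h] at h2
    rwa [mul_left_comm, mul_inv_cancel_left₀ hμ] at h2
  set a' : multiplierRing L.lattice := ⟨star (a : ℂ), hstar a a.2⟩ with ha'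
  set c' : multiplierRing L.lattice := ⟨star (c : ℂ), hstar c c.2⟩ with hc'
  have hcc := coe_ne_zero hc
  have hc0' : c' ≠ 0 := fun h0 => by
    have h1 : star (c : ℂ) = 0 := congrArg Subtype.val h0
    exact hcc (star_eq_zero.1 h1)
  have := finite_tor L hc
  have := finite_tor L hc0'
  let _ := Fintype.ofFinite (tor c)
  let _ := Fintype.ofFinite (tor c')
  -- Conjugation passes to the conjugate lattice, and the homothety μ brings the value back to L.
  have hE1 : ∀ z, star (E L.lattice 1 z) = μ * E L.lattice 1 (μ * star z) := fun z => by
    rw [E_one_scale hμ hsc, mul_inv_cancel_left₀ hμ, E_one_conj]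
  have hE2 : star (E L.lattice 2 0) = μ ^ 2 * E L.lattice 2 0 := by
    conv_rhs => rw [E_two_scale hμ hsc, E_two_conj, mul_inv_cancel_left₀ (pow_ne_zero 2 hμ)]
  have hmem : ∀ {b b' : multiplierRing L.lattice}, (b' : ℂ) = star (b : ℂ) → ∀ z : ℂ,
      b * z ∈ L.lattice → b' * (μ * star z) ∈ L.lattice := fun {b b'} hb z hz => by
    rw [mul_left_comm, h, star_mul', star_star, hb, star_star]
    exact hz
  -- The map z ↦ μ z̄ carries the c-torsion bijectively to the c̄-torsion and intertwines a with ā.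
  have hDc : star (D L.lattice a c) = μ ^ 2 * D L.lattice a' c' := by
    rw [D_eq_sum_tor a hc, D_eq_sum_tor a' hc0', star_mul', star_sum, star_div₀, star_one,
      mul_left_comm]
    congr 1
    rw [Finset.mul_sum]
    refine Fintype.sum_bijective (fun t : tor c => (⟨toTorus L.lattice (μ * star
      (Quotient.out (t : Torus L.lattice))), ?_⟩ : tor c')) ⟨fun t t' htt => ?_, fun u => ?_⟩ _ _
      fun t => ?_
    · rw [toTorus_mem_tor]
      exact hmem rfl _ (mul_out_mem t)
    · have h1 := toTorus_eq.1 (congrArg Subtype.val htt)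
      rw [← mul_sub, ← star_sub, h, star_star, ← toTorus_eq, toTorus_out, toTorus_out] at h1
      exact Subtype.ext h1
    · set z := star (μ⁻¹ * Quotient.out (u : Torus L.lattice)) with hz
      have hz2 : μ * star z = Quotient.out (u : Torus L.lattice) := by
        rw [hz, star_star, mul_inv_cancel_left₀ hμ]
      have hzm : c * z ∈ L.lattice := by
        have h1 := mul_out_mem u
        rw [← hz2, mul_left_comm, h, star_mul', star_star] at h1
        simpa [hc'] using h1
      refine ⟨⟨toTorus L.lattice z, toTorus_mem_tor.2 hzm⟩, Subtype.ext ?_⟩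
      rw [← toTorus_out (u : Torus L.lattice), ← hz2]
      simp only
      rw [toTorus_eq, ← mul_sub, ← star_sub, h, star_star, ← toTorus_eq, toTorus_out]
    · rw [star_mul', smul_toTorus, descend_E_one, descend_E_one,
        ← toTorus_out (t : Torus L.lattice), smul_toTorus, descend_E_one, descend_E_one,
        hE1, hE1, toTorus_out]
      simp only [star_mul', ha']
      rw [mul_left_comm (star (a : ℂ))]
      ring
  have hD := D_conj_conj L hc (a := a) (a' := a') (c' := c') rfl rfl
  refine Complex.conj_eq_iff_real.1 ?_
  have e : (starRingEnd ℂ) (normalizedD L.lattice d a c) =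
      (-I * (Real.sqrt |(d : ℝ)| : ℂ) * star (E L.lattice 2 0))⁻¹ * star (D L.lattice a c) := by
    simp [normalizedD]
  rw [e, hDc, hE2, hD, normalizedD]
  -- If the normalizing factor is 0, its inverse is 0 by convention and so is the value. Otherwise
  -- μ² cancels, and the sign of `hD` meets the sign of the conjugate of i.
  by_cases hs : (Real.sqrt |(d : ℝ)| : ℂ) * E L.lattice 2 0 = 0
  · rw [show -I * (Real.sqrt |(d : ℝ)| : ℂ) * (μ ^ 2 * E L.lattice 2 0) = -I * μ ^ 2 *
      ((Real.sqrt |(d : ℝ)| : ℂ) * E L.lattice 2 0) by ring, mul_assoc I, hs]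
    simp
  · have h1 := left_ne_zero_of_mul hs
    have h2 := right_ne_zero_of_mul hs
    field_simp

/-! ### Real j-invariant: the lattice is homothetic to its conjugate -/

/-- The logarithmic derivative of an analytic function that is not locally zero. -/
lemma tendsto_sub_mul_deriv_div {y : ℂ → ℂ} {z₀ : ℂ} (hy : AnalyticAt ℂ y z₀)
    (h : ¬∀ᶠ z in 𝓝 z₀, y z = 0) : ∃ n : ℕ, (y z₀ = 0 → n ≠ 0) ∧ (∀ᶠ z in 𝓝[≠] z₀, y z ≠ 0) ∧
      Tendsto (fun z => (z - z₀) * deriv y z / y z) (𝓝[≠] z₀) (𝓝 n) := by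
  obtain ⟨n, g, hg, hg0, hev⟩ := (hy.exists_eventuallyEq_pow_smul_nonzero_iff).2 h
  have hgne : ∀ᶠ z in 𝓝 z₀, g z ≠ 0 := hg.continuousAt.eventually_ne hg0
  refine ⟨n, fun h0 hn => ?_, ?_, ?_⟩
  · have := hev.self_of_nhds
    rw [h0, hn, pow_zero, one_smul] at this
    exact hg0 this.symm
  · filter_upwards [hev.filter_mono nhdsWithin_le_nhds, hgne.filter_mono nhdsWithin_le_nhds,
      self_mem_nhdsWithin] with z hz hz2 hz3
    rw [hz, smul_eq_mul]
    exact mul_ne_zero (pow_ne_zero _ (sub_ne_zero.2 hz3)) hz2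
  · have hlim : Tendsto (fun z => (n : ℂ) + (z - z₀) * (deriv g z / g z)) (𝓝[≠] z₀)
        (𝓝 (n + (z₀ - z₀) * (deriv g z₀ / g z₀))) := by
      have hc : ContinuousAt (fun z => (n : ℂ) + (z - z₀) * (deriv g z / g z)) z₀ := by
        have h1 := hg.deriv.continuousAt
        have h2 := hg.continuousAt
        exact continuousAt_const.add ((continuousAt_id.sub continuousAt_const).mul
          (h1.div h2 hg0))
      exact hc.continuousWithinAt
    rw [sub_self, zero_mul, add_zero] at hlim
    refine hlim.congr' ?_
    filter_upwards [hev.eventually_nhds.filter_mono nhdsWithin_le_nhds,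
      hgne.filter_mono nhdsWithin_le_nhds,
      hg.eventually_analyticAt.filter_mono nhdsWithin_le_nhds, self_mem_nhdsWithin]
      with z hz hz2 hz3 hz4
    have hne : z - z₀ ≠ 0 := sub_ne_zero.2 hz4
    have hd : HasDerivAt y (n * (z - z₀) ^ (n - 1) * 1 * g z + (z - z₀) ^ n * deriv g z) z := by
      have h1 := (((hasDerivAt_id z).sub_const z₀).pow n).mul hz3.differentiableAt.hasDerivAt
      refine h1.congr_of_eventuallyEq ?_
      filter_upwards [hz] with w hw
      simpa using hw
    rw [hd.deriv, hz.self_of_nhds, smul_eq_mul]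
    have hpow : (z - z₀) * ((n : ℂ) * (z - z₀) ^ (n - 1)) = n * (z - z₀) ^ n := by
      rcases n with _ | n
      · simp
      · simp only [Nat.add_sub_cancel]; ring
    have hpn : (z - z₀) ^ n ≠ 0 := pow_ne_zero _ hne
    rw [eq_div_iff (mul_ne_zero hpn hz2)]
    field_simp
    linear_combination -(g z) * hpow

lemma countable_lattice (L : PeriodPair) : (L.lattice : Set ℂ).Countable := by
  rw [← Set.countable_coe_iff]
  exact L.latticeEquivProd.toEquiv.injective.countable

lemma isPreconnected_compl_lattice (L M : PeriodPair) :
    IsPreconnected ((L.lattice : Set ℂ) ∪ M.lattice)ᶜ :=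
  (((countable_lattice L).union (countable_lattice M)).isConnected_compl_of_one_lt_rank
    (rank_real_complex ▸ Nat.one_lt_ofNat)).isPreconnected

lemma tendsto_sq_mul_weierstrassP (L : PeriodPair) :
    Tendsto (fun z => z ^ 2 * L.weierstrassP z) (𝓝[≠] 0) (𝓝 1) := by
  have h1 : Tendsto (fun z : ℂ => z) (𝓝[≠] 0) (𝓝 0) := tendsto_id.mono_left nhdsWithin_le_nhds
  have h2 := ((h1.pow 2).mul (tendsto_weierstrassPExcept_zero L)).add_const 1
  simp only [ne_eq, OfNat.ofNat_ne_zero, not_false_eq_true, zero_pow, zero_mul, zero_add] at h2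
  refine h2.congr' ?_
  filter_upwards [self_mem_nhdsWithin] with z hz
  have hz' : z ≠ 0 := hz
  rw [weierstrassPExcept_zero_eq]
  field_simp
  ring

/-- The differential equation of `℘` in terms of its regular part at `0`. -/
lemma weierstrassPExcept_ode (L : PeriodPair) : ∀ᶠ z in 𝓝[≠] (0 : ℂ),
    -4 * z * deriv (L.weierstrassPExcept 0) z + z ^ 4 * deriv (L.weierstrassPExcept 0) z ^ 2 =
      12 * L.weierstrassPExcept 0 z + 12 * z ^ 2 * L.weierstrassPExcept 0 z ^ 2 +
      4 * z ^ 4 * L.weierstrassPExcept 0 z ^ 3 - L.g₂ * z ^ 2 -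
      L.g₂ * z ^ 4 * L.weierstrassPExcept 0 z - L.g₃ * z ^ 4 := by
  filter_upwards [eventually_notMem_lattice L 0, self_mem_nhdsWithin] with z hz hz0
  have hz' : z ≠ 0 := hz0
  have h1 : L.weierstrassPExcept 0 = fun z => L.weierstrassP z - (z ^ 2)⁻¹ :=
    funext fun z => weierstrassPExcept_zero_eq L z
  have hd : deriv (L.weierstrassPExcept 0) z = L.derivWeierstrassP z + 2 / z ^ 3 := by
    rw [h1]
    have h2 := (differentiableAt_weierstrassP L hz).hasDerivAt
    rw [L.deriv_weierstrassP] at h2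
    have h3 := ((hasDerivAt_pow 2 z).inv (pow_ne_zero 2 hz'))
    have h4 := (h2.sub h3).deriv
    refine Eq.trans ?_ (h4.trans ?_)
    · rfl
    · field_simp
      ring
  have hode := L.derivWeierstrassP_sq z hz
  have hp : L.weierstrassP z = L.weierstrassPExcept 0 z + (z ^ 2)⁻¹ := by
    rw [weierstrassPExcept_zero_eq]; ring
  have hp' : L.derivWeierstrassP z = deriv (L.weierstrassPExcept 0) z - 2 / z ^ 3 := by
    rw [hd]; ring
  rw [hp, hp'] at hode
  have h6 : z ^ 6 * (-4 * z * deriv (L.weierstrassPExcept 0) z +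
      z ^ 4 * deriv (L.weierstrassPExcept 0) z ^ 2) = z ^ 6 * (12 * L.weierstrassPExcept 0 z +
      12 * z ^ 2 * L.weierstrassPExcept 0 z ^ 2 +
      4 * z ^ 4 * L.weierstrassPExcept 0 z ^ 3 - L.g₂ * z ^ 2 -
      L.g₂ * z ^ 4 * L.weierstrassPExcept 0 z - L.g₃ * z ^ 4) := by
    have e1 : ∀ p : ℂ, z ^ 10 * (p - 2 / z ^ 3) ^ 2 = z ^ 10 * p ^ 2 - 4 * z ^ 7 * p + 4 * z ^ 4 :=
      fun p => by field_simp; ring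
    have e2 : ∀ p : ℂ, z ^ 10 * (4 * (p + (z ^ 2)⁻¹) ^ 3 - L.g₂ * (p + (z ^ 2)⁻¹) - L.g₃) =
        4 * z ^ 10 * p ^ 3 + 12 * z ^ 8 * p ^ 2 + 12 * z ^ 6 * p + 4 * z ^ 4 -
          L.g₂ * z ^ 10 * p - L.g₂ * z ^ 8 - L.g₃ * z ^ 10 :=
      fun p => by field_simp; ring
    linear_combination z ^ 10 * hode - e1 (deriv (L.weierstrassPExcept 0) z) +
      e2 (L.weierstrassPExcept 0 z)
  exact mul_left_cancel₀ (pow_ne_zero 6 hz') h6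

/-- The invariants `g₂` and `g₃` determine the lattice. -/
theorem lattice_le_of_g_eq {L M : PeriodPair} (h2 : L.g₂ = M.g₂) (h3 : L.g₃ = M.g₃) :
    L.lattice ≤ M.lattice := by
  set a := L.weierstrassPExcept 0 with ha
  set b := M.weierstrassPExcept 0 with hb
  have haa : AnalyticAt ℂ a 0 := L.analyticAt_weierstrassPExcept 0
  have hba : AnalyticAt ℂ b 0 := M.analyticAt_weierstrassPExcept 0
  have hloc : ∀ᶠ z in 𝓝 0, a z - b z = 0 := by
    by_contra hne
    -- Subtract the two differential equations, divide by a - b and let z tend to 0. If a - b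
    -- vanished to the finite order n, this would read -4n = 12, which is impossible; so a = b near
    -- 0.
    obtain ⟨n, -, hnz, hlim⟩ := tendsto_sub_mul_deriv_div (haa.sub hba) hne
    have hid : Tendsto (fun z : ℂ => z) (𝓝[≠] 0) (𝓝 0) := tendsto_id.mono_left nhdsWithin_le_nhds
    have ha0 : Tendsto a (𝓝[≠] 0) (𝓝 (a 0)) := haa.continuousAt.continuousWithinAt
    have hb0 : Tendsto b (𝓝[≠] 0) (𝓝 (b 0)) := hba.continuousAt.continuousWithinAt
    have ha1 : Tendsto (deriv a) (𝓝[≠] 0) (𝓝 (deriv a 0)) :=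
      haa.deriv.continuousAt.continuousWithinAt
    have hb1 : Tendsto (deriv b) (𝓝[≠] 0) (𝓝 (deriv b 0)) :=
      hba.deriv.continuousAt.continuousWithinAt
    have hl := (hlim.const_mul (-4)).add (((hid.pow 3).mul (ha1.add hb1)).mul hlim)
    have hr := (((hid.pow 2).mul (ha0.add hb0)).const_mul 12).add
      (((hid.pow 4).mul (((ha0.pow 2).add (ha0.mul hb0)).add (hb0.pow 2))).const_mul 4) |>.sub
      ((hid.pow 4).const_mul L.g₂) |>.const_add 12
    have heq := tendsto_nhds_unique (hl.congr' ?_) hr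
    · simp only [ne_eq, OfNat.ofNat_ne_zero, not_false_eq_true, zero_pow, zero_mul, mul_zero,
        add_zero, sub_zero] at heq
      have h5 : ((n : ℂ) + 3) = 0 := by linear_combination (-1 / 4 : ℂ) * heq
      have h6 : (((n + 3 : ℕ)) : ℂ) = 0 := by push_cast; exact h5
      exact absurd (Nat.cast_eq_zero.1 h6) (by omega)
    · filter_upwards [weierstrassPExcept_ode L, weierstrassPExcept_ode M, hnz,
        haa.eventually_analyticAt.filter_mono nhdsWithin_le_nhds,
        hba.eventually_analyticAt.filter_mono nhdsWithin_le_nhds] with z hz1 hz2 hz3 hz4 hz5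
      rw [← h2, ← h3] at hz2
      have hdz : deriv (a - b) z = deriv a z - deriv b z :=
        deriv_sub hz4.differentiableAt hz5.differentiableAt
      have hz3' : a z - b z ≠ 0 := hz3
      simp only [hdz, Pi.sub_apply, sub_zero]
      field_simp
      linear_combination hz1 - hz2
  set U : Set ℂ := ((L.lattice : Set ℂ) ∪ M.lattice)ᶜ with hU
  have hUiso : ∀ z, ∀ᶠ w in 𝓝[≠] z, w ∈ U := fun z => by
    filter_upwards [eventually_notMem_lattice L z, eventually_notMem_lattice M z] with w h1 h2 h
    exact h.elim h1 h2
  have hev : ∀ᶠ z in 𝓝[≠] (0 : ℂ), L.weierstrassP z = M.weierstrassP z := by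
    filter_upwards [hloc.filter_mono nhdsWithin_le_nhds] with z hz
    rw [ha, hb, weierstrassPExcept_zero_eq, weierstrassPExcept_zero_eq] at hz
    linear_combination hz
  obtain ⟨z₁, hz₁, hz₁U, hz₁0⟩ := ((eventually_eventually_nhdsWithin.2 hev).and
    ((hUiso 0).and self_mem_nhdsWithin)).exists
  rw [nhdsWithin_eq_nhds.2 (isOpen_compl_singleton.mem_nhds hz₁0)] at hz₁
  have heqU : Set.EqOn L.weierstrassP M.weierstrassP U :=
    AnalyticOnNhd.eqOn_of_preconnected_of_eventuallyEq
      (fun z hz => L.analyticOnNhd_weierstrassP z fun h => hz (Or.inl h))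
      (fun z hz => M.analyticOnNhd_weierstrassP z fun h => hz (Or.inr h))
      (isPreconnected_compl_lattice L M) hz₁U hz₁
  -- The lattice is the set of poles of ℘: at l in L but not in M, z²℘(l+z) would tend to 1 for L
  -- and to 0 for M.
  intro l hl
  by_contra hlM
  have h1 : Tendsto (fun z => z ^ 2 * M.weierstrassP (l + z)) (𝓝[≠] 0) (𝓝 (0 ^ 2 *
      M.weierstrassP (l + 0))) := by
    have hc : ContinuousAt M.weierstrassP (l + 0) := by
      rw [add_zero]
      exact (differentiableAt_weierstrassP M hlM).continuousAt
    have h6 : ContinuousAt (fun u => M.weierstrassP (l + u)) 0 :=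
      ContinuousAt.comp (f := fun u => l + u) hc (by fun_prop)
    have h7 : ContinuousAt (fun u => u ^ 2 * M.weierstrassP (l + u)) 0 :=
      (continuousAt_id.pow 2).mul h6
    exact h7.continuousWithinAt
  have h4 : Tendsto (fun z => l + z) (𝓝[≠] 0) (𝓝[≠] l) := by
    refine tendsto_nhdsWithin_iff.2 ⟨?_, ?_⟩
    · have : Tendsto (fun z => l + z) (𝓝 0) (𝓝 (l + 0)) :=
        (continuous_const.add continuous_id).tendsto 0
      rw [add_zero] at this
      exact this.mono_left nhdsWithin_le_nhds
    · filter_upwards [self_mem_nhdsWithin] with w hw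
      simpa using hw
  have h5 := tendsto_nhds_unique (h1.congr' ?_) (tendsto_sq_mul_weierstrassP L)
  · simp at h5
  · filter_upwards [h4.eventually (hUiso l)] with z hz
    rw [← heqU hz, add_comm l z, weierstrassP_add_mem L hl]

/-- Here ℘'² = 4(℘ - a)²(℘ + 2a). If ℘ - a vanished at w to order n ≥ 1, the square of (z - w)℘'/(℘
- a) would tend to n², while the equation makes it tend to 0. -/
lemma weierstrassP_ne_of_double_root {L : PeriodPair} {a w : ℂ} (h2 : L.g₂ = 12 * a ^ 2)
    (h3 : L.g₃ = -8 * a ^ 3) (hw : w ∉ L.lattice) : L.weierstrassP w ≠ a := by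
  intro hwa
  set y : ℂ → ℂ := fun z => L.weierstrassP z - a with hy
  have hPan : AnalyticAt ℂ L.weierstrassP w := L.analyticOnNhd_weierstrassP w hw
  have hya : AnalyticAt ℂ y w := hPan.sub analyticAt_const
  by_cases hloc : ∀ᶠ z in 𝓝 w, y z = 0
  · have heq : Set.EqOn L.weierstrassP (fun _ => a) ((L.lattice : Set ℂ) ∪ L.lattice)ᶜ :=
      AnalyticOnNhd.eqOn_of_preconnected_of_eventuallyEq
        (fun z hz => L.analyticOnNhd_weierstrassP z fun h => hz (Or.inl h))
        (fun z _ => analyticAt_const) (isPreconnected_compl_lattice L L)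
        (fun h => h.elim hw hw) (by filter_upwards [hloc] with z hz using sub_eq_zero.1 hz)
    have hlim : Tendsto (fun z : ℂ => z ^ 2 * a) (𝓝[≠] 0) (𝓝 (0 ^ 2 * a)) :=
      ((continuous_pow 2).mul continuous_const).continuousAt.continuousWithinAt
    have := tendsto_nhds_unique (hlim.congr' ?_) (tendsto_sq_mul_weierstrassP L)
    · simp at this
    · filter_upwards [eventually_notMem_lattice L 0] with z hz
      rw [heq (x := z) fun h => h.elim hz hz]
  · obtain ⟨n, hn, hnz, hlim⟩ := tendsto_sub_mul_deriv_div hya hloc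
    have hr : Tendsto (fun z => 4 * (z - w) ^ 2 * (y z + 3 * a)) (𝓝[≠] w)
        (𝓝 (4 * (w - w) ^ 2 * (y w + 3 * a))) := by
      have h5 : ContinuousAt (fun z => 4 * (z - w) ^ 2 * (y z + 3 * a)) w :=
        ContinuousAt.mul (by fun_prop) (hya.continuousAt.add continuousAt_const)
      exact h5.continuousWithinAt
    have heq := tendsto_nhds_unique ((hlim.pow 2).congr' ?_) hr
    · rw [sub_self] at heq
      have h5 : (n : ℂ) ^ 2 = 0 := by rw [heq]; ring
      exact hn (by simp [hy, hwa]) (Nat.cast_eq_zero.1 (pow_eq_zero_iff two_ne_zero |>.1 h5))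
    · filter_upwards [hnz, eventually_notMem_lattice L w] with z hz hzL
      have hd : deriv y z = L.derivWeierstrassP z := by
        rw [hy, deriv_sub_const, L.deriv_weierstrassP]
      have hode := L.derivWeierstrassP_sq z hzL
      rw [hd, div_pow, mul_pow, hode, h2, h3, div_eq_iff (pow_ne_zero 2 hz)]
      simp only [hy]
      ring

/-- The discriminant of a lattice does not vanish. -/
theorem discriminant_ne_zero (L : PeriodPair) : L.g₂ ^ 3 - 27 * L.g₃ ^ 2 ≠ 0 := by
  intro h0
  obtain ⟨a, h2, h3⟩ : ∃ a : ℂ, L.g₂ = 12 * a ^ 2 ∧ L.g₃ = -8 * a ^ 3 := by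
    by_cases hg : L.g₂ = 0
    · refine ⟨0, by simp [hg], ?_⟩
      rw [hg] at h0
      have : L.g₃ ^ 2 = 0 := by linear_combination (-1 / 27 : ℂ) * h0
      simpa using this
    -- The double root a is read off from g₃/g₂ = -8a³/(12a²) = -2a/3.
    · refine ⟨-3 * L.g₃ / (2 * L.g₂), ?_, ?_⟩
      · field_simp
        linear_combination 4 * h0
      · field_simp
        linear_combination 8 * L.g₃ * h0
  -- At a half period ℘' and E₁ vanish by oddness and periodicity. As ℘ never takes the double root
  -- a, its value there is the remaining root -2a.
  have hval : ∀ w : ℂ, w ∉ L.lattice → w + w ∈ L.lattice →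
      L.weierstrassP w = -2 * a ∧ E L.lattice 1 w = 0 := fun w hw hww => by
    have hp : L.derivWeierstrassP w = 0 := by
      have e := L.derivWeierstrassP_add_coe (-w) ⟨w + w, hww⟩
      rw [L.derivWeierstrassP_neg] at e
      simp only [neg_add_cancel_left] at e
      linear_combination (1 / 2 : ℂ) * e
    have hE : E L.lattice 1 w = 0 := by
      have e := E_add_mem L.lattice 1 (-w) hww
      rw [neg_add_cancel_left, E_one_lattice_neg] at e
      linear_combination (1 / 2 : ℂ) * e
    refine ⟨?_, hE⟩
    have hode := L.derivWeierstrassP_sq w hw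
    rw [hp, h2, h3] at hode
    have hne := sub_ne_zero.2 (weierstrassP_ne_of_double_root h2 h3 hw)
    have hf : (L.weierstrassP w - a) ^ 2 * (L.weierstrassP w + 2 * a) = 0 := by
      linear_combination (-1 / 4 : ℂ) * hode
    have := (mul_eq_zero.1 hf).resolve_left (pow_ne_zero 2 hne)
    linear_combination this
  have hu := L.ω₁_div_two_notMem_lattice
  have hv := L.ω₂_div_two_notMem_lattice
  have huv : L.ω₁ / 2 + L.ω₂ / 2 ∉ L.lattice := by
    have := (L.mul_ω₁_add_mul_ω₂_mem_lattice (α := 1 / 2) (β := 1 / 2)).not.mpr (by norm_num)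
    simpa [inv_mul_eq_div] using this
  have e1 : L.ω₁ / 2 + L.ω₁ / 2 ∈ L.lattice := by rw [add_halves]; exact L.ω₁_mem_lattice
  have e2 : L.ω₂ / 2 + L.ω₂ / 2 ∈ L.lattice := by rw [add_halves]; exact L.ω₂_mem_lattice
  have e3 : (L.ω₁ / 2 + L.ω₂ / 2) + (L.ω₁ / 2 + L.ω₂ / 2) ∈ L.lattice := by
    rw [add_add_add_comm]; exact L.lattice.add_mem e1 e2
  obtain ⟨p1, q1⟩ := hval _ hu e1
  obtain ⟨p2, q2⟩ := hval _ hv e2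
  obtain ⟨p3, q3⟩ := hval _ huv e3
  -- The addition theorem at the three half periods reads 0 = -6a. Then a = 0 is also the value -2a
  -- taken by ℘, contradicting the exclusion of a.
  have hadd := E_one_add_sq L hu hv huv
  rw [p1, p2, p3, q1, q2, q3] at hadd
  have ha : a = 0 := by linear_combination (1 / 6 : ℂ) * hadd
  exact weierstrassP_ne_of_double_root h2 h3 hu (by rw [p1, ha]; simp)

/-- The lattice `lam⁻¹ L`. -/
def scalePair (L : PeriodPair) {lam : ℂ} (hlam : lam ≠ 0) : PeriodPair where
  ω₁ := lam⁻¹ * L.ω₁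
  ω₂ := lam⁻¹ * L.ω₂
  indep := by
    have h := L.indep
    rw [LinearIndependent.pair_iff] at h ⊢
    refine fun s t hst => h s t ?_
    have e : s • L.ω₁ + t • L.ω₂ = lam * (s • (lam⁻¹ * L.ω₁) + t • (lam⁻¹ * L.ω₂)) := by
      simp only [real_smul]
      field_simp
    rw [e, hst, mul_zero]

lemma mem_scalePair {L : PeriodPair} {lam : ℂ} (hlam : lam ≠ 0) (z : ℂ) :
    lam * z ∈ L.lattice ↔ z ∈ (scalePair L hlam).lattice := by
  simp only [PeriodPair.mem_lattice]
  refine exists_congr fun m => exists_congr fun n => ?_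
  simp only [scalePair]
  constructor <;> intro h
  · apply mul_left_cancel₀ hlam
    rw [← h]
    field_simp
  · rw [← h]
    field_simp

lemma G_scalePair (L : PeriodPair) {lam : ℂ} (hlam : lam ≠ 0) (n : ℕ) :
    (scalePair L hlam).G n = lam ^ n * L.G n := by
  unfold PeriodPair.G
  rw [← (scaleEquiv hlam (mem_scalePair (L := L) hlam)).tsum_eq, ← tsum_mul_left]
  refine tsum_congr fun l => ?_
  change ((l : ℂ) ^ n)⁻¹ = lam ^ n * ((lam * (l : ℂ)) ^ n)⁻¹
  rw [mul_pow, mul_inv, mul_inv_cancel_left₀ (pow_ne_zero n hlam)]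

lemma G_conjPair (L : PeriodPair) (n : ℕ) : (conjPair L).G n = star (L.G n) := by
  unfold PeriodPair.G
  rw [tsum_star, ← (conjEquiv L).tsum_eq]
  refine tsum_congr fun l => ?_
  change ((star (l : ℂ)) ^ n)⁻¹ = _
  rw [star_inv₀, star_pow]

/-- Equal j-invariants mean that (ā, b̄) and (a, b) agree up to weights 4 and 6. When both numbers
are non-zero, λ² must be (b̄/b)/(ā/a); otherwise a single root extraction suffices. -/
lemma exists_star_eq_pow_mul {a b : ℂ} (hΔ : a ^ 3 - 27 * b ^ 2 ≠ 0)
    (h : a ^ 3 * star b ^ 2 = star a ^ 3 * b ^ 2) :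
    ∃ lam : ℂ, lam ≠ 0 ∧ star a = lam ^ 4 * a ∧ star b = lam ^ 6 * b := by
  by_cases ha : a = 0
  · have hb : b ≠ 0 := fun hb => hΔ (by simp [ha, hb])
    obtain ⟨lam, hl⟩ := IsAlgClosed.exists_pow_nat_eq (star b / b) (n := 6) (by norm_num)
    refine ⟨lam, fun h0 => ?_, by simp [ha], by rw [hl, div_mul_cancel₀ _ hb]⟩
    rw [h0, zero_pow (by norm_num)] at hl
    exact div_ne_zero (star_ne_zero.2 hb) hb hl.symm
  by_cases hb : b = 0
  · obtain ⟨lam, hl⟩ := IsAlgClosed.exists_pow_nat_eq (star a / a) (n := 4) (by norm_num)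
    refine ⟨lam, fun h0 => ?_, by rw [hl, div_mul_cancel₀ _ ha], by simp [hb]⟩
    rw [h0, zero_pow (by norm_num)] at hl
    exact div_ne_zero (star_ne_zero.2 ha) ha hl.symm
  have ha' : star a ≠ 0 := star_ne_zero.2 ha
  have hb' : star b ≠ 0 := star_ne_zero.2 hb
  obtain ⟨lam, hl⟩ := IsAlgClosed.exists_pow_nat_eq ((star b * a) / (b * star a)) (n := 2)
    (by norm_num)
  generalize star a = p at *
  generalize star b = q at *
  refine ⟨lam, fun h0 => ?_, ?_, ?_⟩
  · rw [h0, zero_pow (by norm_num)] at hl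
    exact div_ne_zero (mul_ne_zero hb' ha) (mul_ne_zero hb ha') hl.symm
  · rw [show lam ^ 4 = (lam ^ 2) ^ 2 by ring, hl]
    field_simp
    linear_combination -h
  · rw [show lam ^ 6 = (lam ^ 2) ^ 3 by ring, hl]
    field_simp
    linear_combination -h

/-- A lattice with real `j`-invariant is homothetic to its complex conjugate. -/
theorem exists_mul_mem_iff_star_mem {L : PeriodPair} (hj : ∃ x : ℝ, jInvariant L = (x : ℂ)) :
    ∃ lam : ℂ, lam ≠ 0 ∧ ∀ z : ℂ, lam * z ∈ L.lattice ↔ star z ∈ L.lattice := by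
  obtain ⟨x, hx⟩ := hj
  have hΔ := discriminant_ne_zero L
  have hΔ' : star L.g₂ ^ 3 - 27 * star L.g₃ ^ 2 ≠ 0 := by
    have := star_ne_zero.2 hΔ
    simpa using this
  have hreal : star (jInvariant L) = jInvariant L := by rw [hx]; exact conj_ofReal x
  have hstar : star (jInvariant L) =
      1728 * star L.g₂ ^ 3 / (star L.g₂ ^ 3 - 27 * star L.g₃ ^ 2) := by
    simp [jInvariant]
  rw [hstar, jInvariant, div_eq_div_iff hΔ' hΔ] at hreal
  -- The cubes cancel when the two fractions for j are cross-multiplied; the factor left over is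
  -- 1728 · 27 = 46656.
  obtain ⟨lam, hlam, ha, hb⟩ := exists_star_eq_pow_mul hΔ (by
    linear_combination (1 / 46656 : ℂ) * hreal)
  have h2 : (scalePair L hlam).g₂ = (conjPair L).g₂ := by
    have : star L.g₂ = 60 * star (L.G 4) := by simp [PeriodPair.g₂]
    rw [this] at ha
    simp only [PeriodPair.g₂] at ha ⊢
    rw [G_scalePair, G_conjPair, ha]
    ring
  have h3 : (scalePair L hlam).g₃ = (conjPair L).g₃ := by
    have : star L.g₃ = 140 * star (L.G 6) := by simp [PeriodPair.g₃]
    rw [this] at hb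
    simp only [PeriodPair.g₃] at hb ⊢
    rw [G_scalePair, G_conjPair, hb]
    ring
  refine ⟨lam, hlam, fun z => ?_⟩
  rw [mem_scalePair hlam, ← mem_conjPair]
  exact ⟨fun h => lattice_le_of_g_eq h2 h3 h, fun h => lattice_le_of_g_eq h2.symm h3.symm h⟩

end EllipticDedekind

end

/-! ### The main theorem -/

theorem theorem1 (L : PeriodPair) (hj : ∃ x : ℝ, EllipticDedekind.jInvariant L = (x : ℂ))
    (K : Type*) [Field K] [NumberField K] (hK : Module.finrank ℚ K = 2)
    (hKim : NumberField.IsTotallyComplex K)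
    (f : ℕ) (hf : 0 < f)
    (hO : EllipticDedekind.multiplierRing L.lattice =
      Subring.closure {(f : ℂ) * (((NumberField.discr K : ℤ) : ℂ) +
        Complex.I * (Real.sqrt |((NumberField.discr K : ℤ) : ℝ)| : ℂ)) / 2})
    (hZ : EllipticDedekind.multiplierRing L.lattice ≠ ⊥)
    (hi : EllipticDedekind.multiplierRing L.lattice ≠ Subring.closure {Complex.I})
    (hρ : EllipticDedekind.multiplierRing L.lattice ≠
      Subring.closure {(1 - Complex.I * (Real.sqrt 3 : ℂ)) / 2}) :
    (∀ a c : EllipticDedekind.multiplierRing L.lattice, c ≠ 0 →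
      ∃ x : ℝ, EllipticDedekind.normalizedD L.lattice ((f : ℤ) ^ 2 * NumberField.discr K) a c
        = (x : ℂ)) ∧
    Dense {x : ℝ | ∃ a c : EllipticDedekind.multiplierRing L.lattice, c ≠ 0 ∧
      EllipticDedekind.normalizedD L.lattice ((f : ℤ) ^ 2 * NumberField.discr K) a c
        = (x : ℂ)} := by
  obtain ⟨lam, hlam, h⟩ := EllipticDedekind.exists_mul_mem_iff_star_mem hj
  refine ⟨fun a c hc => EllipticDedekind.normalizedD_real L hlam h _ hc, ?_⟩
  have hd : NumberField.discr K ≠ 0 := NumberField.discr_ne_zero K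
  have hf' : f ≠ 0 := hf.ne'
  have hω : (f : ℂ) * (((NumberField.discr K : ℤ) : ℂ) +
      I * (Real.sqrt |((NumberField.discr K : ℤ) : ℝ)| : ℂ)) / 2 ∈
        EllipticDedekind.multiplierRing L.lattice := by
    rw [hO]
    exact Subring.subset_closure rfl
  -- The generator of the order has imaginary part f√|d_K|/2 ≠ 0; together with 1 it spans ℂ over ℝ,
  -- which is all the density argument uses of the order besides E₂(0) ≠ 0.
  refine EllipticDedekind.dense_normalizedD (EllipticDedekind.E_two_ne_zero hi hρ)
    (mul_ne_zero (pow_ne_zero 2 (by exact_mod_cast hf')) hd) hω ?_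
  have hs : Real.sqrt |((NumberField.discr K : ℤ) : ℝ)| ≠ 0 := by
    have : ((NumberField.discr K : ℤ) : ℝ) ≠ 0 := by exact_mod_cast hd
    positivity
  simp [hf', hs]
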